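/- **Conventions.** For a field $k$, a $k$-variety is a separated $k$-scheme of finite type, and $V(k)$ denotes the set of $k$-points of a $k$-variety $V$. The étale open topology $\mathscr E_k$ puts on each $V(k)$ the topology generated by the sets $f(X(k))$, where $f\colon X\to V$ is an étale morphism of $k$-varieties. Let $L/K$ be a finite field extension. If an $L$-variety $V$ has a Weil restriction $W=\operatorname{Res}_{L/K}V$ which is a $K$-variety (this is so for every quasi-projective $V$), the extension topology $\operatorname{Ext}_{L/K}(\mathscr E_K)$ on $V(L)$ is the $\mathscr E_K$-topology on $W(K)$, transported along the canonical bijection $W(K)=V(L)$. For an arbitrary $L$-variety $V$, a set $U\subseteq V(L)$ is $\operatorname{Ext}_{L/K}(\mathscr E_K)$-open if and only if $U\cap V'(L)$ is open in this topology on $V'(L)$ for every open subvariety $V'\subseteq V$ that has such a Weil restriction. **Theorem.** Let $R$ be a henselian regular local domain, $K$ its fraction field, and $L$ a finite field extension of $K$ such that the integral closure of $R$ in $L$ is not a finite $R$-module. Then $\operatorname{Ext}_{L/K}(\mathscr E_K)$ strictly refines $\mathscr E_L$: for every $L$-variety $V$, every $\mathscr E_L$-open subset of $V(L)$ is $\operatorname{Ext}_{L/K}(\mathscr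 E_K)$-open, and the two systems of topologies are different. In fact they already differ on the affine line: some subset of $\mathbb A^1(L)=L$ is $\operatorname{Ext}_{L/K}(\mathscr E_K)$-open but not $\mathscr E_L$-open. -/

import Mathlib

universe u v

namespace EtaleOpen

open CategoryTheory CategoryTheory.Limits AlgebraicGeometry

/-- A variety over the field `k`: a separated `k`-scheme of finite type, not necessarily
irreducible or reduced. -/
structure Variety (k : Type u) [Field k] where
  /-- the underlying scheme together with its structure morphism -/
  toOver : Over (Spec (CommRingCat.of k))
  isSeparated : IsSeparated toOver.hom
  locallyOfFiniteType : LocallyOfFiniteType toOver.hom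
  quasiCompact : QuasiCompact toOver.hom

/-- `Spec k` as a scheme over itself. -/
noncomputable abbrev point (k : Type u) [Field k] : Over (Spec (CommRingCat.of k)) :=
  Over.mk (𝟙 _)

/-- The set `V(k)` of `k`-rational points of a `k`-variety `V`: the `k`-morphisms
`Spec k ⟶ V`. -/
abbrev Variety.Points {k : Type u} [Field k] (V : Variety k) : Type u :=
  point k ⟶ V.toOver

/-- The affine line over `k`. -/
noncomputable def affineLine (k : Type u) [Field k] : Variety k where
  toOver := Over.mk (Spec.map (CommRingCat.ofHom (algebraMap k (Polynomial k))))
  isSeparated := by dsimp; infer_instance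
  locallyOfFiniteType := by
    dsimp
    rw [HasRingHomProperty.Spec_iff (P := @LocallyOfFiniteType)]
    exact (RingHom.finiteType_algebraMap (A := k) (B := Polynomial k)).mpr inferInstance
  quasiCompact := by dsimp; infer_instance

/-- A topology on `V(k)` for every `k`-variety `V`. -/
abbrev TopologyOnVarieties (k : Type u) [Field k] : Type (u + 1) :=
  (V : Variety k) → TopologicalSpace V.Points

/-- `T` refines `T'` if for every `k`-variety `V` every `T'`-open subset of `V(k)` is `T`-open.
(In Mathlib, `t ≤ t'` for topologies means that `t` is finer than `t'`.) -/
def Refines {k : Type u} [Field k] (T T' : TopologyOnVarieties k) : Prop :=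
  ∀ V : Variety k, T V ≤ T' V

/-- `T` strictly refines `T'` if `T` refines `T'` but `T'` does not refine `T`. -/
def StrictlyRefines {k : Type u} [Field k] (T T' : TopologyOnVarieties k) : Prop :=
  Refines T T' ∧ ¬ Refines T' T

/-- The étale open topology `ℰ_k`: the topology on `V(k)` generated by the étale images, i.e.
the images of `X(k) → V(k)` for étale morphisms of `k`-varieties `X ⟶ V`. -/
def etaleOpen (k : Type u) [Field k] : TopologyOnVarieties k := fun V =>
  TopologicalSpace.generateFrom
    {U : Set V.Points | ∃ (X : Variety k) (f : X.toOver ⟶ V.toOver),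
      Etale f.left ∧ U = Set.range (fun x : X.Points => x ≫ f)}

section Extension

variable (K L : Type u) [Field K] [Field L] [Algebra K L]

/-- The morphism `Spec L ⟶ Spec K` of a field extension `L / K`. -/
noncomputable abbrev specMap : Spec (CommRingCat.of L) ⟶ Spec (CommRingCat.of K) :=
  Spec.map (CommRingCat.ofHom (algebraMap K L))

/-- Base change `T ↦ T_L` from `K`-schemes to `L`-schemes. -/
noncomputable abbrev baseChange :
    Over (Spec (CommRingCat.of K)) ⥤ Over (Spec (CommRingCat.of L)) :=
  Over.pullback (specMap K L)

/-- The canonical isomorphism `Spec L ⟶ Spec K ×_K Spec L` of `L`-schemes. -/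
noncomputable def pointToBaseChange : point L ⟶ (baseChange K L).obj (point K) :=
  Over.homMk (pullback.lift (specMap K L) (𝟙 _) (by simp)) (pullback.lift_snd _ _ _)

variable {K L}

/-- `WeilRestriction V W` is the data exhibiting the `K`-variety `W` as the Weil restriction
`Res_{L/K} V` of the `L`-variety `V`: bijections `Hom_K(T, W) ≃ Hom_L(T_L, V)`, natural in the
`K`-scheme `T`. -/
abbrev WeilRestriction (V : Variety L) (W : Variety K) :=
  ((baseChange K L).op ⋙ yoneda.obj V.toOver).RepresentableBy W.toOver

/-- The canonical identification `W(K) → V(L)` if `W` is the Weil restriction of `V`: the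
bijection `Hom_K(Spec K, W) ≃ Hom_L((Spec K)_L, V)` followed by the identification of
`(Spec K)_L` with `Spec L`. -/
noncomputable def WeilRestriction.toPoint {V : Variety L} {W : Variety K}
    (h : WeilRestriction V W) (w : W.Points) : V.Points :=
  pointToBaseChange K L ≫ h.homEquiv w

variable (K L)

/-- The extension `Ext_{L/K}(T)` to `L` of a system of topologies `T` over `K`.

If the `L`-variety `V` has a Weil restriction `W` (for `L / K` finite this is so for every
quasi-projective `V`), this is the `T`-topology on `W(K)`, transported to `V(L)`. In general it
is glued from the open subvarieties of `V` which have a Weil restriction (these cover `V`, since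
affine varieties are quasi-projective): a set `U ⊆ V(L)` is open if and only if for all open
subvarieties `V'` of `V` and all Weil restrictions `W` of `V'` the set of points of `W(K)`
corresponding to points in `U ∩ V'(L)` is `T`-open. -/
noncomputable def ext (T : TopologyOnVarieties K) : TopologyOnVarieties L := fun V =>
  ⨆ (V' : Variety L) (j : V'.toOver ⟶ V.toOver) (_ : IsOpenImmersion j.left)
    (W : Variety K) (h : WeilRestriction V' W),
    TopologicalSpace.coinduced (fun w : W.Points => h.toPoint w ≫ j) (T W)

end Extension

end EtaleOpen

namespace EtaleOpen

open IsLocalRing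

/-- A regular system of parameters of a local ring: a family generating the maximal ideal whose
cardinality is the Krull dimension. -/
structure IsRegularSystem {R : Type*} [CommRing R] [IsLocalRing R] {ι : Type*} [Fintype ι]
    (x : ι → R) : Prop where
  span_range : Ideal.span (Set.range x) = maximalIdeal R
  dim : ringKrullDim R = Fintype.card ι

namespace IsRegularSystem

variable {R : Type*} [CommRing R] [IsLocalRing R] {ι : Type*} [Fintype ι] {x : ι → R}

lemma mem (h : IsRegularSystem x) (i : ι) : x i ∈ maximalIdeal R :=
  h.span_range ▸ Ideal.subset_span ⟨i, rfl⟩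

lemma span_image_le (h : IsRegularSystem x) (s : Set ι) :
    Ideal.span (x '' s) ≤ maximalIdeal R :=
  Ideal.span_le.mpr (by rintro _ ⟨i, -, rfl⟩; exact h.mem i)

lemma isRegularLocalRing [IsNoetherianRing R] (h : IsRegularSystem x) : IsRegularLocalRing R := by
  apply IsRegularLocalRing.of_spanFinrank_maximalIdeal_le
  rw [h.dim, ← h.span_range]
  have h1 := Submodule.spanFinrank_span_le_ncard_of_finite (R := R) (Set.finite_range x)
  have h2 : (Set.range x).ncard ≤ Fintype.card ι := by
    rw [← Set.image_univ]
    refine (Set.ncard_image_le Set.finite_univ).trans ?_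
    simp [Set.ncard_univ]
  exact_mod_cast h1.trans h2

lemma isLocalRing_quotient (h : IsRegularSystem x) (s : Set ι) :
    IsLocalRing (R ⧸ Ideal.span (x '' s)) :=
  haveI : Nontrivial (R ⧸ Ideal.span (x '' s)) := Ideal.Quotient.nontrivial_iff.mpr fun e ↦
    Ideal.IsPrime.ne_top' (top_le_iff.mp (e ▸ h.span_image_le s))
  IsLocalRing.of_surjective' _ Ideal.Quotient.mk_surjective

lemma quotient [IsNoetherianRing R] (h : IsRegularSystem x) (s : Set ι) [DecidablePred (· ∉ s)]
    [IsLocalRing (R ⧸ Ideal.span (x '' s))] :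
    IsRegularSystem (fun i : {i // i ∉ s} ↦ Ideal.Quotient.mk (Ideal.span (x '' s)) (x i)) := by
  classical
  have h1 : Ideal.span (Set.range fun i : {i // i ∉ s} ↦
      Ideal.Quotient.mk (Ideal.span (x '' s)) (x i)) = maximalIdeal _ := by
    have hs := Ideal.Quotient.mk_surjective (I := Ideal.span (x '' s))
    have := hs.isLocalHom
    rw [← Ideal.map_comap_of_surjective _ hs (maximalIdeal _), IsLocalRing.maximalIdeal_comap,
      ← h.span_range, Ideal.map_span]
    refine le_antisymm (Ideal.span_mono ?_) (Ideal.span_le.mpr ?_)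
    · rintro _ ⟨i, rfl⟩
      exact Set.mem_image_of_mem _ (Set.mem_range_self _)
    · rintro _ ⟨_, ⟨i, rfl⟩, rfl⟩
      by_cases hi : i ∈ s
      · rw [Ideal.Quotient.eq_zero_iff_mem.mpr (Ideal.subset_span (Set.mem_image_of_mem x hi))]
        exact Ideal.zero_mem _
      · exact Ideal.subset_span ⟨⟨i, hi⟩, rfl⟩
  refine ⟨h1, le_antisymm ?_ ?_⟩
  · have h3 := ringKrullDim_le_spanFinrank_maximalIdeal (R ⧸ Ideal.span (x '' s))
    refine h3.trans ?_
    rw [← h1]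
    have h1 := Submodule.spanFinrank_span_le_ncard_of_finite (R := R ⧸ Ideal.span (x '' s))
      (Set.finite_range fun i : {i // i ∉ s} ↦ Ideal.Quotient.mk (Ideal.span (x '' s)) (x i))
    have h2 : (Set.range fun i : {i // i ∉ s} ↦
        Ideal.Quotient.mk (Ideal.span (x '' s)) (x i)).ncard ≤ Fintype.card {i // i ∉ s} := by
      rw [← Set.image_univ]
      refine (Set.ncard_image_le Set.finite_univ).trans ?_
      simp [Set.ncard_univ]
    exact_mod_cast h1.trans h2
  · have h3 := ringKrullDim_le_ringKrullDim_quotient_add_encard (x '' s) (R := R)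
      ((Ideal.subset_span.trans (h.span_image_le s)).trans
        (by rw [IsLocalRing.ringJacobson_eq_maximalIdeal]))
    rw [h.dim] at h3
    have h4 : (x '' s).encard ≤ Fintype.card {i // i ∈ s} := by
      refine (Set.encard_image_le _ _).trans ?_
      rw [← Set.coe_fintypeCard]
    have h5 : Fintype.card ι = Fintype.card {i // i ∈ s} + Fintype.card {i // i ∉ s} := by
      rw [← Fintype.card_sum]
      exact Fintype.card_congr (Equiv.sumCompl (· ∈ s)).symm
    have h6 : (Fintype.card ι : WithBot ℕ∞) ≤ ringKrullDim (R ⧸ Ideal.span (x '' s)) +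
        (Fintype.card {i // i ∈ s} : ℕ) := h3.trans (by gcongr; exact_mod_cast h4)
    rw [h5, add_comm, Nat.cast_add] at h6
    exact (WithBot.add_le_add_iff_right' (WithBot.natCast_ne_bot _)
      (WithBot.coe_injective.ne (ENat.natCast_ne_top _))).mp h6

end IsRegularSystem

section

variable (R : Type*) [CommRing R] [IsRegularLocalRing R]

lemma exists_isRegularSystem : ∃ (s : Finset R), IsRegularSystem (fun i : s ↦ (i : R)) := by
  obtain ⟨s, hs, hs'⟩ := Submodule.FG.exists_span_finset_card_eq_spanFinrank
    (maximalIdeal R).fg_of_isNoetherianRing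
  refine ⟨s, ⟨?_, ?_⟩⟩
  · rw [← hs']
    simp [Ideal.span]
  · rw [← (isRegularLocalRing_iff R).mp inferInstance, ← hs]
    simp

lemma exists_ringKrullDim_eq : ∃ d : ℕ, ringKrullDim R = d :=
  ⟨_, ((isRegularLocalRing_iff R).mp inferInstance).symm⟩

variable {R}

/-- Every element of `𝔪 \ 𝔪²` belongs to a regular system of parameters. -/
lemma exists_isRegularSystem_of_notMem {π : R} (h : π ∈ maximalIdeal R)
    (h2 : π ∉ maximalIdeal R ^ 2) :
    ∃ (s : Set (CotangentSpace R)) (_ : Fintype s) (x : s → R) (i : s),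
      IsRegularSystem x ∧ x i = π := by
  classical
  set v : CotangentSpace R := (maximalIdeal R).toCotangent ⟨π, h⟩ with hv
  have hv0 : v ≠ 0 := by rwa [hv, Ne, Ideal.toCotangent_eq_zero]
  have hli : LinearIndepOn (ResidueField R) id {v} := .singleton hv0
  let b := Module.Basis.extend hli
  have : Fintype (hli.extend (Set.subset_univ _)) := FiniteDimensional.fintypeBasisIndex b
  have hsurj := (maximalIdeal R).toCotangent_surjective
  choose l hl using hsurj
  let i₀ : hli.extend (Set.subset_univ _) := ⟨v, hli.subset_extend _ rfl⟩
  let y : hli.extend (Set.subset_univ _) → maximalIdeal R :=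
    fun i ↦ if i = i₀ then ⟨π, h⟩ else l i
  have hy : ∀ i, (maximalIdeal R).toCotangent (y i) = i := by
    intro i
    by_cases hi : i = i₀
    · simp only [y, hi, if_true]
      rfl
    · simp only [y, hi, if_false, hl]
  refine ⟨_, this, fun i ↦ (y i : R), i₀, ⟨?_, ?_⟩, by simp [y]⟩
  · have h1 : Submodule.span R (Set.range y) = ⊤ := by
      rw [← CotangentSpace.span_image_eq_top_iff, ← Set.range_comp]
      have : (maximalIdeal R).toCotangent ∘ y = b := by
        ext i
        simp [b, hy]
      rw [this, b.span_eq]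
    have h3 := congr(Submodule.map (maximalIdeal R).subtype $h1)
    rw [Submodule.map_span, ← Set.range_comp, Submodule.map_top, Submodule.range_subtype] at h3
    exact h3
  · rw [← (IsRegularLocalRing.iff_finrank_cotangentSpace R).mp inferInstance,
      Module.finrank_eq_card_basis b]

end

lemma IsRegularSystem.isField {R : Type*} [CommRing R] [IsLocalRing R] {ι : Type*} [Fintype ι]
    {x : ι → R} (h : IsRegularSystem x) [IsEmpty ι] : IsField R := by
  rw [IsLocalRing.isField_iff_maximalIdeal_eq, ← h.span_range]
  simp

theorem isDomain_of_isRegularLocalRing (R : Type*) [CommRing R] [IsRegularLocalRing R] :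
    IsDomain R := by
  classical
  obtain ⟨d, hd⟩ := exists_ringKrullDim_eq R
  induction d using Nat.strong_induction_on generalizing R with
  | _ d ih =>
  by_cases hR : IsField R
  · exact hR.isDomain
  -- choose a parameter outside all minimal primes
  have h1 : ∃ π ∈ maximalIdeal R, π ∉ maximalIdeal R ^ 2 ∧ ∀ p ∈ minimalPrimes R, π ∉ p := by
    by_contra! hcon
    have hfin : (minimalPrimes R).Finite := minimalPrimes.finite_of_isNoetherianRing R
    have h2 : (maximalIdeal R : Set R) ⊆ ⋃ i ∈ insert (maximalIdeal R ^ 2) (minimalPrimes R),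
        ((i : Ideal R) : Set R) := by
      intro y hy
      by_cases hy2 : y ∈ maximalIdeal R ^ 2
      · exact Set.mem_biUnion (Set.mem_insert _ _) hy2
      · obtain ⟨p, hp, hyp⟩ := hcon y hy hy2
        exact Set.mem_biUnion (Set.mem_insert_of_mem _ hp) hyp
    obtain ⟨p, hp, hle⟩ := (Ideal.subset_union_prime_finite (hfin.insert _)
      (maximalIdeal R ^ 2) (maximalIdeal R ^ 2)
      (fun i hi hi1 _ ↦ ((Set.mem_insert_iff.mp hi).resolve_left hi1).1.1)).mp h2
    have hmin : maximalIdeal R ∉ minimalPrimes R := by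
      intro hm
      have h0 : ringKrullDim R = 0 := by
        rw [← maximalIdeal_height_eq_ringKrullDim, Ideal.height_eq_zero_iff.mpr hm]
        rfl
      obtain ⟨s, hs⟩ := exists_isRegularSystem R
      have := hs.dim
      rw [h0] at this
      have : Fintype.card s = 0 := by exact_mod_cast this.symm
      have := Fintype.card_eq_zero_iff.mp this
      exact hR hs.isField
    rcases Set.mem_insert_iff.mp hp with rfl | hp
    · have := Ideal.isIdempotentElem_iff_eq_bot_or_top_of_isLocalRing (maximalIdeal R)
      rcases this.mp (le_antisymm (Ideal.mul_le_left) (by rwa [← pow_two])) with h | h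
      · exact hR (IsLocalRing.isField_iff_maximalIdeal_eq.mpr h)
      · exact Ideal.IsPrime.ne_top' h
    · have : p = maximalIdeal R :=
        le_antisymm (IsLocalRing.le_maximalIdeal hp.1.1.ne_top) hle
      exact hmin (this ▸ hp)
  obtain ⟨π, hπ, hπ2, hπp⟩ := h1
  obtain ⟨s, _, x, i, hx, rfl⟩ := exists_isRegularSystem_of_notMem hπ hπ2
  have := hx.isLocalRing_quotient {i}
  have hq := hx.quotient {i}
  have := hq.isRegularLocalRing
  have hlt : Fintype.card {j // j ∉ ({i} : Set s)} < d := by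
    have h1 : (Fintype.card s : WithBot ℕ∞) = d := by rw [← hx.dim, hd]
    have h2 : Fintype.card s = d := by exact_mod_cast h1
    rw [← h2]
    exact Fintype.card_subtype_lt (x := i) (by simp)
  have hdom := ih _ hlt _ hq.dim
  rw [Set.image_singleton, Ideal.Quotient.isDomain_iff_prime] at hdom
  obtain ⟨p, hp, hpx⟩ := Ideal.exists_minimalPrimes_le (I := ⊥) (J := Ideal.span {x i}) bot_le
  have hxp := hπp p hp
  have hbot : p = ⊥ := by
    refine Submodule.eq_bot_of_le_smul_of_le_jacobson_bot (Ideal.span {x i}) p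
      (IsNoetherian.noetherian p) ?_ ?_
    · intro u hu
      obtain ⟨v, rfl⟩ := Ideal.mem_span_singleton.mp (hpx hu)
      exact Submodule.smul_mem_smul (Ideal.mem_span_singleton_self _)
        ((hp.1.1.mem_or_mem hu).resolve_left hxp)
    · rw [IsLocalRing.jacobson_eq_maximalIdeal _ bot_ne_top, Ideal.span_le]
      simpa using hx.mem i
  have := hp.1.1
  rw [hbot] at this
  exact IsDomain.of_bot_isPrime R

namespace IsRegularSystem

variable {R : Type*} [CommRing R] [IsLocalRing R] [IsNoetherianRing R] {ι : Type*} [Fintype ι]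
  {x : ι → R}

lemma isPrime_span (h : IsRegularSystem x) (s : Set ι) : (Ideal.span (x '' s)).IsPrime := by
  classical
  have := h.isLocalRing_quotient s
  have := (h.quotient s).isRegularLocalRing
  rw [← Ideal.Quotient.isDomain_iff_prime]
  exact isDomain_of_isRegularLocalRing _

lemma notMem_span (h : IsRegularSystem x) {s : Set ι} {i : ι} (hi : i ∉ s) :
    x i ∉ Ideal.span (x '' s) := by
  classical
  intro hmem
  have h1 : ringKrullDim (R ⧸ Ideal.span (x '' s)) =
      ringKrullDim (R ⧸ Ideal.span (x '' (insert i s))) := by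
    refine ringKrullDim_eq_of_ringEquiv (Ideal.quotEquivOfEq ?_)
    rw [Set.image_insert_eq, Ideal.span_insert, eq_comm, sup_eq_right,
      Ideal.span_singleton_le_iff_mem]
    exact hmem
  have := h.isLocalRing_quotient s
  have := h.isLocalRing_quotient (insert i s)
  rw [(h.quotient s).dim, (h.quotient (insert i s)).dim] at h1
  have h2 : Fintype.card {j // j ∉ s} = Fintype.card {j // j ∉ insert i s} := by
    exact_mod_cast h1
  refine (Fintype.card_lt_of_injective_of_notMem
    (fun j : {j // j ∉ insert i s} ↦ (⟨j, fun hj ↦ j.2 (Set.mem_insert_of_mem _ hj)⟩ :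
      {j // j ∉ s})) (fun a b hab ↦ Subtype.ext (by simpa using hab)) (b := ⟨i, hi⟩) ?_).ne' h2
  rintro ⟨j, hj⟩
  have : (j : ι) = i := by simpa using hj
  exact j.2 (Set.mem_insert_iff.mpr (Or.inl this))

lemma prime [IsDomain R] (h : IsRegularSystem x) (i : ι) : Prime (x i) := by
  have h1 := h.isPrime_span {i}
  rw [Set.image_singleton] at h1
  refine (Ideal.span_singleton_prime ?_).mp h1
  have := h.notMem_span (s := ∅) (i := i) (by simp)
  simpa using this

lemma notMem_sq (h : IsRegularSystem x) (i : ι) : x i ∉ maximalIdeal R ^ 2 := by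
  intro hmem
  have h1 : maximalIdeal R ≤ Ideal.span (x '' {i}ᶜ) ⊔ maximalIdeal R • maximalIdeal R := by
    conv_lhs => rw [← h.span_range]
    rw [Ideal.span_le]
    rintro _ ⟨j, rfl⟩
    by_cases hj : j = i
    · subst hj
      exact Ideal.mem_sup_right (by rwa [smul_eq_mul, ← pow_two])
    · exact Ideal.mem_sup_left (Ideal.subset_span ⟨j, hj, rfl⟩)
  have h2 := Submodule.le_of_le_smul_of_le_jacobson_bot
    ((maximalIdeal R).fg_of_isNoetherianRing)
    (IsLocalRing.jacobson_eq_maximalIdeal _ bot_ne_top).ge h1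
  exact h.notMem_span (s := {i}ᶜ) (by simp) (h2 (h.mem i))

end IsRegularSystem

/-- `R` is completely integrally closed, stated without reference to its fraction field. -/
def IsCompletelyClosed (R : Type*) [CommRing R] : Prop :=
  ∀ f g c : R, c ≠ 0 → g ≠ 0 → (∀ n : ℕ, g ^ n ∣ c * f ^ n) → g ∣ f

lemma IsCompletelyClosed.isIntegrallyClosed {R : Type*} [CommRing R] [IsDomain R]
    (h : IsCompletelyClosed R) : IsIntegrallyClosed R := by
  rw [isIntegrallyClosed_iff (FractionRing R)]
  intro z hz
  obtain ⟨c, hc, hn⟩ := hz.isAlmostIntegral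
  obtain ⟨f, g, hg, rfl⟩ := IsFractionRing.div_surjective (A := R) z
  have hg0 := nonZeroDivisors.ne_zero hg
  have hg1 : algebraMap R (FractionRing R) g ≠ 0 := by simpa using hg0
  obtain ⟨k, hk⟩ := h f g c (nonZeroDivisors.ne_zero hc) hg0 (fun n ↦ by
    obtain ⟨y, hy⟩ := hn n
    refine ⟨y, IsFractionRing.injective R (FractionRing R) ?_⟩
    rw [map_mul, map_mul, map_pow, map_pow, hy, Algebra.smul_def, div_pow]
    field_simp)
  exact ⟨k, by rw [hk, map_mul]; field_simp⟩

lemma isCompletelyClosed_of_field {R : Type*} [CommRing R] (hR : IsField R) :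
    IsCompletelyClosed R := fun f g _ _ hg _ ↦ by
  obtain ⟨b, hb⟩ := hR.mul_inv_cancel hg
  exact ⟨b * f, by rw [← mul_assoc, hb, one_mul]⟩

lemma IsCompletelyClosed.of_prime {R : Type*} [CommRing R] [IsDomain R] [IsLocalRing R]
    [IsNoetherianRing R] {x : R} (hx : Prime x)
    (h : IsCompletelyClosed (R ⧸ Ideal.span {x})) : IsCompletelyClosed R := by
  have hfin : ∀ {a : R}, a ≠ 0 → ∃ (n : ℕ) (b : R), ¬ x ∣ b ∧ a = x ^ n * b := fun {a} ha ↦ by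
    have := FiniteMultiplicity.of_not_isUnit hx.not_isUnit ha
    obtain ⟨b, hb, hb'⟩ := this.exists_eq_pow_mul_and_not_dvd
    exact ⟨_, b, hb', hb⟩
  have hq : ∀ a : R, Ideal.Quotient.mk (Ideal.span {x}) a = 0 ↔ x ∣ a := fun a ↦ by
    rw [Ideal.Quotient.eq_zero_iff_mem, Ideal.mem_span_singleton]
  -- the case where `x` does not divide `g`
  have key : ∀ g c : R, c ≠ 0 → ¬ x ∣ g → ∀ m : ℕ, ∀ f : R, (∀ n : ℕ, g ^ n ∣ c * f ^ n) →
      f ∈ Ideal.span {g} ⊔ maximalIdeal R ^ m := by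
    intro g c hc hg m
    induction m with
    | zero => simp
    | succ m ih =>
      intro f hf
      obtain ⟨s, c', hc', rfl⟩ := hfin hc
      have hxg : ∀ n k : ℕ, ∀ u : R, g ^ n ∣ x ^ k * u → g ^ n ∣ u := by
        rintro n k u ⟨q, hq⟩
        have : x ^ k ∣ q := hx.pow_dvd_of_dvd_mul_left k (fun hd ↦ hg (hx.dvd_of_dvd_pow hd))
          ⟨u, hq.symm⟩
        obtain ⟨r, rfl⟩ := this
        exact ⟨r, mul_left_cancel₀ (pow_ne_zero k hx.ne_zero) (by rw [hq]; ring)⟩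
      have h1 := h (Ideal.Quotient.mk _ f) (Ideal.Quotient.mk _ g) (Ideal.Quotient.mk _ c')
        (by rwa [Ne, hq]) (by rwa [Ne, hq]) (fun n ↦ by
          rw [← map_pow, ← map_pow, ← map_mul]
          exact map_dvd _ (hxg n s _ (by rw [← mul_assoc]; exact hf n)))
      obtain ⟨k, hk⟩ := h1
      obtain ⟨k, rfl⟩ := Ideal.Quotient.mk_surjective k
      rw [← map_mul, ← sub_eq_zero, ← map_sub, hq] at hk
      obtain ⟨f₁, hf₁⟩ := hk
      have h2 := ih f₁ (fun n ↦ hxg n n _ (by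
        have : x ^ n * (x ^ s * c' * f₁ ^ n) = x ^ s * c' * (f - g * k) ^ n := by rw [hf₁]; ring
        rw [this, sub_eq_add_neg, add_pow, Finset.mul_sum]
        refine Finset.dvd_sum fun i hi ↦ ?_
        have hi' : i ≤ n := Nat.lt_succ_iff.mp (Finset.mem_range.mp hi)
        obtain ⟨q, hq⟩ := hf i
        refine ⟨q * (-k) ^ (n - i) * (n.choose i), ?_⟩
        calc _ = (x ^ s * c' * f ^ i) * (-(g * k)) ^ (n - i) * (n.choose i) := by ring
          _ = g ^ (i + (n - i)) * (q * (-k) ^ (n - i) * (n.choose i)) := by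
            rw [hq, pow_add]; ring
          _ = _ := by rw [Nat.add_sub_cancel' hi']))
      have h3 : f = g * k + x * f₁ := by rw [← hf₁]; ring
      rw [h3]
      refine Ideal.add_mem _ (Ideal.mem_sup_left (Ideal.mul_mem_right _ _
        (Ideal.mem_span_singleton_self g))) ?_
      obtain ⟨a, ha, b, hb, hab⟩ := Submodule.mem_sup.mp h2
      rw [← hab, mul_add]
      refine Ideal.add_mem _ (Ideal.mem_sup_left (Ideal.mul_mem_left _ _ ha))
        (Ideal.mem_sup_right ?_)
      rw [pow_succ']
      exact Ideal.mul_mem_mul ((mem_maximalIdeal _).mpr hx.not_isUnit) hb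
  have key' : ∀ g c f : R, c ≠ 0 → ¬ x ∣ g → (∀ n : ℕ, g ^ n ∣ c * f ^ n) → g ∣ f := by
    intro g c f hc hg hf
    by_cases hu : IsUnit g
    · exact hu.dvd
    have hle : Ideal.span {g} ≠ ⊤ := by rwa [Ne, Ideal.span_singleton_eq_top]
    have : Nontrivial (R ⧸ Ideal.span {g}) := Ideal.Quotient.nontrivial_iff.mpr hle
    have : IsLocalRing (R ⧸ Ideal.span {g}) :=
      IsLocalRing.of_surjective' _ Ideal.Quotient.mk_surjective
    rw [← Ideal.mem_span_singleton, ← Ideal.Quotient.eq_zero_iff_mem, ← Ideal.mem_bot,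
      ← Ideal.iInf_pow_eq_bot_of_isLocalRing (maximalIdeal (R ⧸ Ideal.span {g}))
        Ideal.IsPrime.ne_top', Ideal.mem_iInf]
    intro m
    obtain ⟨a, ha, b, hb, hab⟩ := Submodule.mem_sup.mp (key g c hc hg m f hf)
    rw [← hab, map_add, Ideal.Quotient.eq_zero_iff_mem.mpr ha, zero_add]
    have := Ideal.mem_map_of_mem (Ideal.Quotient.mk (Ideal.span {g})) hb
    rw [Ideal.map_pow] at this
    refine Ideal.pow_right_mono (Ideal.map_le_iff_le_comap.mpr ?_) m this
    intro y hy
    have := Ideal.Quotient.mk_surjective (I := Ideal.span {g}) |>.isLocalHom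
    exact map_nonunit _ y hy
  intro f g c hc hg hf
  by_cases hf0 : f = 0
  · simp [hf0]
  obtain ⟨s, g', hg', rfl⟩ := hfin hg
  obtain ⟨u, f', hf', rfl⟩ := hfin hf0
  obtain ⟨t, c', hc', rfl⟩ := hfin hc
  have hsu : s ≤ u := by
    by_contra! hlt
    have h1 : x ^ (s * (t + 1)) ∣ x ^ (t + u * (t + 1)) * (c' * f' ^ (t + 1)) := by
      refine (Dvd.intro (g' ^ (t + 1)) ?_).trans ((hf (t + 1)).trans (dvd_of_eq ?_))
      · rw [mul_pow, pow_mul]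
      · rw [mul_pow, ← pow_mul, pow_add x]; ring
    have h2 := hx.pow_dvd_of_dvd_mul_right _ (fun hd ↦ (hx.dvd_or_dvd hd).elim hc'
      (fun hd ↦ hf' (hx.dvd_of_dvd_pow hd))) h1
    rw [pow_dvd_pow_iff hx.ne_zero hx.not_isUnit] at h2
    nlinarith
  obtain ⟨v, rfl⟩ := Nat.exists_eq_add_of_le hsu
  rw [pow_add, mul_assoc]
  refine mul_dvd_mul_left _ (key' g' _ _ hc hg' fun n ↦ ?_)
  have := hf n
  rw [mul_pow, pow_add, mul_assoc (x ^ s), mul_pow (x ^ s) (x ^ v * f'), mul_left_comm] at this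
  exact (mul_dvd_mul_iff_left (pow_ne_zero _ (pow_ne_zero _ hx.ne_zero))).mp this

theorem isCompletelyClosed_of_isRegularLocalRing (R : Type*) [CommRing R] [IsRegularLocalRing R] :
    IsCompletelyClosed R := by
  classical
  obtain ⟨d, hd⟩ := exists_ringKrullDim_eq R
  induction d using Nat.strong_induction_on generalizing R with
  | _ d ih =>
  have := isDomain_of_isRegularLocalRing R
  obtain ⟨s, hs⟩ := exists_isRegularSystem R
  rcases isEmpty_or_nonempty s with _ | ⟨⟨i⟩⟩
  · exact isCompletelyClosed_of_field hs.isField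
  have := hs.isLocalRing_quotient {i}
  have hq := hs.quotient {i}
  have := hq.isRegularLocalRing
  have hlt : Fintype.card {j // j ∉ ({i} : Set s)} < d := by
    have h1 : (Fintype.card s : WithBot ℕ∞) = d := by rw [← hs.dim, hd]
    have h2 : Fintype.card s = d := by exact_mod_cast h1
    rw [← h2]
    exact Fintype.card_subtype_lt (x := i) (by simp)
  have h := ih _ hlt _ hq.dim
  rw [Set.image_singleton] at h
  exact .of_prime (hs.prime i) h

lemma isIntegrallyClosed_of_isRegularLocalRing (R : Type*) [CommRing R] [IsRegularLocalRing R] :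
    IsIntegrallyClosed R :=
  haveI := isDomain_of_isRegularLocalRing R
  (isCompletelyClosed_of_isRegularLocalRing R).isIntegrallyClosed

end EtaleOpen

universe w

namespace EtaleOpen

open IsLocalRing

section FermatCurve

open Polynomial

/-- The Fermat curve has no non-constant points in a rational function field in one variable. -/
lemma fermat_const_one {F G : Type*} [Field F] [Field G] [Algebra F[X] G] [IsFractionRing F[X] G]
    {n : ℕ} (hn : 3 ≤ n) (hF : (n : F) ≠ 0) {z y : G} (h : y ^ n = 1 + z ^ n) :
    (∃ c : F, z = algebraMap F[X] G (C c)) ∧ ∃ c : F, y = algebraMap F[X] G (C c) := by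
  have hn0 : n ≠ 0 := by lia
  have hinj : Function.Injective (algebraMap F[X] G) := IsFractionRing.injective _ _
  have hroot : ∀ (w : G) (c : F), w ^ n = algebraMap F[X] G (C c) →
      ∃ c : F, w = algebraMap F[X] G (C c) := by
    intro w c hw
    have hint : IsIntegral F[X] w := .of_pow (Nat.pos_of_ne_zero hn0) (hw ▸ isIntegral_algebraMap)
    obtain ⟨p, rfl⟩ := IsIntegrallyClosed.isIntegral_iff.mp hint
    rw [← map_pow] at hw
    have h1 := congr(natDegree $(hinj hw))
    rw [natDegree_pow, natDegree_C, Nat.mul_eq_zero, or_iff_right hn0] at h1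
    exact ⟨_, by rw [← eq_C_of_natDegree_eq_zero h1]⟩
  suffices hz : ∃ c : F, z = algebraMap F[X] G (C c) by
    refine ⟨hz, ?_⟩
    obtain ⟨c, rfl⟩ := hz
    exact hroot y (1 + c ^ n) (by rw [h]; simp)
  classical
  obtain ⟨d, hd⟩ := IsLocalization.exist_integer_multiples_of_finset (nonZeroDivisors F[X])
    ({z, y} : Finset G)
  obtain ⟨a, ha⟩ := hd z (by simp)
  obtain ⟨c, hc⟩ := hd y (by simp)
  obtain ⟨b, hb⟩ := d
  have hb0 := nonZeroDivisors.ne_zero hb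
  have hb1 : algebraMap F[X] G b ≠ 0 := by simpa using hb0
  simp only [Algebra.smul_def] at ha hc
  have heq : a ^ n + b ^ n = c ^ n := hinj (by
    rw [map_add, map_pow, map_pow, map_pow, ha, hc, mul_pow, mul_pow, h]; ring)
  by_cases ha0 : a = 0
  · have : z = 0 := by simpa [ha0, hb1] using ha
    exact ⟨0, by simp [this]⟩
  by_cases hc0 : c = 0
  · have : y = 0 := by simpa [hc0, hb1] using hc
    refine hroot z (-1) ?_
    simp only [map_neg, map_one]
    linear_combination -h + congr($this ^ n) + zero_pow (M₀ := G) hn0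
  obtain ⟨e, a', b', c', ⟨rfl, rfl, -⟩, ha', hb', -⟩ :=
    fermatLastTheoremWith'_polynomial hn hF a b c ha0 hb0 hc0 heq
  obtain ⟨u, hu, rfl⟩ := Polynomial.isUnit_iff.mp ha'
  obtain ⟨v, hv, rfl⟩ := Polynomial.isUnit_iff.mp hb'
  have he1 : algebraMap F[X] G e ≠ 0 := by
    intro he
    exact hb1 (by rw [map_mul, he, mul_zero])
  have hv1 : algebraMap F[X] G (C v) ≠ 0 := by
    intro he
    exact hb1 (by rw [map_mul, he, zero_mul])
  refine ⟨u / v, mul_left_cancel₀ hb1 ?_⟩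
  rw [← ha, ← map_mul]
  congr 1
  rw [mul_right_comm, ← C_mul, mul_div_cancel₀ _ hv.ne_zero]

/-- The Fermat curve has no non-constant points in a purely transcendental extension. -/
lemma fermat_const {k : Type w} [Field k] {n : ℕ} (hn : 3 ≤ n) (hk : (n : k) ≠ 0) (m : ℕ)
    {G : Type w} [Field G] [Algebra (MvPolynomial (Fin m) k) G]
    [IsFractionRing (MvPolynomial (Fin m) k) G] {z y : G} (h : y ^ n = 1 + z ^ n) :
    (∃ c : k, z = algebraMap (MvPolynomial (Fin m) k) G (MvPolynomial.C c)) ∧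
      ∃ c : k, y = algebraMap (MvPolynomial (Fin m) k) G (MvPolynomial.C c) := by
  induction m generalizing G with
  | zero =>
    have hsurj : ∀ w : G, ∃ c : k,
        w = algebraMap (MvPolynomial (Fin 0) k) G (MvPolynomial.C c) := by
      intro w
      obtain ⟨a, b, hb, rfl⟩ := IsFractionRing.div_surjective (A := MvPolynomial (Fin 0) k) w
      obtain ⟨a, rfl⟩ := MvPolynomial.C_surjective (Fin 0) a
      obtain ⟨b, rfl⟩ := MvPolynomial.C_surjective (Fin 0) b
      have hb0 : b ≠ 0 := by
        rintro rfl
        exact nonZeroDivisors.ne_zero hb (map_zero _)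
      have hb1 : algebraMap (MvPolynomial (Fin 0) k) G (MvPolynomial.C b) ≠ 0 := by
        simpa using hb0
      refine ⟨a / b, ?_⟩
      rw [div_eq_iff hb1, ← map_mul, ← map_mul, div_mul_cancel₀ _ hb0]
    exact ⟨hsurj z, hsurj y⟩
  | succ m ih =>
    let F := FractionRing (MvPolynomial (Fin m) k)
    let G₀ := FractionRing F[X]
    let j : MvPolynomial (Fin (m + 1)) k →+* G₀ := (algebraMap F[X] G₀).comp
      ((mapRingHom (algebraMap (MvPolynomial (Fin m) k) F)).comp
        (MvPolynomial.finSuccEquiv k m : _ →+* _))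
    have hj : Function.Injective j := (IsFractionRing.injective F[X] G₀).comp
      ((Polynomial.map_injective _ (IsFractionRing.injective _ _)).comp
        (MvPolynomial.finSuccEquiv k m).injective)
    have hjC : ∀ c : k, j (MvPolynomial.C c) =
        algebraMap F[X] G₀ (C (algebraMap (MvPolynomial (Fin m) k) F (MvPolynomial.C c))) := by
      intro c
      have h1 := congr($(MvPolynomial.finSuccEquiv_comp_C_eq_C (R := k) m) c)
      have h2 : MvPolynomial.finSuccEquiv k m (MvPolynomial.C c) = C (MvPolynomial.C c) :=
        ((AlgEquiv.symm_apply_eq _).mp h1).symm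
      simp only [j, RingHom.comp_apply, RingHom.coe_coe, coe_mapRingHom, h2, map_C]
    let l : G →+* G₀ := IsFractionRing.lift hj
    have hl : ∀ p, l (algebraMap (MvPolynomial (Fin (m + 1)) k) G p) = j p :=
      fun p ↦ IsFractionRing.lift_algebraMap hj p
    have hF : (n : F) ≠ 0 := by
      rw [← map_natCast ((algebraMap (MvPolynomial (Fin m) k) F).comp MvPolynomial.C), Ne,
        map_eq_zero]
      exact hk
    obtain ⟨⟨c, hc⟩, ⟨e, he⟩⟩ := fermat_const_one hn hF (z := l z) (y := l y)
      (by rw [← map_pow, h]; simp)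
    obtain ⟨⟨c', rfl⟩, ⟨e', rfl⟩⟩ := ih (z := c) (y := e) (by
      have := congr(l $h)
      rw [map_pow, map_add, map_one, map_pow, hc, he] at this
      refine ((algebraMap F[X] G₀).comp C).injective ?_
      simpa using this)
    exact ⟨⟨c', l.injective (by rw [hc, hl, hjC])⟩, ⟨e', l.injective (by rw [he, hl, hjC])⟩⟩

end FermatCurve

section BlowUp

open Polynomial

/-- If `y` is a nonzerodivisor modulo `x`, then a polynomial over `D` whose value at `y / x` is
divisible by `x` has coefficients in the ideal `(x, y)`. Here `D` need not inject into `K`, and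
ideals are pulled back from the image of `D`. -/
lemma coeff_mem_of_eval₂_div_eq_zero {D K : Type*} [CommRing D] [Field K] (ψ : D →+* K) {x y : D}
    (hx : ψ x ≠ 0) (J : Ideal D) (hJ : ∀ u, u ∈ J ↔ ∃ v, ψ u = ψ x * ψ v)
    (hy : ∀ u, y * u ∈ J → u ∈ J) (p : D[X]) (hp : p.eval₂ ψ (ψ y / ψ x) = 0) (m : ℕ) :
    p.coeff m ∈ J ⊔ Ideal.span {y} := by
  have hclear : ∀ (N : ℕ) (q : D[X]), q.natDegree ≤ N →
      ∃ w, ψ x ^ N * q.eval₂ ψ (ψ y / ψ x) = ψ w := by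
    intro N q hq
    refine ⟨∑ i ∈ Finset.range (N + 1), q.coeff i * y ^ i * x ^ (N - i), ?_⟩
    rw [eval₂_eq_sum_range' ψ (Nat.lt_succ_of_le hq), Finset.mul_sum, map_sum]
    refine Finset.sum_congr rfl fun i hi ↦ ?_
    have hi' : i ≤ N := Nat.lt_succ_iff.mp (Finset.mem_range.mp hi)
    obtain ⟨j, rfl⟩ := Nat.exists_eq_add_of_le hi'
    simp only [map_mul, map_pow, Nat.add_sub_cancel_left, div_pow, pow_add]
    field_simp
  obtain ⟨N, hN⟩ : ∃ N, p.natDegree = N := ⟨_, rfl⟩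
  induction N using Nat.strong_induction_on generalizing p m with
  | _ N ih =>
  rcases Nat.eq_zero_or_pos N with rfl | hpos
  · rw [eq_C_of_natDegree_eq_zero hN, eval₂_C] at hp
    rw [eq_C_of_natDegree_eq_zero hN, coeff_C]
    split_ifs
    · exact Ideal.mem_sup_left ((hJ _).mpr ⟨0, by rw [hp]; simp⟩)
    · exact Ideal.zero_mem _
  obtain ⟨M, rfl⟩ : ∃ M, N = M + 1 := ⟨N - 1, by lia⟩
  have hdeg : p.eraseLead.natDegree ≤ M := by
    have := p.eraseLead_natDegree_le
    lia
  have hsplit : p.eraseLead + monomial (M + 1) (p.coeff (M + 1)) = p := by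
    conv_rhs => rw [← p.eraseLead_add_monomial_natDegree_leadingCoeff, leadingCoeff, hN]
  have hlead : p.coeff (M + 1) ∈ J := by
    have hpow : ∀ (i : ℕ) (u : D), y ^ i * u ∈ J → u ∈ J := by
      intro i
      induction i with
      | zero => simp
      | succ i ihi =>
        intro u hu
        refine ihi u (hy _ ?_)
        rwa [← mul_assoc, ← pow_succ']
    refine hpow (M + 1) _ ((hJ _).mpr ?_)
    obtain ⟨w, hw⟩ := hclear M _ hdeg
    refine ⟨-w, ?_⟩
    have h1 : p.eraseLead.eval₂ ψ (ψ y / ψ x) +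
        ψ (p.coeff (M + 1)) * (ψ y / ψ x) ^ (M + 1) = 0 := by
      rw [← eval₂_monomial, ← eval₂_add, hsplit, hp]
    rw [map_neg, ← hw, map_mul, map_pow]
    have h2 : ψ (p.coeff (M + 1)) * (ψ y / ψ x) ^ (M + 1) =
      -p.eraseLead.eval₂ ψ (ψ y / ψ x) := by linear_combination h1
    have h3 : ψ y ^ (M + 1) = ψ x ^ (M + 1) * (ψ y / ψ x) ^ (M + 1) := by
      rw [div_pow]; field_simp
    rw [h3, mul_assoc, mul_comm (_ ^ _) (ψ _), h2]
    ring
  obtain ⟨q, hq⟩ := (hJ _).mp hlead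
  have h4 := ih M (Nat.lt_succ_self M)
  set p' := p.eraseLead + monomial M (q * y) with hp'
  have hp'deg : p'.natDegree ≤ M :=
    (natDegree_add_le _ _).trans (max_le hdeg (natDegree_monomial_le _))
  have hp'0 : p'.eval₂ ψ (ψ y / ψ x) = 0 := by
    rw [← hp, ← hsplit, hp', eval₂_add, eval₂_add, eval₂_monomial, eval₂_monomial, hq, map_mul,
      pow_succ]
    field_simp
  have h5 : ∀ i, p'.coeff i ∈ J ⊔ Ideal.span {y} := fun i ↦
    ih p'.natDegree (by lia) p' hp'0 i rfl
  have h6 : p = p' - monomial M (q * y) + monomial (M + 1) (p.coeff (M + 1)) := by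
    conv_lhs => rw [← hsplit]
    rw [hp']; ring
  rw [h6, coeff_add, coeff_sub, coeff_monomial, coeff_monomial]
  refine Ideal.add_mem _ (Ideal.sub_mem _ (h5 m) ?_) ?_
  · split_ifs
    · exact Ideal.mem_sup_right (Ideal.mul_mem_left _ _ (Ideal.mem_span_singleton_self _))
    · exact Ideal.zero_mem _
  · split_ifs
    · exact Ideal.mem_sup_left hlead
    · exact Ideal.zero_mem _

lemma exists_aeval_div_eq_mul_of_mem {R K : Type*} [CommRing R] [Field K] [Algebra R K] {x : R}
    (hx : algebraMap R K x ≠ 0) {n : ℕ} (y : Fin n → R) {f : MvPolynomial (Fin n) R}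
    (hf : f ∈ (Ideal.span (insert x (Set.range y))).map MvPolynomial.C) :
    ∃ g : MvPolynomial (Fin n) R,
      MvPolynomial.aeval (fun i ↦ algebraMap R K (y i) / algebraMap R K x) f =
        algebraMap R K x *
          MvPolynomial.aeval (fun i ↦ algebraMap R K (y i) / algebraMap R K x) g := by
  rw [Ideal.map_span] at hf
  induction hf using Submodule.span_induction with
  | mem f hf =>
    obtain ⟨r, hr, rfl⟩ := hf
    rcases hr with rfl | ⟨i, rfl⟩
    · exact ⟨1, by simp⟩
    · refine ⟨MvPolynomial.X i, ?_⟩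
      rw [MvPolynomial.aeval_C, MvPolynomial.aeval_X, mul_div_cancel₀ _ hx]
  | zero => exact ⟨0, by simp⟩
  | add f₁ f₂ _ _ h₁ h₂ =>
    obtain ⟨g₁, h₁⟩ := h₁
    obtain ⟨g₂, h₂⟩ := h₂
    exact ⟨g₁ + g₂, by rw [map_add, map_add, h₁, h₂, mul_add]⟩
  | smul a f _ h =>
    obtain ⟨g, h⟩ := h
    exact ⟨a * g, by rw [smul_eq_mul, map_mul, map_mul, h]; ring⟩

/-- Quasi-regularity: a polynomial in the `y i / x` whose value is divisible by `x` in
`R[y i / x]` has coefficients in `(x, y i)`. -/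
lemma mem_map_C_of_aeval_div_eq_mul {R K : Type*} [CommRing R] [Field K] [Algebra R K]
    (hinj : Function.Injective (algebraMap R K)) {x : R} (hx : x ≠ 0) {n : ℕ} (y : Fin n → R)
    (hp : ∀ s : Set (Fin n), (Ideal.span (insert x (y '' s))).IsPrime)
    (hy : ∀ s : Set (Fin n), ∀ i ∉ s, y i ∉ Ideal.span (insert x (y '' s)))
    {f g : MvPolynomial (Fin n) R}
    (h : MvPolynomial.aeval (fun i ↦ algebraMap R K (y i) / algebraMap R K x) f =
        algebraMap R K x *
          MvPolynomial.aeval (fun i ↦ algebraMap R K (y i) / algebraMap R K x) g) :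
    f ∈ (Ideal.span (insert x (Set.range y))).map MvPolynomial.C := by
  have hx' : algebraMap R K x ≠ 0 := by
    rw [← map_zero (algebraMap R K)]
    exact hinj.ne hx
  induction n with
  | zero =>
    obtain ⟨a, rfl⟩ := MvPolynomial.C_surjective (Fin 0) f
    obtain ⟨b, rfl⟩ := MvPolynomial.C_surjective (Fin 0) g
    rw [MvPolynomial.aeval_C, MvPolynomial.aeval_C, ← map_mul] at h
    rw [hinj h]
    exact Ideal.mem_map_of_mem _ (Ideal.mul_mem_right _ _ (Ideal.subset_span (by simp)))
  | succ n ih =>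
    let t : Fin n → K := fun i ↦ algebraMap R K (y i.succ) / algebraMap R K x
    let ψ : MvPolynomial (Fin n) R →+* K := (MvPolynomial.aeval t : _ →ₐ[R] K)
    have hrange : ∀ s : Set (Fin n), y '' (Fin.succ '' s) = (fun i ↦ y i.succ) '' s :=
      fun s ↦ by rw [Set.image_image]
    set I := Ideal.span (insert x (Set.range fun i : Fin n ↦ y i.succ)) with hI
    have hIp : I.IsPrime := by
      have := hp (Fin.succ '' Set.univ)
      rwa [hrange, Set.image_univ] at this
    have hI0 : y 0 ∉ I := by
      have := hy (Fin.succ '' Set.univ) 0 (by simp)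
      rwa [hrange, Set.image_univ] at this
    have hψC : ∀ r, ψ (MvPolynomial.C r) = algebraMap R K r := fun r ↦
      MvPolynomial.aeval_C _ _
    have hJ : ∀ u, u ∈ I.map MvPolynomial.C ↔ ∃ v, ψ u = ψ (MvPolynomial.C x) * ψ v := by
      intro u
      refine ⟨fun hu ↦ ?_, fun ⟨v, hv⟩ ↦ ?_⟩
      · rw [hψC]
        exact exists_aeval_div_eq_mul_of_mem hx' _ hu
      · rw [hψC] at hv
        refine ih (fun i ↦ y i.succ) (fun s ↦ ?_) (fun s i hi ↦ ?_) hv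
        · rw [← hrange]
          exact hp _
        · rw [← hrange]
          exact hy _ _ (by simpa using hi)
    have hev : ∀ p : MvPolynomial (Fin (n + 1)) R,
        MvPolynomial.aeval (fun i ↦ algebraMap R K (y i) / algebraMap R K x) p =
          (MvPolynomial.finSuccEquiv R n p).eval₂ ψ
            (ψ (MvPolynomial.C (y 0)) / ψ (MvPolynomial.C x)) := by
      intro p
      rw [hψC, hψC]
      have h1 : ((MvPolynomial.aeval (fun i ↦ algebraMap R K (y i) / algebraMap R K x) :
          MvPolynomial (Fin (n + 1)) R →ₐ[R] K) : _ →+* K) =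
          (eval₂RingHom ψ (algebraMap R K (y 0) / algebraMap R K x)).comp
            (MvPolynomial.finSuccEquiv R n : MvPolynomial (Fin (n + 1)) R →+* _) := by
        refine MvPolynomial.ringHom_ext (fun r ↦ ?_) (fun i ↦ ?_)
        · have h1 := congr($(MvPolynomial.finSuccEquiv_comp_C_eq_C (R := R) n) r)
          have h2 : MvPolynomial.finSuccEquiv R n (MvPolynomial.C r) = C (MvPolynomial.C r) :=
            ((AlgEquiv.symm_apply_eq _).mp h1).symm
          simp [h2, hψC]
        · refine Fin.cases ?_ (fun i ↦ ?_) i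
          · simp [MvPolynomial.finSuccEquiv_X_zero]
          · simp [MvPolynomial.finSuccEquiv_X_succ, ψ, t]
      exact congr($h1 p)
    have h0 : (MvPolynomial.finSuccEquiv R n f - C (MvPolynomial.C x) *
        MvPolynomial.finSuccEquiv R n g).eval₂ ψ
          (ψ (MvPolynomial.C (y 0)) / ψ (MvPolynomial.C x)) = 0 := by
      rw [eval₂_sub, eval₂_mul, ← hev, ← hev, eval₂_C, hψC, h, sub_self]
    have hI' : I.map MvPolynomial.C ⊔ Ideal.span {MvPolynomial.C (y 0)} ≤
        (Ideal.span (insert x (Set.range y))).map (MvPolynomial.C (σ := Fin n)) := by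
      refine sup_le (Ideal.map_mono (Ideal.span_mono ?_)) ?_
      · refine Set.insert_subset_insert ?_
        rintro _ ⟨i, rfl⟩
        exact ⟨i.succ, rfl⟩
      · rw [Ideal.span_singleton_le_iff_mem]
        exact Ideal.mem_map_of_mem _ (Ideal.subset_span (Set.mem_insert_of_mem _ ⟨0, rfl⟩))
    rw [MvPolynomial.mem_map_C_iff]
    intro m
    have h1 := hI' (coeff_mem_of_eval₂_div_eq_zero ψ (x := MvPolynomial.C x)
      (y := MvPolynomial.C (y 0)) (by rwa [hψC]) _ hJ (fun u hu ↦ by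
        rw [MvPolynomial.mem_map_C_iff] at hu ⊢
        intro m
        have := hu m
        rw [MvPolynomial.coeff_C_mul] at this
        exact (hIp.mem_or_mem this).resolve_left hI0) _ h0 (m 0))
    rw [coeff_sub, coeff_C_mul, Submodule.sub_mem_iff_left _ (Ideal.mul_mem_right _ _
      (Ideal.mem_map_of_mem _ (Ideal.subset_span (Set.mem_insert _ _)))),
      MvPolynomial.mem_map_C_iff] at h1
    have h2 := h1 m.tail
    rwa [MvPolynomial.finSuccEquiv_coeff_coeff, Finsupp.cons_tail] at h2

end BlowUp

end EtaleOpen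

namespace EtaleOpen

open IsLocalRing

section BlowUp

variable {K : Type w} [Field K]

lemma LocalSubring.le_of_le_of_le {A A' O : LocalSubring K} (h : A ≤ O)
    (h₁ : A.toSubring ≤ A'.toSubring) (h₂ : A'.toSubring ≤ O.toSubring) : A ≤ A' := by
  obtain ⟨h₃, h₄⟩ := h
  refine ⟨h₁, ⟨fun a ha ↦ h₄.map_nonunit a ?_⟩⟩
  exact ha.map (Subring.inclusion h₂)

lemma LocalSubring.ofPrime_le (B : Subring K) (O : LocalSubring K) (h : B ≤ O.toSubring)
    (P : Ideal B) [P.IsPrime]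
    (hP : P = (maximalIdeal O.toSubring).comap (Subring.inclusion h)) :
    LocalSubring.ofPrime B P ≤ O := by
  have hunit : ∀ s : B, s ∉ P → IsUnit (Subring.inclusion h s) := by
    intro s hs
    by_contra hcon
    exact hs (hP ▸ hcon)
  have hmk : ∀ z : (LocalSubring.ofPrime B P).toSubring, ∃ b s : B, s ∉ P ∧
      (z : K) * s = b := by
    intro z
    obtain ⟨⟨b, s⟩, hbs⟩ := IsLocalization.surj P.primeCompl z
    exact ⟨b, s, s.2, congr(($hbs : K))⟩
  have hle : (LocalSubring.ofPrime B P).toSubring ≤ O.toSubring := by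
    intro z hz
    obtain ⟨b, s, hs, hbs⟩ := hmk ⟨z, hz⟩
    obtain ⟨u, hu⟩ := (hunit s hs).exists_right_inv
    have hu' : (s : K) * u = 1 := congr(($hu : K))
    have : z = b * u := by
      rw [← hbs, mul_assoc, hu', mul_one]
    rw [this]
    exact mul_mem (h b.2) u.2
  refine ⟨hle, ⟨fun z hz ↦ ?_⟩⟩
  obtain ⟨b, s, hs, hbs⟩ := hmk z
  have hb : b ∉ P := by
    rw [hP, Ideal.mem_comap, mem_maximalIdeal, mem_nonunits_iff, not_not]
    have : Subring.inclusion h b = Subring.inclusion hle z * Subring.inclusion h s :=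
      Subtype.ext hbs.symm
    rw [this]
    exact hz.mul (hunit s hs)
  have h1 : IsUnit (algebraMap B (LocalSubring.ofPrime B P).toSubring b) :=
    IsLocalization.map_units (M := P.primeCompl) _ ⟨b, hb⟩
  have h2 : algebraMap B (LocalSubring.ofPrime B P).toSubring b =
      z * algebraMap B (LocalSubring.ofPrime B P).toSubring s := Subtype.ext hbs.symm
  rw [h2] at h1
  exact isUnit_of_mul_isUnit_left h1

lemma isRegularLocalRing_of_quotient {R : Type*} [CommRing R] [IsDomain R] [IsLocalRing R]
    [IsNoetherianRing R] {x : R} (hx : x ≠ 0) (hxm : x ∈ maximalIdeal R)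
    [IsRegularLocalRing (R ⧸ Ideal.span {x})] :
    IsRegularLocalRing R ∧ ringKrullDim R = ringKrullDim (R ⧸ Ideal.span {x}) + 1 := by
  have hdim := (ringKrullDim_quotient_span_singleton_succ_eq_ringKrullDim_of_mem_nonZeroDivisors
    (mem_nonZeroDivisors_of_ne_zero hx) hxm).symm
  refine ⟨?_, hdim⟩
  obtain ⟨s, hs⟩ := exists_isRegularSystem (R ⧸ Ideal.span {x})
  choose l hl using Ideal.Quotient.mk_surjective (I := Ideal.span {x})
  have h : IsRegularSystem (fun i : Option s ↦ i.elim x (fun j ↦ l j)) := by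
    refine ⟨le_antisymm (Ideal.span_le.mpr ?_) ?_, ?_⟩
    · have := (Ideal.Quotient.mk_surjective (I := Ideal.span {x})).isLocalHom
      rintro _ ⟨_ | j, rfl⟩
      · exact hxm
      · have := hs.mem j
        rw [← hl j] at this
        rw [SetLike.mem_coe, ← IsLocalRing.maximalIdeal_comap (Ideal.Quotient.mk (Ideal.span {x}))]
        exact this
    · intro a ha
      have := (Ideal.Quotient.mk_surjective (I := Ideal.span {x})).isLocalHom
      have h1 : Ideal.Quotient.mk (Ideal.span {x}) a ∈ maximalIdeal _ := by
        rwa [← Ideal.mem_comap, IsLocalRing.maximalIdeal_comap]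
      have h2 : Ideal.span (Set.range fun i : s ↦ (i : R ⧸ Ideal.span {x})) =
          (Ideal.span (Set.range fun i : s ↦ l i)).map (Ideal.Quotient.mk (Ideal.span {x})) := by
        rw [Ideal.map_span, ← Set.range_comp]
        congr 2
        ext i
        exact (hl i).symm
      rw [← hs.span_range, h2, ← Ideal.mem_comap,
        Ideal.comap_map_of_surjective' _ Ideal.Quotient.mk_surjective, Ideal.mk_ker] at h1
      refine (sup_le (Ideal.span_mono ?_) (Ideal.span_mono ?_) :
        Ideal.span (Set.range fun i : s ↦ l i) ⊔ Ideal.span {x} ≤ _) h1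
      · rintro _ ⟨i, rfl⟩
        exact ⟨some i, rfl⟩
      · rintro _ rfl
        exact ⟨none, rfl⟩
    · rw [hdim, hs.dim]
      simp
  exact h.isRegularLocalRing

/-- The affine chart of the blowup of a regular local ring `A` in its closed point that contains
the centre of a valuation ring dominating `A`, together with its exceptional divisor. -/
lemma exists_chart (A : LocalSubring K) [IsRegularLocalRing A.toSubring]
    (V : ValuationSubring K) (hAV : A.toSubring ≤ V.toSubring) (hA : ¬ IsField A.toSubring) :
    ∃ (n : ℕ) (B : Subring K) (hAB : A.toSubring ≤ B) (x : A.toSubring)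
      (π : B →+* MvPolynomial (Fin n) (ResidueField A.toSubring)),
      B ≤ V.toSubring ∧ IsNoetherianRing B ∧ ringKrullDim A.toSubring = n + 1 ∧ x ≠ 0 ∧
      x ∈ maximalIdeal A.toSubring ∧ Function.Surjective π ∧
      RingHom.ker π = Ideal.span {Subring.inclusion hAB x} ∧
      (∀ a, π (Subring.inclusion hAB a) = MvPolynomial.C (residue _ a)) ∧
      ∀ a ∈ maximalIdeal A.toSubring, ∃ b : B, (a : K) = x * b := by
  classical
  obtain ⟨s, hs⟩ := exists_isRegularSystem A.toSubring
  have hne : Nonempty s := by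
    by_contra hcon
    rw [not_nonempty_iff] at hcon
    exact hA hs.isField
  obtain ⟨i₀, -, hi₀⟩ := Finset.exists_max_image (Finset.univ : Finset s)
    (fun i ↦ V.valuation ((i : A.toSubring) : K)) Finset.univ_nonempty
  have hx0 : (i₀ : A.toSubring) ≠ 0 := (hs.prime i₀).ne_zero
  have hxK : ((i₀ : A.toSubring) : K) ≠ 0 := by simpa using hx0
  let n := Fintype.card {j : s // j ≠ i₀}
  let e : Fin n ≃ {j : s // j ≠ i₀} := (Fintype.equivFin _).symm
  have hcard : Fintype.card s = n + 1 := by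
    have h1 : n = Fintype.card s - 1 := by simp [n]
    have := Fintype.card_pos (α := s)
    lia
  let y : Fin n → A.toSubring := fun i ↦ ((e i : s) : A.toSubring)
  have himg : ∀ t : Set (Fin n), insert (i₀ : A.toSubring) (y '' t) =
      (fun i : s ↦ (i : A.toSubring)) '' (insert i₀ ((fun i ↦ ((e i : s))) '' t)) := by
    intro t
    rw [Set.image_insert_eq, Set.image_image]
  have hmax : Ideal.span (insert (i₀ : A.toSubring) (Set.range y)) =
      maximalIdeal A.toSubring := by
    rw [← hs.span_range, ← Set.image_univ, himg, ← Set.image_univ]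
    congr 2
    rw [Set.image_univ, Set.eq_univ_iff_forall]
    intro j
    by_cases hj : j = i₀
    · exact Set.mem_insert_iff.mpr (Or.inl hj)
    · exact Set.mem_insert_of_mem _ ⟨e.symm ⟨j, hj⟩, by simp⟩
  let ψ : MvPolynomial (Fin n) A.toSubring →ₐ[A.toSubring] K :=
    MvPolynomial.aeval (fun i ↦ algebraMap A.toSubring K (y i) / algebraMap A.toSubring K i₀)
  let B : Subring K := (ψ : MvPolynomial (Fin n) A.toSubring →+* K).range
  let ρ : MvPolynomial (Fin n) A.toSubring →+* B :=
    (ψ : MvPolynomial (Fin n) A.toSubring →+* K).rangeRestrict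
  have hρ : Function.Surjective ρ :=
    (ψ : MvPolynomial (Fin n) A.toSubring →+* K).rangeRestrict_surjective
  let φ : MvPolynomial (Fin n) A.toSubring →+* MvPolynomial (Fin n) (ResidueField A.toSubring) :=
    MvPolynomial.map (residue _)
  have hφ : ∀ f, φ f = 0 ↔ ∃ g, ψ f = algebraMap A.toSubring K i₀ * ψ g := by
    intro f
    have h1 : φ f = 0 ↔ f ∈ (maximalIdeal A.toSubring).map (MvPolynomial.C (σ := Fin n)) := by
      rw [MvPolynomial.mem_map_C_iff, MvPolynomial.ext_iff]
      refine forall_congr' fun m ↦ ?_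
      rw [MvPolynomial.coeff_map, MvPolynomial.coeff_zero, residue_eq_zero_iff]
    rw [h1, ← hmax]
    refine ⟨fun hf ↦ exists_aeval_div_eq_mul_of_mem hxK _ hf, fun ⟨g, hg⟩ ↦
      mem_map_C_of_aeval_div_eq_mul Subtype.val_injective hx0 y (fun t ↦ ?_) (fun t i hi ↦ ?_) hg⟩
    · rw [himg]
      exact hs.isPrime_span _
    · rw [himg]
      refine hs.notMem_span (i := (e i : s)) ?_
      rintro (h | ⟨j, hj, h⟩)
      · exact (e i).2 h
      · rw [← e.injective (Subtype.ext h)] at hi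
        exact hi hj
  have hker : RingHom.ker ρ ≤ RingHom.ker φ := by
    intro f hf
    rw [RingHom.mem_ker, hφ]
    exact ⟨0, by rw [map_zero, mul_zero]; exact congr(($hf : K))⟩
  let π : B →+* MvPolynomial (Fin n) (ResidueField A.toSubring) :=
    RingHom.liftOfSurjective ρ hρ ⟨φ, hker⟩
  have hπ : ∀ f, π (ρ f) = φ f := fun f ↦
    RingHom.liftOfRightInverse_comp_apply ρ _ (Function.rightInverse_surjInv hρ) ⟨φ, hker⟩ f
  have hAB : A.toSubring ≤ B := by
    intro a ha
    exact ⟨MvPolynomial.C ⟨a, ha⟩, by simp [ψ]; rfl⟩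
  have hABρ : ∀ a, Subring.inclusion hAB a = ρ (MvPolynomial.C a) := fun a ↦
    Subtype.ext (MvPolynomial.aeval_C _ a).symm
  have hV : ∀ i, ((y i : K)) / ((i₀ : A.toSubring) : K) ∈ V := by
    intro i
    rw [← ValuationSubring.valuation_le_one_iff, map_div₀]
    exact div_le_one_of_le₀ (hi₀ _ (Finset.mem_univ _)) zero_le
  refine ⟨n, B, hAB, i₀, π, ?_, ?_, ?_, hx0, hs.mem i₀, ?_, ?_, ?_, ?_⟩
  · rintro _ ⟨f, rfl⟩
    change ψ f ∈ V
    induction f using MvPolynomial.induction_on with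
    | C a => simpa [ψ] using! hAV a.2
    | add p q hp hq => rw [map_add]; exact add_mem hp hq
    | mul_X p i hp => rw [map_mul]; exact mul_mem hp (by simpa [ψ] using! hV i)
  · exact isNoetherianRing_of_surjective _ _ ρ hρ
  · rw [hs.dim, hcard]
    simp
  · refine Function.Surjective.of_comp (g := ρ) ?_
    rw [show π ∘ ρ = φ from funext hπ]
    exact MvPolynomial.map_surjective _ residue_surjective
  · ext b
    obtain ⟨f, rfl⟩ := hρ b
    rw [RingHom.mem_ker, hπ, hφ, Ideal.mem_span_singleton]
    constructor
    · rintro ⟨g, hg⟩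
      exact ⟨ρ g, Subtype.ext hg⟩
    · rintro ⟨b, hb⟩
      obtain ⟨g, rfl⟩ := hρ b
      exact ⟨g, congr(($hb : K))⟩
  · intro a
    rw [hABρ, hπ]
    exact MvPolynomial.map_C _ _
  · intro a ha
    have h1 : φ (MvPolynomial.C a) = 0 := by
      rw [MvPolynomial.map_C, (residue_eq_zero_iff a).mpr ha, map_zero]
    obtain ⟨g, hg⟩ := (hφ _).mp h1
    rw [show ψ (MvPolynomial.C a) = _ from MvPolynomial.aeval_C _ a] at hg
    exact ⟨ρ g, hg⟩

/-- The local ring `A'` of the blowup of a regular local ring `A` at the centre of a valuation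
ring dominating `A`. Here `x` is an equation of the exceptional divisor. -/
theorem exists_blowUp (A : LocalSubring K) [IsRegularLocalRing A.toSubring]
    (V : ValuationSubring K) (hAV : A ≤ V.toLocalSubring) (hA : ¬ IsField A.toSubring) :
    ∃ (A' : LocalSubring K) (x : A.toSubring), A ≤ A' ∧ A' ≤ V.toLocalSubring ∧
      IsRegularLocalRing A'.toSubring ∧ x ≠ 0 ∧ x ∈ maximalIdeal A.toSubring ∧
      (∀ a ∈ maximalIdeal A.toSubring, ∃ b : A'.toSubring, (a : K) = x * b) ∧
      ringKrullDim A'.toSubring ≤ ringKrullDim A.toSubring ∧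
      (ringKrullDim A'.toSubring = ringKrullDim A.toSubring → ∀ c : A'.toSubring,
        ∃ f : Polynomial A.toSubring, f.Monic ∧
          ∃ m ∈ maximalIdeal A'.toSubring, f.eval₂ A.toSubring.subtype c = m) ∧
      ∀ n : ℕ, 3 ≤ n → IsUnit (n : A.toSubring) → ∀ z y : A'.toSubring, y ^ n = 1 + z ^ n →
        ∃ (c : A.toSubring) (u : A'.toSubring), (z : K) - c = x * u := by
  obtain ⟨n, B, hAB, x, π, hBV, hBN, hdim, hx0, hxm, hπ, hker, hπA, hdiv⟩ :=
    exists_chart A V hAV.1 hA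
  replace hBV : B ≤ V.toLocalSubring.toSubring := hBV
  set P : Ideal B := (maximalIdeal V.toLocalSubring.toSubring).comap (Subring.inclusion hBV)
    with hP
  have hPp : P.IsPrime := Ideal.comap_isPrime _ _
  set A' := LocalSubring.ofPrime B P with hA'
  have hA'V : A' ≤ V.toLocalSubring := LocalSubring.ofPrime_le B _ hBV P rfl
  have hBA' : B ≤ A'.toSubring := LocalSubring.le_ofPrime B P
  have hAA' : A ≤ A' := LocalSubring.le_of_le_of_le hAV (hAB.trans hBA') hA'V.1
  set k := ResidueField A.toSubring
  set xB : B := Subring.inclusion hAB x with hxB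
  have hxP : xB ∈ P := by
    rw [hP, Ideal.mem_comap]
    have := hAV.2
    exact map_nonunit (Subring.inclusion hAV.1) x hxm
  have hkerP : RingHom.ker π ≤ P := by
    rw [hker, Ideal.span_singleton_le_iff_mem]
    exact hxP
  -- the corresponding point of the exceptional divisor
  set Q : Ideal (MvPolynomial (Fin n) k) := P.map π with hQ
  have hQp : Q.IsPrime := Ideal.map_isPrime_of_surjective hπ hkerP
  have hQc : ∀ b, π b ∈ Q ↔ b ∈ P := by
    intro b
    rw [← Ideal.mem_comap, hQ, Ideal.comap_map_of_surjective' _ hπ, sup_eq_left.mpr hkerP]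
  have hT : P.primeCompl.map π = Q.primeCompl := by
    ext q
    constructor
    · rintro ⟨b, hb, rfl⟩
      exact fun h ↦ hb ((hQc b).mp h)
    · intro hq
      obtain ⟨b, rfl⟩ := hπ q
      exact ⟨b, fun h ↦ hq ((hQc b).mpr h), rfl⟩
  let D := Localization.AtPrime Q
  have hloc : IsLocalization (P.primeCompl.map π) D := by
    rw [hT]
    exact Localization.isLocalization
  let ρ : A'.toSubring →+* D := IsLocalization.map D π (hT.symm ▸ P.primeCompl.le_comap_map)
  have hρ : Function.Surjective ρ := by
    have := IsLocalization.map_surjective_of_surjective P.primeCompl A'.toSubring D hπ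
    exact this
  have hρB : ∀ b : B, ρ (algebraMap B _ b) = algebraMap _ D (π b) := fun b ↦
    IsLocalization.map_eq _ b
  set xA' : A'.toSubring := Subring.inclusion hAA'.1 x with hxA'
  have hρker : RingHom.ker ρ = Ideal.span {xA'} := by
    rw [IsLocalization.ker_map (S := A'.toSubring) D π hT, hker, Ideal.map_span,
      Set.image_singleton]
    rfl
  have hA'N : IsNoetherianRing A'.toSubring :=
    IsLocalization.isNoetherianRing P.primeCompl _ hBN
  have hxA'0 : xA' ≠ 0 := fun h ↦ hx0 (Subtype.ext congr(($h : K)))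
  have hxA'm : xA' ∈ maximalIdeal A'.toSubring := by
    have := hAA'.2
    exact map_nonunit (Subring.inclusion hAA'.1) x hxm
  let ε : (A'.toSubring ⧸ Ideal.span {xA'}) ≃+* D :=
    (Ideal.quotEquivOfEq hρker.symm).trans (RingHom.quotientKerEquivOfSurjective hρ)
  have hreg : IsRegularLocalRing (A'.toSubring ⧸ Ideal.span {xA'}) :=
    IsRegularLocalRing.of_ringEquiv ε.symm
  obtain ⟨hA'reg, hA'dim⟩ := isRegularLocalRing_of_quotient hxA'0 hxA'm
  rw [ringKrullDim_eq_of_ringEquiv ε, IsLocalization.AtPrime.ringKrullDim_eq_height Q D] at hA'dim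
  have hpoly : ringKrullDim (MvPolynomial (Fin n) k) = n := by
    rw [MvPolynomial.ringKrullDim_of_isNoetherianRing, ringKrullDim_eq_zero_of_field]
    simp
  have hht : (Q.height : WithBot ℕ∞) ≤ n := by
    rw [← hpoly]
    exact Ideal.height_le_ringKrullDim_of_ne_top hQp.ne_top
  refine ⟨A', x, hAA', hA'V, hA'reg, hx0, hxm, ?_, ?_, ?_, ?_⟩
  · intro a ha
    obtain ⟨b, hb⟩ := hdiv a ha
    exact ⟨Subring.inclusion hBA' b, hb⟩
  · rw [hA'dim, hdim]
    gcongr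
  · intro heq c
    have hQmax : Q.IsMaximal := by
      obtain ⟨M, hM, hle⟩ := Ideal.exists_le_maximal Q hQp.ne_top
      by_cases hQM : Q = M
      · rwa [hQM]
      have h1 := Ideal.height_add_one_le_of_lt_of_isPrime (lt_of_le_of_ne hle hQM)
      have h2 : (M.height : WithBot ℕ∞) ≤ n := by
        rw [← hpoly]
        exact Ideal.height_le_ringKrullDim_of_ne_top hM.ne_top
      have h3 : ((Q.height + 1 : ℕ∞) : WithBot ℕ∞) ≤ n := (WithBot.coe_le_coe.mpr h1).trans h2
      rw [WithBot.coe_add, WithBot.coe_one, ← hA'dim, heq, hdim] at h3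
      exact absurd h3 (by exact_mod_cast (Nat.lt_succ_self n).not_ge)
    have hPmax : P.IsMaximal := by
      have : P = Q.comap π := by
        exact Ideal.ext fun b ↦ (hQc b).symm
      rw [this]
      exact Ideal.comap_isMaximal_of_surjective π hπ
    have hPm : ∀ b ∈ P, algebraMap B A'.toSubring b ∈ maximalIdeal A'.toSubring := fun b hb ↦
      (IsLocalization.AtPrime.to_map_mem_maximal_iff A'.toSubring P b).mpr hb
    obtain ⟨b, hb⟩ : ∃ b : B, c - algebraMap B _ b ∈ maximalIdeal A'.toSubring := by
      obtain ⟨⟨b, s⟩, hbs⟩ := IsLocalization.surj P.primeCompl c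
      obtain ⟨t, i, hi, hti⟩ := hPmax.exists_inv s.2
      refine ⟨t * b, ?_⟩
      have h1 : c - algebraMap B _ (t * b) = c * algebraMap B _ i := by
        have h2 := congr(algebraMap B A'.toSubring $hti)
        rw [map_add, map_mul, map_one] at h2
        rw [map_mul, ← hbs]
        linear_combination -c * h2
      rw [h1]
      exact Ideal.mul_mem_left _ _ (hPm i hi)
    let := Ideal.Quotient.field Q
    have hfin : Module.Finite k (MvPolynomial (Fin n) k ⧸ Q) :=
      finite_of_finite_type_of_isJacobsonRing _ _
    obtain ⟨g, hgm, hg⟩ := (Algebra.IsIntegral.isIntegral (R := k)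
      (Ideal.Quotient.mk Q (π b)) : IsIntegral k _)
    obtain ⟨f, hfg, -, hfm⟩ := Polynomial.lifts_and_degree_eq_and_monic
      ((Polynomial.mem_lifts _).mpr (Polynomial.map_surjective _ residue_surjective g)) hgm
    have hfP : f.eval₂ (Subring.inclusion hAB) b ∈ P := by
      rw [← hQc, ← Ideal.Quotient.eq_zero_iff_mem, Polynomial.hom_eval₂, Polynomial.hom_eval₂,
        ← hg, ← hfg, Polynomial.eval₂_map]
      congr 1
      ext a
      exact congr(Ideal.Quotient.mk Q $(hπA a))
    refine ⟨f, hfm, f.eval₂ (Subring.inclusion hAA'.1) c, ?_, ?_⟩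
    · have h1 := Polynomial.sub_dvd_eval_sub c (algebraMap B _ b)
        (f.map (Subring.inclusion hAA'.1))
      rw [Polynomial.eval_map, Polynomial.eval_map] at h1
      have h2 : f.eval₂ (Subring.inclusion hAA'.1) (algebraMap B A'.toSubring b) =
          algebraMap B _ (f.eval₂ (Subring.inclusion hAB) b) := by
        rw [Polynomial.hom_eval₂]
        rfl
      rw [h2] at h1
      have h3 := Ideal.mem_of_dvd _ h1 hb
      rwa [Submodule.sub_mem_iff_left _ (hPm _ hfP)] at h3
    · change _ = A'.toSubring.subtype _
      rw [Polynomial.hom_eval₂]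
      rfl
  · intro N hN3 hN z y hzy
    have hNk : (N : k) ≠ 0 := by
      have := (hN.map (residue A.toSubring)).ne_zero
      rwa [map_natCast] at this
    let G := FractionRing (MvPolynomial (Fin n) k)
    let l : D →+* G := IsLocalization.lift (M := Q.primeCompl)
      (g := algebraMap (MvPolynomial (Fin n) k) G) (fun q ↦ by
        rw [isUnit_iff_ne_zero, Ne, FaithfulSMul.algebraMap_eq_zero_iff]
        rintro h
        exact q.2 (h ▸ Q.zero_mem))
    have hl : ∀ p, l (algebraMap _ D p) = algebraMap _ G p := fun p ↦ IsLocalization.lift_eq _ p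
    have hlinj : Function.Injective l :=
      (IsLocalization.lift_injective_iff _).mpr fun a b ↦ by
        rw [(IsFractionRing.injective (MvPolynomial (Fin n) k) G).eq_iff,
          (IsLocalization.injective D Q.primeCompl_le_nonZeroDivisors).eq_iff]
    obtain ⟨⟨c, hc⟩, -⟩ := fermat_const hN3 hNk n (z := l (ρ z)) (y := l (ρ y))
      (by rw [← map_pow, ← map_pow, hzy]; simp)
    obtain ⟨c, rfl⟩ := residue_surjective c
    rw [← hl, ← hπA, ← hρB] at hc
    have h1 : z - algebraMap B _ (Subring.inclusion hAB c) ∈ RingHom.ker ρ := by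
      rw [RingHom.mem_ker, map_sub, hlinj hc, sub_self]
    rw [hρker, Ideal.mem_span_singleton] at h1
    obtain ⟨u, hu⟩ := h1
    exact ⟨c, u, congr(($hu : K))⟩

end BlowUp

end EtaleOpen

namespace EtaleOpen

open IsLocalRing

section Valuations

open Polynomial Pointwise

/-- An element of the fraction field of an integrally closed local domain that is a root of a
polynomial with a unit coefficient lies in the ring or has its inverse there. -/
lemma mem_or_inv_mem_of_aeval_eq_zero {R K : Type*} [CommRing R] [IsLocalRing R] [IsDomain R]
    [IsIntegrallyClosed R] [Field K] [Algebra R K] [IsFractionRing R K] {z : K} {f : R[X]}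
    (hf : aeval z f = 0) {i : ℕ} (hi : IsUnit (f.coeff i)) :
    (∃ a, algebraMap R K a = z) ∨ ∃ a, algebraMap R K a = z⁻¹ := by
  obtain ⟨N, hN⟩ : ∃ N, f.natDegree = N := ⟨_, rfl⟩
  induction N using Nat.strong_induction_on generalizing f i with
  | _ N ih =>
  obtain ⟨w, hw⟩ : ∃ w, algebraMap R K w = f.leadingCoeff • z :=
    IsIntegrallyClosed.isIntegral_iff.mp (isIntegral_leadingCoeff_smul f z hf)
  by_cases hu : IsUnit f.leadingCoeff
  · obtain ⟨u, hu⟩ := hu.exists_left_inv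
    refine Or.inl ⟨u * w, ?_⟩
    rw [map_mul, hw, Algebra.smul_def, ← mul_assoc, ← map_mul, hu, map_one, one_mul]
  have hiN : i < N := by
    refine lt_of_le_of_ne (hN ▸ le_natDegree_of_ne_zero hi.ne_zero) ?_
    rintro rfl
    exact hu (by rwa [leadingCoeff, hN])
  obtain ⟨M, rfl⟩ : ∃ M, N = M + 1 := ⟨N - 1, by lia⟩
  set g := f.eraseLead + monomial M w with hg
  have hgdeg : g.natDegree ≤ M := by
    refine (natDegree_add_le _ _).trans (max_le ?_ (natDegree_monomial_le _))
    have := f.eraseLead_natDegree_le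
    lia
  have hg0 : aeval z g = 0 := by
    rw [hg, map_add, aeval_monomial, hw, Algebra.smul_def, mul_assoc, ← pow_succ',
      ← aeval_monomial, ← map_add, ← hN, f.eraseLead_add_monomial_natDegree_leadingCoeff, hf]
  by_cases hex : ∃ j, IsUnit (g.coeff j)
  · obtain ⟨j, hj⟩ := hex
    exact ih g.natDegree (by lia) hg0 hj rfl
  push Not at hex
  have hcoeff : ∀ j, j < M + 1 → g.coeff j = f.coeff j + if M = j then w else 0 := by
    intro j hj
    rw [hg, coeff_add, coeff_monomial, eraseLead_coeff_of_ne _ (by lia)]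
  have h1 := hex i
  rw [hcoeff i hiN] at h1
  split_ifs at h1 with hMi
  · have hwu : IsUnit w := by
      by_contra hwn
      have h2 : f.coeff i + w ∈ maximalIdeal R := h1
      rw [Submodule.add_mem_iff_left _ ((mem_maximalIdeal w).mpr hwn)] at h2
      exact h2 hi
    obtain ⟨u, hu⟩ := hwu.exists_left_inv
    refine Or.inr ⟨u * f.leadingCoeff, ?_⟩
    refine eq_inv_of_mul_eq_one_left ?_
    rw [Algebra.smul_def] at hw
    rw [map_mul, mul_assoc, ← hw, ← map_mul, hu, map_one]
  · exact absurd hi (by simpa using h1)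

variable {K : Type w} [Field K]

lemma isFractionRing_of_le {A B : Subring K} (h : A ≤ B) [IsFractionRing A K] :
    IsFractionRing B K := by
  refine IsFractionRing.of_field B K fun z ↦ ?_
  obtain ⟨a, b, -, rfl⟩ := IsFractionRing.div_surjective (A := A) z
  exact ⟨⟨a, h a.2⟩, ⟨b, h b.2⟩, rfl⟩

/-- A valuation ring in which no nonzero element is divisible by arbitrarily long products of
nonunits. -/
def HasBoundedDivision (V : ValuationSubring K) : Prop :=
  ∀ b : K, b ≠ 0 → ∃ N : ℕ, ∀ c : ℕ → K, (∀ i, V.valuation (c i) < 1) →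
    V.valuation (∏ i ∈ Finset.range N, c i) < V.valuation b

lemma length_quotient_smul {B : Type*} [CommRing B] [IsDomain B] {b : B} (hb : b ≠ 0)
    (I : Ideal B) :
    Module.length B (B ⧸ (b • I)) =
      Module.length B (B ⧸ I) + Module.length B (B ⧸ Ideal.span {b}) :=
  Module.length_eq_add_of_exact (Ideal.mulQuot b I) (Ideal.quotOfMul b I)
    (Ideal.mulQuot_injective I (mem_nonZeroDivisors_of_ne_zero hb)) (Ideal.quotOfMul_surjective I)
    (Ideal.exact_mulQuot_quotOfMul I)

lemma length_quotient_ne_top {B : Type*} [CommRing B] [IsDomain B] [IsNoetherianRing B]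
    [Ring.KrullDimLE 1 B] {I : Ideal B} (hI : I ≠ ⊥) : Module.length B (B ⧸ I) ≠ ⊤ := by
  obtain ⟨a, ha, ha0⟩ := Submodule.exists_mem_ne_zero_of_ne_bot hI
  have h := isFiniteLength_quotient_span_singleton B (mem_nonZeroDivisors_of_ne_zero ha0)
  rw [← Module.length_ne_top_iff] at h
  refine ne_top_of_le_ne_top h (Module.length_le_of_surjective
    (Submodule.factor ((Ideal.span_singleton_le_iff_mem I).mpr ha))
    (Submodule.factor_surjective _))

lemma length_quotient_lt {B : Type*} [CommRing B] {I J : Ideal B} (h : I < J) :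
    Module.length B (B ⧸ J) + 1 ≤ Module.length B (B ⧸ I) := by
  have h1 := Module.length_eq_add_of_exact (LinearMap.ker (Submodule.factor h.le)).subtype
    (Submodule.factor h.le) (Submodule.subtype_injective _) (Submodule.factor_surjective _)
    (LinearMap.exact_subtype_ker_map _)
  rw [h1, add_comm]
  gcongr
  rw [Order.one_le_iff_pos, Module.length_pos_iff, Submodule.nontrivial_iff_ne_bot]
  obtain ⟨x, hxJ, hxI⟩ := Set.exists_of_ssubset h
  intro h2
  have h3 : Submodule.Quotient.mk x ∈ LinearMap.ker (Submodule.factor h.le) := by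
    rw [LinearMap.mem_ker]
    exact (Submodule.Quotient.mk_eq_zero _).mpr hxJ
  rw [h2, Submodule.mem_bot, Submodule.Quotient.mk_eq_zero] at h3
  exact hxI h3

/-- A valuation ring containing a one-dimensional noetherian ring with the same fraction field
has bounded division. -/
lemma hasBoundedDivision_of_krullDimLE_one {B : Subring K} [IsNoetherianRing B]
    [Ring.KrullDimLE 1 B] [IsFractionRing B K] {V : ValuationSubring K}
    (hB : B ≤ V.toSubring) : HasBoundedDivision V := by
  classical
  have hv : ∀ x : B, V.valuation x ≤ 1 := fun x ↦ (V.valuation_le_one_iff _).mpr (hB x.2)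
  suffices h : ∀ b : B, b ≠ 0 → ∃ N : ℕ, ∀ c : ℕ → K, (∀ i, V.valuation (c i) < 1) →
      V.valuation (∏ i ∈ Finset.range N, c i) < V.valuation (b : K) by
    intro b hb
    obtain ⟨p, q, hq, rfl⟩ := IsFractionRing.div_surjective (A := B) b
    have hp0 : p ≠ 0 := by
      rintro rfl
      simp at hb
    have hq0 : (q : K) ≠ 0 := fun h ↦ nonZeroDivisors.ne_zero hq (Subtype.ext h)
    obtain ⟨N, hN⟩ := h p hp0
    refine ⟨N, fun c hc ↦ (hN c hc).trans_le ?_⟩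
    rw [map_div₀]
    refine (le_div_iff₀ (zero_lt_iff.mpr ((V.valuation.ne_zero_iff).mpr hq0))).mpr ?_
    exact mul_le_of_le_one_right' (hv q)
  intro b hb
  set l := Module.length B (B ⧸ Ideal.span {b}) with hl
  have hltop : l ≠ ⊤ := length_quotient_ne_top (by simpa using hb)
  refine ⟨l.toNat + 1, fun c hc ↦ ?_⟩
  by_contra! hlt
  set N := l.toNat + 1
  have hb' : V.valuation (b : K) ≠ 0 := (V.valuation.ne_zero_iff).mpr fun h ↦ hb (Subtype.ext h)
  let t : ℕ → K := fun n ↦ ∏ i ∈ Finset.range n, c i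
  have ht0 : ∀ i ≤ N, t i ≠ 0 := by
    intro i hi h0
    obtain ⟨j, hj, hcj⟩ := Finset.prod_eq_zero_iff.mp h0
    have : t N = 0 := Finset.prod_eq_zero (i := j) (by simp at hj ⊢; lia) hcj
    rw [show ∏ i ∈ Finset.range N, c i = 0 from this, map_zero, le_zero_iff] at hlt
    exact hb' hlt
  obtain ⟨⟨d, hd⟩, hdt⟩ := IsLocalization.exist_integer_multiples_of_finset
    (nonZeroDivisors B) ((Finset.range (N + 1)).image t)
  have hd0 : (d : K) ≠ 0 := fun h ↦ nonZeroDivisors.ne_zero hd (Subtype.ext h)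
  have hdt' : ∀ i ≤ N, ∃ e : B, (e : K) = d * t i := fun i hi ↦
    hdt (t i) (Finset.mem_image_of_mem _ (by simp; lia))
  let J : ℕ → Ideal B := fun i ↦
    { carrier := {f | V.valuation (f : K) ≤ V.valuation (d * t i)}
      add_mem' := fun {f g} hf hg ↦ show V.valuation ((f : K) + g) ≤ V.valuation (d * t i) from
        (V.valuation.map_add f g).trans (max_le hf hg)
      zero_mem' := by simp
      smul_mem' := fun r f hf ↦ by
        change V.valuation ((r : K) * f) ≤ V.valuation (d * t i)
        rw [map_mul]
        exact (mul_le_of_le_one_left' (hv r)).trans hf }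
  have hmem : ∀ i f, f ∈ J i ↔ V.valuation (f : K) ≤ V.valuation (d * t i) := fun _ _ ↦ Iff.rfl
  have hJ0 : ∀ i ≤ N, J i ≠ ⊥ := by
    intro i hi h
    obtain ⟨e, he⟩ := hdt' i hi
    have h1 : e ∈ J i := by rw [hmem, he]
    rw [h, Submodule.mem_bot] at h1
    rw [h1] at he
    exact mul_ne_zero hd0 (ht0 i hi) he.symm
  have hlt' : ∀ i < N, J (i + 1) < J i := by
    intro i hi
    have h1 : V.valuation (d * t (i + 1)) < V.valuation (d * t i) := by
      rw [show t (i + 1) = t i * c i from Finset.prod_range_succ _ _, ← mul_assoc,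
        map_mul _ _ (c i)]
      exact mul_lt_of_lt_one_right
        (zero_lt_iff.mpr ((V.valuation.ne_zero_iff).mpr (mul_ne_zero hd0 (ht0 i hi.le)))) (hc i)
    refine lt_of_le_of_ne (fun f hf ↦ (hmem _ _).mpr (((hmem _ _).mp hf).trans h1.le)) fun h ↦ ?_
    obtain ⟨e, he⟩ := hdt' i hi.le
    have h2 : e ∈ J i := by rw [hmem, he]
    rw [← h, hmem, he] at h2
    exact h2.not_gt h1
  have hlen : ∀ i ≤ N, Module.length B (B ⧸ J 0) + i ≤ Module.length B (B ⧸ J i) := by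
    intro i
    induction i with
    | zero => simp
    | succ i ih =>
      intro hi
      refine le_trans ?_ (length_quotient_lt (hlt' i hi))
      push_cast
      rw [← add_assoc]
      gcongr
      exact ih (by lia)
  have h1 : b • J 0 ≤ J N := by
    rintro _ ⟨f, hf, rfl⟩
    have hf' : V.valuation (f : K) ≤ V.valuation (d * t 0) := hf
    change V.valuation ((b : K) * f) ≤ V.valuation (d * t N)
    rw [map_mul, mul_comm, map_mul]
    refine mul_le_mul' ?_ hlt
    simpa [t] using hf'
  have h2 : Module.length B (B ⧸ J N) ≤ Module.length B (B ⧸ (b • J 0)) :=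
    Module.length_le_of_surjective (Submodule.factor h1) (Submodule.factor_surjective _)
  rw [length_quotient_smul hb] at h2
  have h3 := (hlen N le_rfl).trans h2
  rw [ENat.add_le_add_iff_left (length_quotient_ne_top (hJ0 0 (Nat.zero_le _))), ← hl,
    ← ENat.natCast_toNat hltop, Nat.cast_le] at h3
  exact absurd h3 (Nat.not_succ_le_self _)

lemma valuation_lt_one_iff_of_ofPrime_le {A : Subring K} {P : Ideal A} [P.IsPrime]
    {V : ValuationSubring K} (h : LocalSubring.ofPrime A P ≤ V.toLocalSubring) (a : A) :
    V.valuation a < 1 ↔ a ∈ P := by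
  obtain ⟨h₁, h₂⟩ := h
  rw [← IsLocalization.AtPrime.to_map_mem_maximal_iff (LocalSubring.ofPrime A P).toSubring P]
  have h3 := V.valuation_lt_one_iff ⟨a, h₁ (LocalSubring.le_ofPrime A P a.2)⟩
  rw [← h3]
  exact not_congr ((isUnit_map_iff (Subring.inclusion h₁) (algebraMap A _ a)))

/-- Every nonzero prime of a noetherian domain is the center of a valuation ring with bounded
division. -/
lemma exists_hasBoundedDivision {A : Subring K} [IsNoetherianRing A] [IsFractionRing A K]
    (P : Ideal A) [P.IsPrime] (hP : P ≠ ⊥) :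
    ∃ V : ValuationSubring K, A ≤ V.toSubring ∧ HasBoundedDivision V ∧
      ∀ a : A, V.valuation a < 1 ↔ a ∈ P := by
  obtain ⟨V₁, hV₁⟩ := (LocalSubring.ofPrime A P).exists_le_valuationSubring
  have hAV₁ : A ≤ V₁.toSubring := (LocalSubring.le_ofPrime A P).trans hV₁.1
  obtain ⟨s, hs⟩ := (isNoetherianRing_iff_ideal_fg A).mp inferInstance P
  have hsne : s.Nonempty := by
    by_contra h
    rw [Finset.not_nonempty_iff_eq_empty] at h
    exact hP (by simpa [h] using hs.symm)
  obtain ⟨p, hps, hpmax⟩ := s.exists_max_image (fun a ↦ V₁.valuation (a : K)) hsne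
  have hpP : p ∈ P := hs ▸ Ideal.subset_span hps
  have hp0 : (p : K) ≠ 0 := by
    intro hp
    refine hP ?_
    rw [← hs, Ideal.span_eq_bot]
    intro a ha
    have h := hpmax a ha
    rw [hp, map_zero, le_zero_iff, map_eq_zero] at h
    exact Subtype.ext h
  let T : Set K := (fun a : A ↦ (a : K) / p) '' s
  have hT : ∀ a ∈ s, (a : K) / p ∈ T := fun a ha ↦ Set.mem_image_of_mem _ ha
  let A₁' := Algebra.adjoin A T
  let A₁ : Subring K := A₁'.toSubring
  have hfin : Algebra.FiniteType A A₁' :=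
    (Subalgebra.fg_iff_finiteType _).mp (Subalgebra.fg_def.mpr ⟨T, s.finite_toSet.image _, rfl⟩)
  have hN : IsNoetherianRing A₁ := by
    have : IsNoetherianRing A₁' := Algebra.FiniteType.isNoetherianRing A A₁'
    exact this
  have hAA₁ : A ≤ A₁ := fun a ha ↦ A₁'.algebraMap_mem ⟨a, ha⟩
  have hTA₁ : ∀ a ∈ s, (a : K) / p ∈ A₁ := fun a ha ↦ Algebra.subset_adjoin (hT a ha)
  have hA₁V₁ : A₁ ≤ V₁.toSubring := by
    let V' : Subalgebra A K := { V₁.toSubring with algebraMap_mem' := fun a ↦ hAV₁ a.2 }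
    have : A₁' ≤ V' := by
      refine Algebra.adjoin_le ?_
      rintro _ ⟨a, ha, rfl⟩
      refine (V₁.valuation_le_one_iff _).mp ?_
      rw [map_div₀]
      exact div_le_one_of_le₀ (hpmax a ha) zero_le
    exact this
  have : IsFractionRing A₁ K := isFractionRing_of_le hAA₁
  let Q₁ : Ideal A₁ := (maximalIdeal V₁).comap (Subring.inclusion hA₁V₁)
  have hQ₁ : ∀ a : A₁, a ∈ Q₁ ↔ V₁.valuation (a : K) < 1 := fun a ↦
    V₁.valuation_lt_one_iff (Subring.inclusion hA₁V₁ a)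
  let p₁ : A₁ := Subring.inclusion hAA₁ p
  have hp₁ : p₁ ∈ Q₁ := (hQ₁ _).mpr ((valuation_lt_one_iff_of_ofPrime_le hV₁ p).mpr hpP)
  obtain ⟨Q, hQ, hQQ₁⟩ := Ideal.exists_minimalPrimes_le
    (I := Ideal.span {p₁}) (J := Q₁) ((Ideal.span_singleton_le_iff_mem _).mpr hp₁)
  have hQp : Q.IsPrime := hQ.1.1
  have hp₁Q : p₁ ∈ Q := hQ.1.2 (Ideal.mem_span_singleton_self _)
  have hht : Q.height ≤ 1 := Ideal.height_le_one_of_isPrincipal_of_mem_minimalPrimes _ _ hQ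
  let B := LocalSubring.ofPrime A₁ Q
  have hA₁B : A₁ ≤ B.toSubring := LocalSubring.le_ofPrime A₁ Q
  have : IsNoetherianRing B.toSubring := IsLocalization.isNoetherianRing Q.primeCompl _ hN
  have : Ring.KrullDimLE 1 B.toSubring := by
    rw [Ring.krullDimLE_iff, IsLocalization.AtPrime.ringKrullDim_eq_height Q]
    exact_mod_cast hht
  have : IsFractionRing B.toSubring K := isFractionRing_of_le hA₁B
  obtain ⟨V, hV⟩ := B.exists_le_valuationSubring
  refine ⟨V, hAA₁.trans (hA₁B.trans hV.1), hasBoundedDivision_of_krullDimLE_one hV.1, ?_⟩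
  intro a
  rw [show (a : K) = (Subring.inclusion hAA₁ a : A₁) from rfl,
    valuation_lt_one_iff_of_ofPrime_le hV]
  constructor
  · intro h
    exact (valuation_lt_one_iff_of_ofPrime_le hV₁ a).mp ((hQ₁ _).mp (hQQ₁ h))
  · intro h
    rw [← Ideal.mem_comap]
    revert a
    change P ≤ _
    rw [← hs, Ideal.span_le]
    intro a ha
    have h1 : Subring.inclusion hAA₁ a = p₁ * ⟨(a : K) / p, hTA₁ a ha⟩ :=
      Subtype.ext (mul_div_cancel₀ (a : K) hp0).symm
    change Subring.inclusion hAA₁ a ∈ Q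
    rw [h1]
    exact Ideal.mul_mem_right _ _ hp₁Q

end Valuations

end EtaleOpen

namespace EtaleOpen

open IsLocalRing

section Fermat

open Polynomial

variable {K : Type w} [Field K]

lemma mem_of_isField {A : Subring K} [IsFractionRing A K] (hA : IsField A) (z : K) : z ∈ A := by
  obtain ⟨a, ha⟩ := (IsFractionRing.surjective_iff_isField (R := A) (K := K)).mpr hA z
  exact ha ▸ a.2

/-- If neither `z` nor `z⁻¹` belongs to the normal noetherian local domain `A`, then there is a
valuation ring with bounded division dominating `A` in which `z` is residually transcendental
over `A`. -/
lemma exists_residually_transcendental {A : LocalSubring K} [IsNoetherianRing A.toSubring]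
    [IsIntegrallyClosed A.toSubring] [IsFractionRing A.toSubring K] {z : K}
    (hz : z ∉ A.toSubring) (hz' : z⁻¹ ∉ A.toSubring) :
    ∃ V : ValuationSubring K, A ≤ V.toLocalSubring ∧ HasBoundedDivision V ∧ z ∈ V ∧
      ∀ f : A.toSubring[X], V.valuation (aeval z f) < 1 →
        ∀ i, f.coeff i ∈ maximalIdeal A.toSubring := by
  have hS : ∀ f : A.toSubring[X], aeval z f = 0 → ∀ i, f.coeff i ∈ maximalIdeal A.toSubring := by
    intro f hf i hi
    obtain ⟨a, ha⟩ | ⟨a, ha⟩ := mem_or_inv_mem_of_aeval_eq_zero hf hi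
    · exact hz (ha ▸ a.2)
    · exact hz' (ha ▸ a.2)
  let A₀ : Subring K := (aeval z : A.toSubring[X] →ₐ[A.toSubring] K).toRingHom.range
  let φ : A.toSubring[X] →+* A₀ :=
    (aeval z : A.toSubring[X] →ₐ[A.toSubring] K).toRingHom.rangeRestrict
  have hφ : Function.Surjective φ := RingHom.rangeRestrict_surjective _
  have hφz : ∀ f, (φ f : K) = aeval z f := fun f ↦ rfl
  have hN : IsNoetherianRing A₀ := isNoetherianRing_of_surjective _ _ φ hφ
  have hAA₀ : A.toSubring ≤ A₀ := fun a ha ↦ ⟨C ⟨a, ha⟩, by simp; rfl⟩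
  have : IsFractionRing A₀ K := isFractionRing_of_le hAA₀
  set M : Ideal A.toSubring[X] := (maximalIdeal A.toSubring).map C with hM
  have hMp : M.IsPrime := Ideal.isPrime_map_C_of_isPrime
  have hker : RingHom.ker φ ≤ M := by
    intro f hf
    rw [hM, Ideal.mem_map_C_iff]
    exact hS f ((hφz f).symm.trans congr(($hf : K)))
  set P : Ideal A₀ := M.map φ with hP
  have hPp : P.IsPrime := Ideal.map_isPrime_of_surjective hφ hker
  have hPc : ∀ f, φ f ∈ P ↔ ∀ i, f.coeff i ∈ maximalIdeal A.toSubring := by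
    intro f
    rw [← Ideal.mem_comap, hP, Ideal.comap_map_of_surjective' _ hφ, sup_eq_left.mpr hker, hM,
      Ideal.mem_map_C_iff]
  have hPA : ∀ a : A.toSubring, φ (C a) ∈ P ↔ a ∈ maximalIdeal A.toSubring := by
    intro a
    rw [hPc]
    refine ⟨fun h ↦ by simpa using h 0, fun h i ↦ ?_⟩
    rw [coeff_C]
    split_ifs
    exacts [h, zero_mem _]
  have hA : ∃ a ∈ maximalIdeal A.toSubring, a ≠ 0 := by
    by_contra! h
    have hm : maximalIdeal A.toSubring = ⊥ := (Submodule.eq_bot_iff _).mpr h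
    have hf : IsField A.toSubring := IsLocalRing.isField_iff_maximalIdeal_eq.mpr hm
    exact hz (mem_of_isField hf z)
  have hP0 : P ≠ ⊥ := by
    obtain ⟨a, ha, ha0⟩ := hA
    intro h
    have h1 := (hPA a).mpr ha
    rw [h, Submodule.mem_bot] at h1
    have h2 : aeval z (C a) = 0 := (hφz _).symm.trans congr(($h1 : K))
    rw [aeval_C] at h2
    exact ha0 (Subtype.ext h2)
  obtain ⟨V, hA₀V, hV, hVP⟩ := exists_hasBoundedDivision P hP0
  refine ⟨V, ⟨hAA₀.trans hA₀V, ⟨fun a ha ↦ ?_⟩⟩, hV, hA₀V ⟨X, by simp⟩, fun f hf ↦ ?_⟩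
  · by_contra hna
    have h1 := (hVP _).mpr ((hPA a).mpr hna)
    rw [hφz, aeval_C] at h1
    exact (V.valuation_lt_one_iff (Subring.inclusion (hAA₀.trans hA₀V) a)).mpr h1 ha
  · exact (hPc f).mp ((hVP _).mp hf)

/-- The residue map of a valuation ring on a subring. -/
noncomputable abbrev residueOfLE {A : Subring K} {V : ValuationSubring K} (h : A ≤ V.toSubring) :
    A →+* ResidueField V :=
  (residue V).comp (Subring.inclusion h)

lemma toSubring_le {A : LocalSubring K} {V : ValuationSubring K}
    (h : A ≤ V.toLocalSubring) : A.toSubring ≤ V.toSubring := h.1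

lemma exists_monic_valuation_lt_one {A : Subring K} {V : ValuationSubring K}
    (h : A ≤ V.toSubring) {a : K} (ha : a ∈ V)
    (hint : (residueOfLE h).IsIntegralElem (residue V ⟨a, ha⟩)) :
    ∃ f : A[X], f.Monic ∧ V.valuation (aeval a f) < 1 := by
  obtain ⟨f, hf, hf0⟩ := hint
  refine ⟨f, hf, ?_⟩
  rw [← hom_eval₂, residue_eq_zero_iff, V.valuation_lt_one_iff] at hf0
  convert hf0 using 2
  change _ = V.subtype _
  rw [hom_eval₂]
  rfl

/-- The residues of `A'` are integral over `A`. -/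
def IsResiduallyIntegral {A A' : Subring K} {V : ValuationSubring K} (h : A ≤ V.toSubring)
    (h' : A' ≤ V.toSubring) : Prop :=
  ∀ a : A', (residueOfLE h).IsIntegralElem (residueOfLE h' a)

lemma IsResiduallyIntegral.trans {A : Subring K} {A' A'' : LocalSubring K}
    {V : ValuationSubring K} {h : A ≤ V.toSubring} {h' : A' ≤ V.toLocalSubring}
    {h'' : A'' ≤ V.toLocalSubring} (H : IsResiduallyIntegral h (toSubring_le h'))
    (H' : ∀ c : A''.toSubring, ∃ f : A'.toSubring[X], f.Monic ∧
      ∃ m ∈ maximalIdeal A''.toSubring, f.eval₂ A'.toSubring.subtype c = m) :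
    IsResiduallyIntegral h (toSubring_le h'') := by
  intro c
  obtain ⟨f, hf, m, hm, hfm⟩ := H' c
  let := (residueOfLE h).toAlgebra
  let ψ : A'.toSubring →+* integralClosure A (ResidueField V) :=
    (residueOfLE (toSubring_le h')).codRestrict _ H
  refine isIntegral_trans (R := A) (A := integralClosure A (ResidueField V)) _
    ⟨f.map ψ, hf.map ψ, ?_⟩
  rw [eval₂_map]
  have h1 : (algebraMap (integralClosure A (ResidueField V)) (ResidueField V)).comp ψ =
    (residue V).comp (Subring.inclusion (toSubring_le h')) := rfl
  have h2 : residueOfLE (toSubring_le h'') c =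
      residue V (Subring.inclusion (toSubring_le h'') c) := rfl
  rw [h1, h2, ← hom_eval₂]
  have h3 : f.eval₂ (Subring.inclusion (toSubring_le h')) (Subring.inclusion (toSubring_le h'') c) =
      Subring.inclusion (toSubring_le h'') m := by
    refine Subtype.ext (Eq.trans ?_ hfm)
    change V.subtype _ = _
    rw [hom_eval₂]
    rfl
  rw [h3, residue_eq_zero_iff]
  have := h''.2
  exact map_nonunit (Subring.inclusion h''.1) m hm

/-- A solution of `y ^ n = 1 + z ^ n` cannot be resolved by point blow-ups along a valuation ring
with bounded division. -/
lemma false_of_residually_transcendental {n : ℕ} (hn : 3 ≤ n) {A : LocalSubring K}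
    [IsFractionRing A.toSubring K] (hnA : IsUnit (n : A.toSubring))
    {z y : K} (hzy : y ^ n = 1 + z ^ n) {V : ValuationSubring K} (hAV : A ≤ V.toLocalSubring)
    (hz : z ∈ V) (hz' : z⁻¹ ∈ V)
    (hzA : ¬ (residueOfLE (toSubring_le hAV)).IsIntegralElem (residue V ⟨z, hz⟩))
    (hzA' : ¬ (residueOfLE (toSubring_le hAV)).IsIntegralElem (residue V ⟨z⁻¹, hz'⟩))
    (IH : ∀ A' : LocalSubring K, A ≤ A' → IsRegularLocalRing A'.toSubring →
      ringKrullDim A'.toSubring < ringKrullDim A.toSubring →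
      z ∈ A'.toSubring ∨ z⁻¹ ∈ A'.toSubring) (N : ℕ) :
    ∀ (A' : LocalSubring K) (_ : A ≤ A') (hA'V : A' ≤ V.toLocalSubring),
      IsRegularLocalRing A'.toSubring → ringKrullDim A'.toSubring = ringKrullDim A.toSubring →
      IsResiduallyIntegral (toSubring_le hAV) (toSubring_le hA'V) →
      ∀ a b : A'.toSubring, b ≠ 0 → z = a / b → ¬ ∀ c : ℕ → K, (∀ i, V.valuation (c i) < 1) →
        V.valuation (∏ i ∈ Finset.range N, c i) < V.valuation (b : K) := by
  have hn0 : n ≠ 0 := by lia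
  have hz0 : z ≠ 0 := by
    rintro rfl
    refine hzA ?_
    rw [show (⟨0, hz⟩ : V) = 0 from rfl, map_zero]
    exact ⟨X, monic_X, by simp⟩
  induction N with
  | zero =>
    intro A' _ hA'V _ _ _ a b _ _ h
    have h1 := h (fun _ ↦ 0) (by simp)
    rw [Finset.prod_range_zero, map_one] at h1
    exact h1.not_ge ((V.valuation_le_one_iff _).mpr (hA'V.1 b.2))
  | succ N ih =>
    intro A' hAA' hA'V hreg hdim hint a b hb hab hbd
    have : IsFractionRing A'.toSubring K := isFractionRing_of_le hAA'.1
    have hzA₁ : z ∉ A'.toSubring := fun h ↦ hzA (hint ⟨z, h⟩)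
    have hzA₂ : z⁻¹ ∉ A'.toSubring := fun h ↦ hzA' (hint ⟨z⁻¹, h⟩)
    obtain ⟨A'', x, hA'A'', hA''V, hreg'', hx0, hxm, hdvd, hle, hcl, hf⟩ :=
      exists_blowUp A' V hA'V fun h ↦ hzA₁ (mem_of_isField h z)
    have : IsFractionRing A''.toSubring K := isFractionRing_of_le hA'A''.1
    have := isIntegrallyClosed_of_isRegularLocalRing A''.toSubring
    have hxK : (x : K) ≠ 0 := fun h ↦ hx0 (Subtype.ext h)
    have hbK : (b : K) ≠ 0 := fun h ↦ hb (Subtype.ext h)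
    have hxv : V.valuation (x : K) < 1 := by
      have := hA'V.2
      exact (V.valuation_lt_one_iff (Subring.inclusion (toSubring_le hA'V) x)).mp
        (map_nonunit (Subring.inclusion hA'V.1) x hxm)
    have hnA' : IsUnit (n : A'.toSubring) := by
      simpa using hnA.map (Subring.inclusion hAA'.1)
    -- the solution does not extend to `A''`
    have key : ∀ w v : K, ∀ hw : w ∈ V, v ^ n = 1 + w ^ n → w ∈ A''.toSubring →
        (residueOfLE (toSubring_le hAV)).IsIntegralElem (residue V ⟨w, hw⟩) := by
      intro w v hw hwv hwA
      obtain ⟨v', rfl⟩ : ∃ v' : A''.toSubring, algebraMap A''.toSubring K v' = v := by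
        refine IsIntegrallyClosed.isIntegral_iff.mp (IsIntegral.of_pow (R := A''.toSubring)
          (Nat.pos_of_ne_zero hn0) ?_)
        rw [hwv]
        exact isIntegral_algebraMap (R := A''.toSubring) (A := K) (x := 1 + ⟨w, hwA⟩ ^ n)
      obtain ⟨c, u, hcu⟩ := hf n hn hnA' ⟨w, hwA⟩ v' (Subtype.ext hwv)
      have h1 : residue V ⟨w, hw⟩ = residueOfLE (toSubring_le hA'V) c := by
        rw [← sub_eq_zero, RingHom.comp_apply, ← map_sub, residue_eq_zero_iff,
          V.valuation_lt_one_iff]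
        change V.valuation (w - c) < 1
        rw [hcu, map_mul]
        exact mul_lt_one_of_lt_of_le hxv ((V.valuation_le_one_iff _).mpr ((toSubring_le hA''V) u.2))
      rw [h1]
      exact hint c
    have hz₁ : z ∉ A''.toSubring := fun h ↦ hzA (key z y hz hzy h)
    have hz₂ : z⁻¹ ∉ A''.toSubring := fun h ↦ hzA' (key z⁻¹ (y * z⁻¹) hz' (by
      rw [mul_pow, hzy, add_mul, ← mul_pow, mul_inv_cancel₀ hz0]; simp [add_comm]) h)
    have hdim'' : ringKrullDim A''.toSubring = ringKrullDim A'.toSubring := by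
      by_contra hne
      obtain h | h := IH A'' (hAA'.trans hA'A'') hreg'' (hdim ▸ lt_of_le_of_ne hle hne)
      exacts [hz₁ h, hz₂ h]
    have ham : a ∈ maximalIdeal A'.toSubring := by
      intro ha
      obtain ⟨a', ha'⟩ := ha.exists_right_inv
      have ha'' : (a : K) * a' = 1 := congr(($ha' : K))
      refine hzA₂ ?_
      have : z⁻¹ = (b * a' : A'.toSubring) := by
        have ha0 : (a : K) ≠ 0 := left_ne_zero_of_mul_eq_one ha''
        rw [hab, inv_div, div_eq_iff ha0, Subring.coe_mul]
        linear_combination -(b : K) * ha''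
      rw [this]
      exact Subtype.mem _
    have hbm : b ∈ maximalIdeal A'.toSubring := by
      intro hb
      obtain ⟨b', hb'⟩ := hb.exists_right_inv
      have hb'' : (b : K) * b' = 1 := congr(($hb' : K))
      refine hzA₁ ?_
      have : z = (a * b' : A'.toSubring) := by
        rw [hab, div_eq_iff hbK, Subring.coe_mul]
        linear_combination -(a : K) * hb''
      rw [this]
      exact Subtype.mem _
    obtain ⟨a', ha'⟩ := hdvd a ham
    obtain ⟨b', hb'⟩ := hdvd b hbm
    have hb'0 : b' ≠ 0 := by
      rintro rfl
      exact hbK (by simpa using hb')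
    refine ih A'' (hAA'.trans hA'A'') hA''V hreg'' (hdim''.trans hdim)
      (IsResiduallyIntegral.trans (h' := hA'V) (h'' := hA''V) hint (hcl hdim''))
      a' b' hb'0 ?_ ?_
    · rw [hab, ha', hb', mul_div_mul_left _ _ hxK]
    · intro c hc
      have h1 := hbd (fun i ↦ Nat.casesOn i x c) (fun i ↦ by
        cases i
        exacts [hxv, hc _])
      rw [Finset.prod_range_succ', hb', mul_comm, map_mul, map_mul] at h1
      exact lt_of_mul_lt_mul_left' h1

/-- A solution `(z, y)` of `y ^ n = 1 + z ^ n` in the fraction field of a regular local ring is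
such that `z` or `z⁻¹` lies in the ring. -/
theorem mem_or_inv_mem_of_pow_eq_one_add_pow {n : ℕ} (hn : 3 ≤ n) {z y : K}
    (hzy : y ^ n = 1 + z ^ n) (A : LocalSubring K) [IsRegularLocalRing A.toSubring]
    [IsFractionRing A.toSubring K] (hnA : IsUnit (n : A.toSubring)) :
    z ∈ A.toSubring ∨ z⁻¹ ∈ A.toSubring := by
  obtain ⟨d, hd⟩ := exists_ringKrullDim_eq A.toSubring
  induction d using Nat.strong_induction_on generalizing A with
  | _ d ih =>
  by_contra! hz
  have := isIntegrallyClosed_of_isRegularLocalRing A.toSubring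
  obtain ⟨V, hAV, hV, hzV, htr⟩ := exists_residually_transcendental hz.1 hz.2
  have hzV' : z⁻¹ ∈ V := by
    rw [← V.valuation_le_one_iff, map_inv₀, ]
    refine inv_le_one_of_one_le₀ ?_
    by_contra! h
    have h1 := htr X (by simpa using h) 1
    rw [coeff_X_one] at h1
    exact (Ideal.ne_top_iff_one _).mp (Ideal.IsPrime.ne_top inferInstance) h1
  have hzA : ¬ (residueOfLE (toSubring_le hAV)).IsIntegralElem (residue V ⟨z, hzV⟩) := by
    intro h
    obtain ⟨f, hf, hfz⟩ := exists_monic_valuation_lt_one (toSubring_le hAV) hzV h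
    have h1 := htr f hfz f.natDegree
    rw [hf.coeff_natDegree] at h1
    exact (Ideal.ne_top_iff_one _).mp (Ideal.IsPrime.ne_top inferInstance) h1
  have hzA' : ¬ (residueOfLE (toSubring_le hAV)).IsIntegralElem (residue V ⟨z⁻¹, hzV'⟩) := by
    intro h
    obtain ⟨f, hf, hfz⟩ := exists_monic_valuation_lt_one (toSubring_le hAV) hzV' h
    have h0 : z ≠ 0 := fun h ↦ hz.1 (h ▸ zero_mem _)
    have h1 := htr f.reverse (by
      let := invertibleOfNonzero (inv_ne_zero h0)
      have h2 := eval₂_reverse_mul_pow (algebraMap A.toSubring K) z⁻¹ f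
      rw [invOf_eq_inv, inv_inv, inv_pow, ← div_eq_mul_inv, div_eq_iff (pow_ne_zero _ h0)] at h2
      rw [aeval_def, h2, map_mul, map_pow]
      exact mul_lt_one_of_lt_of_le hfz (pow_le_one' ((V.valuation_le_one_iff _).mpr hzV) _)) 0
    rw [coeff_zero_reverse, hf] at h1
    exact (Ideal.ne_top_iff_one _).mp (Ideal.IsPrime.ne_top inferInstance) h1
  obtain ⟨a, b, hb, hab⟩ := IsFractionRing.div_surjective (A := A.toSubring) z
  have hb0 : b ≠ 0 := nonZeroDivisors.ne_zero hb
  obtain ⟨N, hN⟩ := hV b fun h ↦ hb0 (Subtype.ext h)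
  refine false_of_residually_transcendental hn hnA hzy hAV hzV hzV' hzA hzA' ?_ N A le_rfl hAV
    inferInstance rfl ?_ a b hb0 hab.symm hN
  · intro A' hAA' hreg hlt
    obtain ⟨d', hd'⟩ := exists_ringKrullDim_eq A'.toSubring
    have := isFractionRing_of_le (K := K) hAA'.1
    refine ih d' ?_ A' (by simpa using hnA.map (Subring.inclusion hAA'.1)) hd'
    rw [hd, hd'] at hlt
    exact_mod_cast hlt
  · intro a
    exact ⟨X - C a, monic_X_sub_C a, by simp⟩

lemma exists_isUnit_natCast (R : Type*) [CommRing R] [IsLocalRing R] :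
    ∃ n : ℕ, 3 ≤ n ∧ IsUnit (n : R) := by
  by_contra! h
  have h3 : ((3 : ℕ) : R) ∈ maximalIdeal R := h 3 le_rfl
  have h4 : ((4 : ℕ) : R) ∈ maximalIdeal R := h 4 (by lia)
  have h1 := sub_mem h4 h3
  rw [show ((4 : ℕ) : R) - (3 : ℕ) = 1 by push_cast; norm_num] at h1
  exact (Ideal.ne_top_iff_one _).mp (Ideal.IsPrime.ne_top inferInstance) h1

/-- The first equation confines `z` or `z⁻¹` to the regular local ring, the second one excludes
that `z⁻¹` is in the maximal ideal. -/
theorem exists_algebraMap_eq_of_equations {R : Type*} [CommRing R] [IsDomain R]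
    [IsRegularLocalRing R] [Algebra R K] [IsFractionRing R K] {n : ℕ} (hn : 3 ≤ n)
    (hnR : IsUnit (n : R)) {π : R} (hπ : π ∈ maximalIdeal R) (hπ' : π ∉ maximalIdeal R ^ 2)
    {z y y' : K} (h : y ^ n = 1 + z ^ n) (h' : y' ^ 2 + y' = algebraMap R K π * z ^ 2) :
    ∃ r, algebraMap R K r = z := by
  have := isIntegrallyClosed_of_isRegularLocalRing R
  let A := LocalSubring.range (algebraMap R K)
  have hA : A.toSubring = (algebraMap R K).range := LocalSubring.range_toSubring _
  let e : R ≃+* A.toSubring :=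
    (RingEquiv.ofBijective (algebraMap R K).rangeRestrict ⟨fun a b hab ↦
      IsFractionRing.injective R K (congrArg Subtype.val hab),
      RingHom.rangeRestrict_surjective _⟩).trans
      (RingEquiv.subringCongr hA.symm)
  have : IsRegularLocalRing A.toSubring := IsRegularLocalRing.of_ringEquiv e
  have : IsFractionRing A.toSubring K := by
    refine IsFractionRing.of_field A.toSubring K fun z ↦ ?_
    obtain ⟨a, b, -, rfl⟩ := IsFractionRing.div_surjective (A := R) z
    exact ⟨e a, e b, rfl⟩
  obtain hz | hz := mem_or_inv_mem_of_pow_eq_one_add_pow hn h A (by simpa using hnR.map e)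
  · rw [hA] at hz
    exact hz
  rw [hA] at hz
  obtain ⟨w, hw⟩ := hz
  by_cases hz0 : z = 0
  · exact ⟨0, by rw [hz0, map_zero]⟩
  have hzw : z * algebraMap R K w = 1 := by rw [hw, mul_inv_cancel₀ hz0]
  by_cases hwu : IsUnit w
  · obtain ⟨w', hw'⟩ := hwu.exists_right_inv
    have hw'K := congr(algebraMap R K $hw')
    rw [map_mul, map_one] at hw'K
    refine ⟨w', ?_⟩
    linear_combination -algebraMap R K w' * hzw + z * hw'K
  exfalso
  have hu : (y' * algebraMap R K w) ^ 2 + algebraMap R K w * (y' * algebraMap R K w) =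
      algebraMap R K π := by
    linear_combination (algebraMap R K w) ^ 2 * h' +
      algebraMap R K π * (z * algebraMap R K w + 1) * hzw
  obtain ⟨u, hu'⟩ : ∃ u, algebraMap R K u = y' * algebraMap R K w := by
    refine IsIntegrallyClosed.isIntegral_iff.mp
      ⟨X ^ 2 + (C w * X - C π), monic_X_pow_add (by compute_degree!), ?_⟩
    simp only [eval₂_add, eval₂_sub, eval₂_mul, eval₂_pow, eval₂_X, eval₂_C]
    linear_combination hu
  rw [← hu', ← map_pow, ← map_mul, ← map_add] at hu
  have hu := IsFractionRing.injective R K hu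
  have hum : u ∈ maximalIdeal R := by
    rw [← hu, sq, ← add_mul] at hπ
    refine (Ideal.IsPrime.mem_or_mem inferInstance hπ).elim (fun h ↦ ?_) id
    exact (Submodule.add_mem_iff_left _ hwu).mp h
  refine hπ' ?_
  rw [← hu, sq, sq]
  exact add_mem (Ideal.mul_mem_mul hum hum) (Ideal.mul_mem_mul hwu hum)

lemma exists_mem_maximalIdeal_notMem_sq {R : Type*} [CommRing R] [IsRegularLocalRing R]
    (hR : ¬ IsField R) : ∃ π ∈ maximalIdeal R, π ∉ maximalIdeal R ^ 2 := by
  obtain ⟨s, hs⟩ := exists_isRegularSystem R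
  by_cases h : IsEmpty s
  · exact absurd hs.isField hR
  · obtain ⟨i⟩ := not_isEmpty_iff.mp h
    exact ⟨_, hs.mem i, hs.notMem_sq i⟩

end Fermat

end EtaleOpen

namespace EtaleOpen

section WeilRestriction

open TensorProduct MvPolynomial

attribute [local instance] Algebra.TensorProduct.rightAlgebra

variable {A D : Type*} [CommRing A] [CommRing D] [Algebra A D]
  {ι : Type*} [Fintype ι] (e : Module.Basis ι A D) {σ : Type*}

/-- The generic `σ`-tuple of elements of `D`, with coordinates the variables. -/
noncomputable def genericPoint (s : σ) : MvPolynomial (σ × ι) A ⊗[A] D :=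
  ∑ i, X (s, i) ⊗ₜ e i

/-- The coordinates of the value of a polynomial at the generic tuple. -/
noncomputable def coordPolynomial (f : MvPolynomial σ D) (i : ι) : MvPolynomial (σ × ι) A :=
  (Algebra.TensorProduct.basis (MvPolynomial (σ × ι) A) e).repr (aeval (genericPoint e) f) i

section

variable {C D' : Type*} [CommRing C] [CommRing D'] [Algebra A C] [Algebra C D'] [Algebra D D']
  [Algebra A D'] [IsScalarTower A C D'] [IsScalarTower A D D'] {b : Module.Basis ι C D'}

lemma aeval_coordPolynomial (hb : ∀ i, b i = algebraMap D D' (e i)) (c : σ × ι → C)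
    (f : MvPolynomial σ D) (i : ι) :
    aeval c (coordPolynomial e f i) = b.repr (aeval (fun s ↦ ∑ i, c (s, i) • b i) f) i := by
  let Θ : MvPolynomial (σ × ι) A ⊗[A] D →ₐ[A] D' := Algebra.TensorProduct.lift
    ((IsScalarTower.toAlgHom A C D').comp (aeval c)) (IsScalarTower.toAlgHom A D D')
    fun _ _ ↦ Commute.all _ _
  have hΘ : ∀ q d, Θ (q ⊗ₜ d) = aeval c q • algebraMap D D' d := fun q d ↦ by
    simp [Θ, Algebra.smul_def]
  have h1 : Θ (aeval (genericPoint e) f) = aeval (fun s ↦ ∑ i, c (s, i) • b i) f := by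
    have := map_aeval (genericPoint e) Θ.toRingHom f
    refine this.trans ?_
    rw [aeval_eq_eval₂Hom]
    congr 2
    · ext d
      exact (hΘ 1 d).trans (by simp)
    · ext s
      change Θ _ = _
      simp [genericPoint, hΘ, hb]
  have h2 := (Algebra.TensorProduct.basis (MvPolynomial (σ × ι) A) e).sum_repr
    (aeval (genericPoint e) f)
  rw [← h1, ← h2, map_sum]
  have h3 : ∀ j, Θ ((Algebra.TensorProduct.basis (MvPolynomial (σ × ι) A) e).repr
      (aeval (genericPoint e) f) j • Algebra.TensorProduct.basis (MvPolynomial (σ × ι) A) e j) =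
      aeval c (coordPolynomial e f j) • b j := by
    intro j
    rw [Algebra.TensorProduct.basis_apply, TensorProduct.smul_tmul', smul_eq_mul, mul_one, hΘ, hb]
    rfl
  simp_rw [h3]
  exact congr($(b.repr_sum_self fun j ↦ aeval c (coordPolynomial e f j)) i).symm

end

/-- The Weil restriction along `A → D` of the algebra with relations `S`. -/
abbrev RestrictionRing (S : Set (MvPolynomial σ D)) : Type _ :=
  MvPolynomial (σ × ι) A ⧸ Ideal.span (Set.range fun p : S × ι ↦ coordPolynomial e p.1.1 p.2)

variable {E : Type*} [CommRing E] [Algebra D E] {π : MvPolynomial σ D →ₐ[D] E}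
  {S : Set (MvPolynomial σ D)}

section

variable {C D' : Type*} [CommRing C] [CommRing D'] [Algebra A C] [Algebra C D'] [Algebra D D']
  (b : Module.Basis ι C D')

/-- The homomorphisms `φ` from the Weil restriction and `ψ` correspond to each other. -/
def Corresponds (π : MvPolynomial σ D →ₐ[D] E) (φ : RestrictionRing e S →ₐ[A] C)
    (ψ : E →ₐ[D] D') : Prop :=
  ∀ s, ψ (π (X s)) = ∑ i, φ (Ideal.Quotient.mk _ (X (s, i))) • b i

variable {b}

lemma Corresponds.left_unique {φ φ' : RestrictionRing e S →ₐ[A] C} {ψ : E →ₐ[D] D'}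
    (h : Corresponds e b π φ ψ) (h' : Corresponds e b π φ' ψ) : φ = φ' := by
  refine Ideal.Quotient.algHom_ext _ (MvPolynomial.algHom_ext fun ⟨s, i⟩ ↦ ?_)
  have h1 := congr(b.repr $((h s).symm.trans (h' s)) i)
  rwa [b.repr_sum_self, b.repr_sum_self] at h1

lemma Corresponds.right_unique (hπ : Function.Surjective π)
    {φ : RestrictionRing e S →ₐ[A] C} {ψ ψ' : E →ₐ[D] D'}
    (h : Corresponds e b π φ ψ) (h' : Corresponds e b π φ ψ') : ψ = ψ' := by
  have : ψ.comp π = ψ'.comp π := MvPolynomial.algHom_ext fun s ↦ (h s).trans (h' s).symm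
  ext x
  obtain ⟨x, rfl⟩ := hπ x
  exact congr($this x)

variable [Algebra A D'] [IsScalarTower A C D'] [IsScalarTower A D D']

lemma exists_corresponds_right (hb : ∀ i, b i = algebraMap D D' (e i))
    (hπ : Function.Surjective π) (hS : RingHom.ker π = Ideal.span S)
    (φ : RestrictionRing e S →ₐ[A] C) : ∃ ψ : E →ₐ[D] D', Corresponds e b π φ ψ := by
  let c : σ × ι → C := fun p ↦ φ (Ideal.Quotient.mk _ (X p))
  have hc : ∀ q, aeval c q = φ (Ideal.Quotient.mk _ q) := fun q ↦ by
    have : aeval c = φ.comp (Ideal.Quotient.mkₐ A _) := by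
      ext p
      simp [c]
    rw [this]
    rfl
  refine ⟨AlgHom.liftOfSurjective π hπ (aeval fun s ↦ ∑ i, c (s, i) • b i) ?_, fun s ↦ ?_⟩
  · change RingHom.ker π ≤ _
    rw [hS, Ideal.span_le]
    intro f hf
    refine b.ext_elem fun i ↦ ?_
    change b.repr (aeval _ f) i = _
    have h1 : coordPolynomial e f i ∈
        Ideal.span (Set.range fun p : S × ι ↦ coordPolynomial e p.1.1 p.2) :=
      Ideal.subset_span ⟨(⟨f, hf⟩, i), rfl⟩
    rw [← aeval_coordPolynomial e hb, hc, Ideal.Quotient.eq_zero_iff_mem.mpr h1]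
    simp
  · rw [AlgHom.liftOfSurjective_apply, aeval_X]

lemma exists_corresponds_left (hb : ∀ i, b i = algebraMap D D' (e i))
    (hS : RingHom.ker π = Ideal.span S)
    (ψ : E →ₐ[D] D') : ∃ φ : RestrictionRing e S →ₐ[A] C, Corresponds e b π φ ψ := by
  let c : σ × ι → C := fun p ↦ b.repr (ψ (π (X p.1))) p.2
  have hc : (aeval fun s ↦ ∑ i, c (s, i) • b i) = ψ.comp π := by
    ext s
    simp [c, b.sum_repr]
  refine ⟨Ideal.Quotient.liftₐ _ (aeval c) ?_, fun s ↦ ?_⟩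
  · change _ ≤ RingHom.ker _
    rw [Ideal.span_le]
    rintro _ ⟨⟨⟨f, hf⟩, i⟩, rfl⟩
    have h1 : f ∈ RingHom.ker π := hS ▸ Ideal.subset_span hf
    change aeval c (coordPolynomial e f i) = 0
    rw [aeval_coordPolynomial e hb, hc, AlgHom.comp_apply, (RingHom.mem_ker).mp h1]
    simp
  · change _ = ∑ i, aeval c (X (s, i)) • b i
    simp_rw [aeval_X]
    exact (b.sum_repr _).symm

end

lemma formallyEtale_restrictionRing [Algebra.FormallyEtale D E] (hπ : Function.Surjective π)
    (hS : RingHom.ker π = Ideal.span S) : Algebra.FormallyEtale A (RestrictionRing e S) := by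
  refine Algebra.FormallyEtale.iff_comp_bijective.mpr fun C _ _ I hI ↦ ?_
  let b := Algebra.TensorProduct.basis C e
  let b' := Algebra.TensorProduct.basis (C ⧸ I) e
  have hb : ∀ i, b i = algebraMap D (C ⊗[A] D) (e i) := fun i ↦
    Algebra.TensorProduct.basis_apply _ _
  have hb' : ∀ i, b' i = algebraMap D ((C ⧸ I) ⊗[A] D) (e i) := fun i ↦
    Algebra.TensorProduct.basis_apply _ _
  let q₀ : C ⊗[A] D →ₐ[A] (C ⧸ I) ⊗[A] D :=
    Algebra.TensorProduct.map (Ideal.Quotient.mkₐ A I) (AlgHom.id A D)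
  let q : C ⊗[A] D →ₐ[D] (C ⧸ I) ⊗[A] D :=
    { q₀ with
      commutes' := fun d ↦ by
        change q₀ (1 ⊗ₜ d) = 1 ⊗ₜ d
        simp [q₀] }
  have hq : ∀ c d, q (c ⊗ₜ d) = Ideal.Quotient.mk I c ⊗ₜ d := fun c d ↦ by
    change q₀ (c ⊗ₜ d) = _
    simp [q₀]
  have hqs : Function.Surjective q := by
    change Function.Surjective q₀
    exact TensorProduct.map_surjective Ideal.Quotient.mk_surjective Function.surjective_id
  have hqn : IsNilpotent (RingHom.ker (q : C ⊗[A] D →+* (C ⧸ I) ⊗[A] D)) := by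
    refine ⟨2, ?_⟩
    have h1 : RingHom.ker q₀ = _ := Algebra.TensorProduct.rTensor_ker
      (Ideal.Quotient.mkₐ A I) (C := D) (Ideal.Quotient.mkₐ_surjective A I)
    have h2 : RingHom.ker (q : C ⊗[A] D →+* (C ⧸ I) ⊗[A] D) = RingHom.ker q₀ := rfl
    have h3 : RingHom.ker (Ideal.Quotient.mkₐ A I) = I := Ideal.Quotient.mkₐ_ker A I
    rw [h2, h1, ← Ideal.map_pow, h3, hI, Ideal.map_bot]
    rfl
  have hcomp : ∀ (φ : RestrictionRing e S →ₐ[A] C) (ψ : E →ₐ[D] C ⊗[A] D),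
      Corresponds e b π φ ψ →
      Corresponds e b' π ((Ideal.Quotient.mkₐ A I).comp φ) (q.comp ψ) := by
    intro φ ψ h s
    rw [AlgHom.comp_apply, h s, map_sum]
    refine Finset.sum_congr rfl fun i _ ↦ ?_
    simp only [b, b', Algebra.TensorProduct.basis_apply, TensorProduct.smul_tmul', smul_eq_mul,
      mul_one, hq]
    rfl
  constructor
  · intro φ φ' h
    obtain ⟨ψ, hψ⟩ := exists_corresponds_right e hb hπ hS φ
    obtain ⟨ψ', hψ'⟩ := exists_corresponds_right e hb hπ hS φ'
    have h1 := hcomp φ' ψ' hψ'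
    rw [← h] at h1
    have h2 := (hcomp φ ψ hψ).right_unique e hπ h1
    have h3 : ψ = ψ' := Algebra.FormallyUnramified.lift_unique' q hqn ψ ψ' h2
    exact hψ.left_unique e (h3 ▸ hψ')
  · intro φ'
    obtain ⟨ψ', hψ'⟩ := exists_corresponds_right e hb' hπ hS φ'
    let ψ := Algebra.FormallySmooth.liftOfSurjective ψ' q hqs hqn
    obtain ⟨φ, hφ⟩ := exists_corresponds_left e hb hS ψ
    refine ⟨φ, ?_⟩
    have h1 := hcomp φ ψ hφ
    rw [Algebra.FormallySmooth.comp_liftOfSurjective] at h1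
    exact h1.left_unique e hψ'

/-- The Weil restriction of an étale algebra along a finite free ring extension. -/
theorem exists_etale_weilRestriction {A D E : Type w} [CommRing A] [CommRing D] [CommRing E]
    [Algebra A D] [Algebra D E] [Algebra.Etale D E] {ι : Type w} [Fintype ι]
    (e : Module.Basis ι A D) :
    ∃ (B : Type w) (_ : CommRing B) (_ : Algebra A B), Algebra.Etale A B ∧
      ∀ (C D' : Type w) [CommRing C] [CommRing D'] [Algebra A C] [Algebra C D'] [Algebra D D']
        [Algebra A D'] [IsScalarTower A C D'] [IsScalarTower A D D'] (b : Module.Basis ι C D'),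
        (∀ i, b i = algebraMap D D' (e i)) →
          (Nonempty (B →ₐ[A] C) ↔ Nonempty (E →ₐ[D] D')) := by
  obtain ⟨σ, _, π, hπ, S, hS⟩ := Algebra.FinitePresentation.iff_quotient_mvPolynomial'.mp
    (inferInstance : Algebra.FinitePresentation D E)
  have hS' : RingHom.ker π = Ideal.span (S : Set (MvPolynomial σ D)) := hS.symm
  refine ⟨RestrictionRing e (S : Set (MvPolynomial σ D)), inferInstance, inferInstance, ?_, ?_⟩
  · have := formallyEtale_restrictionRing e hπ hS'
    exact ⟨this, .quotient (Submodule.fg_span (Set.finite_range _))⟩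
  · intro C D' _ _ _ _ _ _ _ _ b hb
    exact ⟨fun ⟨φ⟩ ↦ (exists_corresponds_right e hb hπ hS' φ).nonempty,
      fun ⟨ψ⟩ ↦ (exists_corresponds_left e hb hS' ψ).nonempty⟩

end WeilRestriction

end EtaleOpen

namespace EtaleOpen

open IsLocalRing

section Hensel

open Polynomial TensorProduct

lemma exists_standardEtalePair_hasMap {R B k : Type*} [CommRing R] [CommRing B] [Algebra R B]
    [Algebra.Etale R B] [Field k] [Algebra R k] (φ : B →ₐ[R] k) :
    ∃ (P : StandardEtalePair R) (_ : B →ₐ[R] P.Ring) (x : k), P.HasMap x := by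
  have hQ : (RingHom.ker φ).IsPrime := RingHom.ker_isPrime φ
  obtain ⟨f, hf, hst⟩ := Algebra.IsEtaleAt.exists_isStandardEtale (R := R) (RingHom.ker φ)
  obtain ⟨P⟩ := hst.nonempty_standardEtalePresentation
  let l : Localization.Away f →ₐ[R] k := IsLocalization.Away.liftAlgHom f (f := φ)
    (isUnit_iff_ne_zero.mpr fun h ↦ hf h)
  exact ⟨P.P, P.equivRing.toAlgHom.comp (IsScalarTower.toAlgHom R B (Localization.Away f)),
    l P.x, P.hasMap.map l⟩

/-- Points of étale algebras over the residue field of a henselian local ring lift. -/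
lemma nonempty_algHom_of_henselianLocalRing {R B : Type*} [CommRing R] [HenselianLocalRing R]
    [CommRing B] [Algebra R B] [Algebra.Etale R B] (φ : B →ₐ[R] ResidueField R) :
    Nonempty (B →ₐ[R] R) := by
  obtain ⟨P, j, x, hx⟩ := exists_standardEtalePair_hasMap φ
  have H := (HenselianLocalRing.TFAE R).out 0 1
  obtain ⟨a, ha, hax⟩ := H.mp ‹_› P.f P.monic_f x hx.1 hx.isUnit_derivative_f.ne_zero
  refine ⟨(P.lift a ⟨by rwa [coe_aeval_eq_eval], ?_⟩).comp j⟩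
  have h := hx.2
  rw [← hax, ← ResidueField.algebraMap_eq, aeval_algebraMap_apply,
    ResidueField.algebraMap_eq] at h
  exact isUnit_of_map_unit _ _ h

attribute [local instance] Algebra.TensorProduct.rightAlgebra in
/-- Points of étale algebras over a finite free algebra lift from the special fibre. -/
lemma nonempty_algHom_of_finite_free {R D E : Type w} [CommRing R] [HenselianLocalRing R]
    [CommRing D] [Algebra R D] [Module.Finite R D] [Module.Free R D] [CommRing E] [Algebra D E]
    [Algebra.Etale D E] (ψ : E →ₐ[D] ResidueField R ⊗[R] D) : Nonempty (E →ₐ[D] D) := by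
  let e := Module.Free.chooseBasis R D
  obtain ⟨B, _, _, hB, h⟩ := exists_etale_weilRestriction (E := E) e
  obtain ⟨φ⟩ := (h (ResidueField R) (ResidueField R ⊗[R] D)
    (Algebra.TensorProduct.basis (ResidueField R) e)
    fun i ↦ Algebra.TensorProduct.basis_apply _ _).mpr ⟨ψ⟩
  exact (h R D e fun _ ↦ rfl).mp (nonempty_algHom_of_henselianLocalRing φ)

lemma exists_finite_free_algHom {R : Type w} {S : Type*} [CommRing R] [CommRing S] [Algebra R S]
    [Algebra.IsIntegral R S] (s : Finset S) :
    ∃ (D : Type w) (_ : CommRing D) (_ : Algebra R D), Module.Finite R D ∧ Module.Free R D ∧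
      ∃ g : D →ₐ[R] S, ∀ x ∈ s, ∃ d, g d = x := by
  classical
  induction s using Finset.induction_on with
  | empty => exact ⟨R, _, _, inferInstance, inferInstance, Algebra.ofId R S, by simp⟩
  | insert x s _ ih =>
    obtain ⟨D, _, _, _, _, g, hg⟩ := ih
    obtain ⟨f, hf, hfx⟩ := Algebra.IsIntegral.isIntegral (R := R) x
    have := hf.finite_adjoinRoot
    have := hf.free_adjoinRoot
    let g' : AdjoinRoot f →ₐ[R] S := AdjoinRoot.liftAlgHom f (Algebra.ofId R S) x hfx
    refine ⟨D ⊗[R] AdjoinRoot f, inferInstance, inferInstance, inferInstance, inferInstance,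
      Algebra.TensorProduct.lift g g' fun _ _ ↦ .all _ _, fun y hy ↦ ?_⟩
    obtain rfl | hy := Finset.mem_insert.mp hy
    · exact ⟨1 ⊗ₜ AdjoinRoot.root f, by
        rw [Algebra.TensorProduct.lift_tmul, map_one, one_mul]
        exact AdjoinRoot.liftAlgHom_root ..⟩
    · obtain ⟨d, rfl⟩ := hg y hy
      exact ⟨d ⊗ₜ 1, by simp⟩

variable {R : Type w} [CommRing R] [HenselianLocalRing R] {S : Type*} [CommRing S] [Algebra R S]
  [Algebra.IsIntegral R S]

attribute [local instance] Algebra.TensorProduct.rightAlgebra in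
lemma exists_isUnit_root_of_monic {a : R} (ha : a ∈ maximalIdeal R) (n : ℕ) {l : S[X]}
    (hl : l.natDegree ≤ n) :
    ∃ t : S, IsUnit t ∧ t ^ (n + 1) + t ^ n + algebraMap R S a * l.eval t = 0 := by
  obtain ⟨D, _, _, _, _, g, hg⟩ := exists_finite_free_algHom (R := R) l.coeffs
  obtain ⟨l', hl'l, hl'd⟩ : ∃ l' : D[X], l'.map g.toRingHom = l ∧ l'.degree = l.degree := by
    refine exists_degree_eq_of_mem_lifts ((lifts_iff_coeffs_subset_range _).mpr fun x hx ↦ ?_)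
    exact hg x hx
  set q : D[X] := X ^ n * (X + 1) + C (algebraMap R D a) * l' with hq
  have hqm : q.Monic := by
    have h1 : q = X ^ (n + 1) + (X ^ n + C (algebraMap R D a) * l') := by rw [hq]; ring
    rw [h1]
    refine monic_X_pow_add (lt_of_le_of_lt (degree_add_le _ _) (max_lt ?_ ?_))
    · exact (degree_X_pow_le n).trans_lt (by exact_mod_cast Nat.lt_succ_self n)
    · refine lt_of_le_of_lt (degree_mul_le _ _) ?_
      rw [hl'd]
      refine (add_le_add degree_C_le le_rfl).trans_lt ?_
      rw [zero_add]
      exact (degree_le_of_natDegree_le hl).trans_lt (by exact_mod_cast Nat.lt_succ_self n)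
  let P : StandardEtalePair D := ⟨q, hqm, X * derivative q, X, 0, 1, by ring⟩
  have ha0 : algebraMap D (ResidueField R ⊗[R] D) (algebraMap R D a) = 0 := by
    change (1 : ResidueField R) ⊗ₜ[R] algebraMap R D a = 0
    rw [Algebra.algebraMap_eq_smul_one, ← TensorProduct.smul_tmul, Algebra.smul_def, mul_one,
      ResidueField.algebraMap_eq, (residue_eq_zero_iff a).mpr ha, TensorProduct.zero_tmul]
  have hP : P.HasMap (-1 : ResidueField R ⊗[R] D) := by
    constructor
    · simp [P, hq, ha0]
    · have : aeval (-1 : ResidueField R ⊗[R] D) (derivative q) = (-1) ^ n := by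
        simp [hq, ha0]
      simp only [P, map_mul, this, aeval_X]
      exact (isUnit_one.neg).mul (isUnit_one.neg.pow n)
  obtain ⟨ψ⟩ := nonempty_algHom_of_finite_free (P.lift _ hP)
  have h := P.hasMap_X.map ψ
  set t := ψ P.X
  have h1 : q.eval t = 0 := h.1
  have h2 : IsUnit ((X * derivative q).eval t) := h.2
  rw [eval_mul, eval_X] at h2
  refine ⟨g t, (isUnit_of_mul_isUnit_left h2).map g, ?_⟩
  have h3 := congr(g $h1)
  rw [hq] at h3
  simp only [eval_add, eval_mul, eval_pow, eval_X, eval_one, eval_C, map_add, map_mul, map_pow,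
    map_one, map_zero, AlgHom.commutes] at h3
  have h4 : g (l'.eval t) = l.eval (g t) := by
    rw [← hl'l, eval_map]
    exact hom_eval₂ l' (RingHom.id D) g.toRingHom t
  rw [← h4]
  linear_combination h3

/-- Hensel's lemma for perturbations of the identity over integral extensions of a henselian
local ring. -/
theorem exists_add_mul_eval_eq_zero {a : R} (ha : a ∈ maximalIdeal R) (h : S[X]) :
    ∃ y : S, y + algebraMap R S a * h.eval y = 0 := by
  set n := h.natDegree
  set c := algebraMap R S a * h.coeff 0 with hc
  let l : S[X] := ∑ i ∈ Finset.range (n + 1), C (c ^ i * h.coeff (i + 1)) * X ^ (n - i)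
  have hl : l.natDegree ≤ n := natDegree_sum_le_of_forall_le _ _ fun i _ ↦
    (natDegree_C_mul_X_pow_le _ _).trans (Nat.sub_le _ _)
  obtain ⟨t, ⟨t, rfl⟩, h1⟩ := exists_isUnit_root_of_monic ha n hl
  refine ⟨c * ↑t⁻¹, ?_⟩
  have ht : (t : S) * ↑t⁻¹ = 1 := t.mul_inv
  have h2 : l.eval ↑t * c = ↑t ^ (n + 1) * (h.eval (c * ↑t⁻¹) - h.coeff 0) := by
    have h3 : h.eval (c * ↑t⁻¹) - h.coeff 0 =
        ∑ i ∈ Finset.range (n + 1), h.coeff (i + 1) * (c * ↑t⁻¹) ^ (i + 1) := by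
      rw [eval_eq_sum_range' (n := n + 2) (by lia), Finset.sum_range_succ']
      simp
    rw [h3, Finset.mul_sum, eval_finsetSum, Finset.sum_mul]
    refine Finset.sum_congr rfl fun i hi ↦ ?_
    have h4 : (t : S) ^ (n + 1) * (↑t⁻¹) ^ (i + 1) = ↑t ^ (n - i) := by
      have : n + 1 = (n - i) + (i + 1) := by
        have := Finset.mem_range.mp hi
        lia
      rw [this, pow_add, mul_assoc, ← mul_pow, ht, one_pow, mul_one]
    rw [eval_mul, eval_C, eval_pow, eval_X, mul_pow]
    linear_combination (-h.coeff (i + 1) * c ^ (i + 1)) * h4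
  have h5 : (t : S) ^ (n + 1) * (c * ↑t⁻¹ + algebraMap R S a * h.eval (c * ↑t⁻¹)) = 0 := by
    linear_combination c * h1 - algebraMap R S a * h2 + c * (t : S) ^ n * ht -
      (t : S) ^ (n + 1) * hc
  exact ((t.isUnit.pow (n + 1)).mul_right_eq_zero).mp h5

section Scaling

variable {R : Type w} [CommRing R] [IsDomain R] {L : Type*} [Field L] [Algebra R L]

/-- Common denominators of a polynomial over the fraction field of an integral closure. -/
lemma exists_smul_mem_lifts (hL : ∀ x : L, ∃ d : R, d ≠ 0 ∧ IsIntegral R (algebraMap R L d * x))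
    (p : L[X]) :
    ∃ d : R, d ≠ 0 ∧ ∃ q : (integralClosure R L)[X],
      q.map (algebraMap _ L) = C (algebraMap R L d) * p := by
  induction p using Polynomial.induction_on' with
  | add p q hp hq =>
    obtain ⟨d, hd, p', hp'⟩ := hp
    obtain ⟨e, he, q', hq'⟩ := hq
    refine ⟨d * e, mul_ne_zero hd he,
      C (algebraMap R _ e) * p' + C (algebraMap R _ d) * q', ?_⟩
    rw [Polynomial.map_add, Polynomial.map_mul, Polynomial.map_mul, hp', hq', map_C, map_C,
      ← IsScalarTower.algebraMap_apply, ← IsScalarTower.algebraMap_apply, map_mul, C_mul]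
    ring
  | monomial n x =>
    obtain ⟨d, hd, hx⟩ := hL x
    exact ⟨d, hd, monomial n ⟨_, hx⟩, by rw [map_monomial, C_mul_monomial]; rfl⟩

/-- Common denominators of a bivariate polynomial over the fraction field of an integral
closure. -/
lemma exists_smul_mem_lifts_bivariate
    (hL : ∀ x : L, ∃ d : R, d ≠ 0 ∧ IsIntegral R (algebraMap R L d * x)) (p : L[X][X]) :
    ∃ d : R, d ≠ 0 ∧ ∃ q : (integralClosure R L)[X][X],
      q.map (mapRingHom (algebraMap _ L)) = C (C (algebraMap R L d)) * p := by
  induction p using Polynomial.induction_on' with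
  | add p q hp hq =>
    obtain ⟨d, hd, p', hp'⟩ := hp
    obtain ⟨e, he, q', hq'⟩ := hq
    refine ⟨d * e, mul_ne_zero hd he,
      C (C (algebraMap R _ e)) * p' + C (C (algebraMap R _ d)) * q', ?_⟩
    rw [Polynomial.map_add, Polynomial.map_mul, Polynomial.map_mul, hp', hq', map_C, map_C,
      coe_mapRingHom, map_C, map_C, ← IsScalarTower.algebraMap_apply,
      ← IsScalarTower.algebraMap_apply, map_mul, C_mul, C_mul]
    ring
  | monomial n x =>
    obtain ⟨d, hd, q, hq⟩ := exists_smul_mem_lifts hL x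
    exact ⟨d, hd, monomial n q, by rw [map_monomial, C_mul_monomial, coe_mapRingHom, hq]⟩

variable [HenselianLocalRing R] [FaithfulSMul R L]

/-- A simple zero of a bivariate polynomial extends to a zero over a neighbourhood of the origin
of the form `a S`, where `S` is the integral closure of a henselian local domain. -/
theorem exists_evalEval_eq_zero (hR : ¬ IsField R)
    (hL : ∀ x : L, ∃ d : R, d ≠ 0 ∧ IsIntegral R (algebraMap R L d * x)) {f g : L[X][X]} {x : L}
    (hf : f.evalEval 0 x = 0) (hf' : (derivative f).evalEval 0 x ≠ 0) (hg : g.evalEval 0 x ≠ 0) :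
    ∃ a : R, a ≠ 0 ∧ ∀ s : integralClosure R L, ∃ y : L,
      f.evalEval (algebraMap R L a * s) y = 0 ∧ g.evalEval (algebraMap R L a * s) y ≠ 0 := by
  let S := integralClosure R L
  obtain ⟨μ, hμ, hμ0⟩ : ∃ μ ∈ maximalIdeal R, μ ≠ 0 := by
    by_contra! h
    exact hR (IsLocalRing.isField_iff_maximalIdeal_eq.mpr ((Submodule.eq_bot_iff _).mpr h))
  set F := taylor (C x) f with hF
  set G := taylor (C x) g with hG
  have hFe : ∀ t y, f.evalEval t (y + x) = F.evalEval t y := fun t y ↦ by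
    rw [hF, evalEval, evalEval, taylor_eval, C_add]
  have hGe : ∀ t y, g.evalEval t (y + x) = G.evalEval t y := fun t y ↦ by
    rw [hG, evalEval, evalEval, taylor_eval, C_add]
  set α := (derivative f).evalEval 0 x with hα
  set β := g.evalEval 0 x with hβ
  have hF₀ : (F.coeff 0).coeff 0 = 0 := by
    rw [hF, taylor_coeff_zero, coeff_zero_eq_eval_zero]
    exact hf
  have hF₁ : (F.coeff 1).coeff 0 = α := by
    rw [hF, taylor_coeff_one, coeff_zero_eq_eval_zero, hα, evalEval]
  have hG₀ : (G.coeff 0).coeff 0 = β := by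
    rw [hG, taylor_coeff_zero, coeff_zero_eq_eval_zero, hβ, evalEval]
  have hFe' : ∀ t y, F.evalEval t y = F.divX.divX.evalEval t y * y ^ 2 +
      (t * (F.coeff 1).divX.eval t + α) * y + t * (F.coeff 0).divX.eval t := by
    intro t y
    have h0 := congr(eval t $((F.coeff 0).divX_mul_X_add))
    have h1 := congr(eval t $((F.coeff 1).divX_mul_X_add))
    have h2 := congr(evalEval t y $(F.divX_mul_X_add))
    have h3 := congr(evalEval t y $(F.divX.divX_mul_X_add))
    rw [hF₀] at h0
    rw [hF₁] at h1
    rw [coeff_divX] at h3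
    simp only [evalEval_add, evalEval_mul, evalEval_X, evalEval_C, eval_add, eval_mul, eval_X,
      eval_C] at h0 h1 h2 h3
    rw [← h2, ← h3, ← h0, ← h1]
    ring
  have hGe' : ∀ t y, G.evalEval t y = G.divX.evalEval t y * y +
      (t * (G.coeff 0).divX.eval t + β) := by
    intro t y
    have h0 := congr(eval t $((G.coeff 0).divX_mul_X_add))
    have h2 := congr(evalEval t y $(G.divX_mul_X_add))
    rw [hG₀] at h0
    simp only [evalEval_add, evalEval_mul, evalEval_X, evalEval_C, eval_add, eval_mul, eval_X,
      eval_C] at h0 h2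
    rw [← h2, ← h0]
    ring
  obtain ⟨d₁, hd₁, q₁, hq₁⟩ := exists_smul_mem_lifts_bivariate hL (C (C α⁻¹) * F.divX.divX)
  obtain ⟨d₂, hd₂, q₂, hq₂⟩ := exists_smul_mem_lifts hL (C α⁻¹ * (F.coeff 1).divX)
  obtain ⟨d₃, hd₃, q₃, hq₃⟩ := exists_smul_mem_lifts hL (C α⁻¹ * (F.coeff 0).divX)
  obtain ⟨d₄, hd₄, q₄, hq₄⟩ := exists_smul_mem_lifts_bivariate hL (C (C β⁻¹) * G.divX)
  obtain ⟨d₅, hd₅, q₅, hq₅⟩ := exists_smul_mem_lifts hL (C β⁻¹ * (G.coeff 0).divX)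
  set d := d₁ * d₂ * d₃ * d₄ * d₅ with hd
  have hd0 : d ≠ 0 := by positivity
  have hinj : Function.Injective (algebraMap S L) := Subtype.val_injective
  have hRL : ∀ r : R, algebraMap R L r = algebraMap S L (algebraMap R S r) := fun r ↦
    IsScalarTower.algebraMap_apply R S L r
  have hv₁ : ∀ t y : S, algebraMap S L (q₁.evalEval t y) = algebraMap R L d₁ *
      (α⁻¹ * F.divX.divX.evalEval (algebraMap S L t) (algebraMap S L y)) := fun t y ↦ by
    rw [← map_mapRingHom_evalEval, hq₁]
    simp only [evalEval_mul, evalEval_C, eval_C]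
  have hv₂ : ∀ t : S, algebraMap S L (q₂.eval t) = algebraMap R L d₂ *
      (α⁻¹ * (F.coeff 1).divX.eval (algebraMap S L t)) := fun t ↦ by
    rw [← eval₂_at_apply, ← eval_map, hq₂]
    simp only [eval_mul, eval_C]
  have hv₃ : ∀ t : S, algebraMap S L (q₃.eval t) = algebraMap R L d₃ *
      (α⁻¹ * (F.coeff 0).divX.eval (algebraMap S L t)) := fun t ↦ by
    rw [← eval₂_at_apply, ← eval_map, hq₃]
    simp only [eval_mul, eval_C]
  have hv₄ : ∀ t y : S, algebraMap S L (q₄.evalEval t y) = algebraMap R L d₄ *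
      (β⁻¹ * G.divX.evalEval (algebraMap S L t) (algebraMap S L y)) := fun t y ↦ by
    rw [← map_mapRingHom_evalEval, hq₄]
    simp only [evalEval_mul, evalEval_C, eval_C]
  have hv₅ : ∀ t : S, algebraMap S L (q₅.eval t) = algebraMap R L d₅ *
      (β⁻¹ * (G.coeff 0).divX.eval (algebraMap S L t)) := fun t ↦ by
    rw [← eval₂_at_apply, ← eval_map, hq₅]
    simp only [eval_mul, eval_C]
  refine ⟨d ^ 2 * μ ^ 2, by positivity, fun s ↦ ?_⟩
  set r := algebraMap R S with hr
  set t : S := r (d ^ 2 * μ ^ 2) * s with ht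
  have htL : algebraMap R L (d ^ 2 * μ ^ 2) * s = algebraMap S L t := by
    rw [hRL, ht, map_mul]
    rfl
  let H : S[X] := C (s * r (d₁ * d₂ * d₄ * d₅) * q₃.eval t) +
    C (s * r (d * μ) * r (d₁ * d₃ * d₄ * d₅) * q₂.eval t) * X +
    C (r (d₂ * d₃ * d₄ * d₅)) * X ^ 2 * (q₁.map (evalRingHom t)).comp (C (r (d * μ)) * X)
  obtain ⟨y, hy⟩ := exists_add_mul_eval_eq_zero hμ H
  set v : S := r (d * μ) * y with hv
  have hHy : H.eval y = s * r (d₁ * d₂ * d₄ * d₅) * q₃.eval t +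
      s * r (d * μ) * r (d₁ * d₃ * d₄ * d₅) * q₂.eval t * y +
      r (d₂ * d₃ * d₄ * d₅) * y ^ 2 * q₁.evalEval t v := by
    simp only [H, eval_add, eval_mul, eval_C, eval_X, eval_pow, eval_comp, map_evalRingHom_eval, hv]
  have hyL := congr(algebraMap S L $hy)
  rw [hHy] at hyL
  have hμL : algebraMap S L (algebraMap R S μ) = algebraMap R L μ := (hRL μ).symm
  simp only [map_add, map_mul, map_pow, map_zero, hv₁, hv₂, hv₃, ← hRL, hμL] at hyL
  have hvL : algebraMap S L v = algebraMap R L d * algebraMap R L μ * algebraMap S L y := by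
    rw [hv, map_mul, ← hRL, map_mul]
  have htL' : algebraMap S L t =
      algebraMap R L d ^ 2 * algebraMap R L μ ^ 2 * algebraMap S L s := by
    rw [ht, map_mul, ← hRL, map_mul, map_pow, map_pow]
  have hdL : algebraMap R L d = algebraMap R L d₁ * algebraMap R L d₂ * algebraMap R L d₃ *
      algebraMap R L d₄ * algebraMap R L d₅ := by simp only [hd, map_mul]
  have hdL0 : algebraMap R L d ≠ 0 := by
    rwa [Ne, FaithfulSMul.algebraMap_eq_zero_iff]
  refine ⟨algebraMap S L v + x, ?_, ?_⟩
  · rw [htL, hFe, hFe']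
    have h1 : algebraMap R L d * α⁻¹ * (F.divX.divX.evalEval (algebraMap S L t) (algebraMap S L v) *
        algebraMap S L v ^ 2 + (algebraMap S L t * (F.coeff 1).divX.eval (algebraMap S L t) + α) *
        algebraMap S L v + algebraMap S L t * (F.coeff 0).divX.eval (algebraMap S L t)) = 0 := by
      have hαα : α * α⁻¹ = 1 := mul_inv_cancel₀ hf'
      generalize F.divX.divX.evalEval (algebraMap S L t) (algebraMap S L v) = A at hyL ⊢
      generalize (F.coeff 1).divX.eval (algebraMap S L t) = B at hyL ⊢
      generalize (F.coeff 0).divX.eval (algebraMap S L t) = B' at hyL ⊢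
      rw [hvL, htL']
      linear_combination (algebraMap R L d ^ 2 * algebraMap R L μ) * hyL +
        algebraMap R L d ^ 2 * algebraMap R L μ * algebraMap S L y * hαα +
        algebraMap R L d ^ 2 * algebraMap R L μ ^ 2 * α⁻¹ * (A * algebraMap S L y ^ 2 +
          algebraMap S L s * algebraMap R L d * algebraMap R L μ * B * algebraMap S L y +
          algebraMap S L s * B') * hdL
    exact (mul_eq_zero.mp h1).resolve_left (mul_ne_zero hdL0 (inv_ne_zero hf'))
  · rw [htL, hGe, hGe']
    intro h0
    set σ : S := r (d₁ * d₂ * d₃ * d₅) * y * q₄.evalEval t v +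
      r (d * μ) * s * r (d₁ * d₂ * d₃ * d₄) * q₅.eval t with hσ
    have h1 : 1 + r μ * σ = 0 := by
      apply hinj
      have hββ : β * β⁻¹ = 1 := mul_inv_cancel₀ hg
      refine mul_left_cancel₀ hdL0 ?_
      rw [hσ]
      simp only [map_add, map_mul, map_zero, map_one, hv₄, hv₅, ← hRL]
      generalize G.divX.evalEval (algebraMap S L t) (algebraMap S L v) = A at h0 ⊢
      generalize (G.coeff 0).divX.eval (algebraMap S L t) = B at h0 ⊢
      rw [hvL, htL'] at h0
      linear_combination algebraMap R L d * β⁻¹ * h0 - algebraMap R L d * hββ -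
        algebraMap R L d * algebraMap R L μ * β⁻¹ * (algebraMap S L y * A +
          algebraMap S L s * algebraMap R L d * algebraMap R L μ * B) * hdL
    have h2 : IsUnit (r μ) := by
      refine IsUnit.of_mul_eq_one (-σ) ?_
      linear_combination -h1
    exact hμ (isUnit_of_map_unit r μ h2)

end Scaling

end Hensel

end EtaleOpen

namespace EtaleOpen

open CategoryTheory CategoryTheory.Limits AlgebraicGeometry
open scoped Topology TensorProduct

section Charts

/-- A field-valued point of a scheme factors through an affine open subscheme. -/
lemma exists_affine_chart (X : Scheme.{w}) {k : Type w} [Field k]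
    (p : Spec (CommRingCat.of k) ⟶ X) :
    ∃ (A : Type w) (_ : CommRing A) (j : Spec (CommRingCat.of A) ⟶ X) (φ : A →+* k),
      IsOpenImmersion j ∧ p = Spec.map (CommRingCat.ofHom φ) ≫ j := by
  obtain ⟨U, hU, hpU, -⟩ := exists_isAffineOpen_mem_and_subset
    (x := p (IsLocalRing.closedPoint k)) (U := ⊤) trivial
  have hp : Set.range p ⊆ Set.range hU.fromSpec := by
    rw [hU.range_fromSpec]
    rintro _ ⟨x, rfl⟩
    have : x = IsLocalRing.closedPoint k :=
      Subsingleton.elim (α := PrimeSpectrum k) _ _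
    rwa [this]
  refine ⟨Γ(X, U), inferInstance, hU.fromSpec,
    (Spec.preimage (IsOpenImmersion.lift hU.fromSpec p hp)).hom, inferInstance, ?_⟩
  exact ((congr($(Spec.map_preimage (IsOpenImmersion.lift hU.fromSpec p hp)) ≫ _)).trans
    (IsOpenImmersion.lift_fac hU.fromSpec p hp)).symm

variable {k : Type w} [Field k]

/-- The rational point of a variety given by a chart and a rational point of the chart. -/
noncomputable def chartPoint {W : Variety k} {A : Type w} [CommRing A] [Algebra k A]
    (j : Spec (CommRingCat.of A) ⟶ W.toOver.left)
    (hj : j ≫ W.toOver.hom = Spec.map (CommRingCat.ofHom (algebraMap k A))) (φ : A →ₐ[k] k) :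
    W.Points :=
  Over.homMk (Spec.map (CommRingCat.ofHom φ.toRingHom) ≫ j) (by
    rw [Category.assoc, hj, ← Spec.map_comp, ← CommRingCat.ofHom_comp]
    have : φ.toRingHom.comp (algebraMap k A) = RingHom.id k := φ.comp_algebraMap
    rw [this]
    exact Spec.map_id _)

lemma isOpen_etaleOpen_of_forall {W : Variety k} {T : Set W.Points}
    (h : ∀ w ∈ T, ∃ (X : Variety k) (f : X.toOver ⟶ W.toOver), Etale f.left ∧
      (∃ x : X.Points, x ≫ f = w) ∧ ∀ x : X.Points, x ≫ f ∈ T) :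
    IsOpen[etaleOpen k W] T := by
  let := etaleOpen k W
  refine isOpen_iff_forall_mem_open.mpr fun w hw ↦ ?_
  obtain ⟨X, f, hf, hx, hT⟩ := h w hw
  refine ⟨Set.range fun x : X.Points ↦ x ≫ f, ?_, ?_, hx⟩
  · rintro _ ⟨x, rfl⟩
    exact hT x
  · exact TopologicalSpace.isOpen_generateFrom_of_mem ⟨X, f, hf, rfl⟩

/-- A criterion for étale openness in terms of étale algebras over affine charts. -/
lemma isOpen_etaleOpen_of_chart {W : Variety k} {T : Set W.Points}
    (h : ∀ (A : Type w) [CommRing A] [Algebra k A] (j : Spec (CommRingCat.of A) ⟶ W.toOver.left)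
      [IsOpenImmersion j]
      (hj : j ≫ W.toOver.hom = Spec.map (CommRingCat.ofHom (algebraMap k A))) (φ : A →ₐ[k] k),
      chartPoint j hj φ ∈ T → ∃ (B : Type w) (_ : CommRing B) (_ : Algebra A B),
        Algebra.Etale A B ∧ (∃ ψ : B →+* k, ψ.comp (algebraMap A B) = φ) ∧
        ∀ φ' : A →ₐ[k] k, (∃ ψ : B →+* k, ψ.comp (algebraMap A B) = φ') →
          chartPoint j hj φ' ∈ T) :
    IsOpen[etaleOpen k W] T := by
  refine isOpen_etaleOpen_of_forall fun w hw ↦ ?_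
  obtain ⟨A, _, j, φ, hj, hw'⟩ := exists_affine_chart W.toOver.left w.left
  let : Algebra k A := (Spec.preimage (j ≫ W.toOver.hom)).hom.toAlgebra
  have hjA : j ≫ W.toOver.hom = Spec.map (CommRingCat.ofHom (algebraMap k A)) :=
    (Spec.map_preimage _).symm
  have hφ : φ.comp (algebraMap k A) = RingHom.id k := by
    have h1 := Over.w w
    rw [hw', Category.assoc, hjA, ← Spec.map_comp, ← CommRingCat.ofHom_comp] at h1
    have h2 : Spec.map (CommRingCat.ofHom (φ.comp (algebraMap k A))) =
        Spec.map (CommRingCat.ofHom (RingHom.id k)) := h1.trans (Spec.map_id _).symm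
    exact congr($(Spec.map_injective h2).hom)
  let φ₀ : A →ₐ[k] k := { φ with commutes' := fun a ↦ congr($hφ a) }
  have hwφ : chartPoint j hjA φ₀ = w := by
    ext1
    exact hw'.symm
  obtain ⟨B, _, _, hB, ⟨ψ, hψ⟩, hT⟩ := h A j hjA φ₀ (hwφ ▸ hw)
  have : LocallyOfFiniteType (Spec.map (CommRingCat.ofHom (algebraMap k A))) := by
    rw [← hjA]
    have := W.locallyOfFiniteType
    infer_instance
  have hBe : Etale (Spec.map (CommRingCat.ofHom (algebraMap A B))) := by
    rw [HasRingHomProperty.Spec_iff (P := @Etale)]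
    exact RingHom.etale_algebraMap.mpr hB
  let X : Variety k :=
    { toOver := Over.mk (Spec.map (CommRingCat.ofHom (algebraMap A B)) ≫
        Spec.map (CommRingCat.ofHom (algebraMap k A)))
      isSeparated := by dsimp; infer_instance
      locallyOfFiniteType := by dsimp; infer_instance
      quasiCompact := by dsimp; infer_instance }
  let f : X.toOver ⟶ W.toOver :=
    Over.homMk (Spec.map (CommRingCat.ofHom (algebraMap A B)) ≫ j) (by
      rw [Category.assoc, hjA]; rfl)
  have hmap : ∀ ψ : B →+* k, Spec.map (CommRingCat.ofHom ψ) ≫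
      Spec.map (CommRingCat.ofHom (algebraMap A B)) =
      Spec.map (CommRingCat.ofHom (ψ.comp (algebraMap A B))) := fun ψ ↦ by
    rw [← Spec.map_comp, ← CommRingCat.ofHom_comp]
  refine ⟨X, f, ?_, ⟨Over.homMk (Spec.map (CommRingCat.ofHom ψ)) ?_, ?_⟩, fun x ↦ ?_⟩
  · change Etale (Spec.map (CommRingCat.ofHom (algebraMap A B)) ≫ j)
    infer_instance
  · change Spec.map (CommRingCat.ofHom ψ) ≫ Spec.map (CommRingCat.ofHom (algebraMap A B)) ≫
      Spec.map (CommRingCat.ofHom (algebraMap k A)) = 𝟙 _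
    rw [← Category.assoc, hmap, hψ, ← Spec.map_comp, ← CommRingCat.ofHom_comp]
    exact (congr(Spec.map (CommRingCat.ofHom $hφ))).trans (Spec.map_id _)
  · rw [← hwφ]
    ext1
    change Spec.map (CommRingCat.ofHom ψ) ≫ Spec.map (CommRingCat.ofHom (algebraMap A B)) ≫ j = _
    rw [← Category.assoc, hmap, hψ]
    rfl
  · let ψ' : B →+* k := (Spec.preimage x.left).hom
    have hx : x.left = Spec.map (CommRingCat.ofHom ψ') := (Spec.map_preimage _).symm
    have h1 : x.left ≫ Spec.map (CommRingCat.ofHom (algebraMap A B)) ≫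
      Spec.map (CommRingCat.ofHom (algebraMap k A)) = 𝟙 _ := Over.w x
    rw [hx, ← Category.assoc, hmap, ← Spec.map_comp, ← CommRingCat.ofHom_comp] at h1
    have h2 : Spec.map (CommRingCat.ofHom ((ψ'.comp (algebraMap A B)).comp (algebraMap k A))) =
        Spec.map (CommRingCat.ofHom (RingHom.id k)) := h1.trans (Spec.map_id _).symm
    have h3 := congr($(Spec.map_injective h2).hom)
    let φ' : A →ₐ[k] k :=
      { ψ'.comp (algebraMap A B) with commutes' := fun a ↦ congr($h3 a) }
    have h4 : x ≫ f = chartPoint j hjA φ' := by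
      ext1
      change x.left ≫ Spec.map (CommRingCat.ofHom (algebraMap A B)) ≫ j = _
      rw [hx, ← Category.assoc, hmap]
      rfl
    rw [h4]
    exact hT φ' ⟨ψ', rfl⟩

end Charts

section BaseChange

variable {K L : Type w} [Field K] [Field L] [Algebra K L]

/-- The `L`-point of `A ⊗ L` given by a `K`-point of `A`. -/
noncomputable def tensorPoint {A : Type w} [CommRing A] [Algebra K A] (φ : A →ₐ[K] K) :
    A ⊗[K] L →+* L :=
  (Algebra.TensorProduct.lift ((Algebra.ofId K L).comp φ) (AlgHom.id K L)
    fun _ _ ↦ .all _ _).toRingHom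

@[simp]
lemma tensorPoint_tmul {A : Type w} [CommRing A] [Algebra K A] (φ : A →ₐ[K] K) (a : A) (l : L) :
    tensorPoint φ (a ⊗ₜ l) = algebraMap K L (φ a) * l := by
  simp [tensorPoint, Algebra.ofId_apply]

/-- The point of `W_L` induced by a rational point of `W`. -/
noncomputable def baseChangePoint {W : Variety K} (w : W.Points) :
    point L ⟶ (baseChange K L).obj W.toOver :=
  pointToBaseChange K L ≫ (baseChange K L).map w

variable {W : Variety K} {A : Type w} [CommRing A] [Algebra K A]

lemma baseChangePoint_left_fst (w : W.Points) :
    (baseChangePoint (L := L) w).left ≫ pullback.fst W.toOver.hom (specMap K L) =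
      specMap K L ≫ w.left := by
  have h1 : ((baseChange K L).map w).left ≫ pullback.fst W.toOver.hom (specMap K L) =
      pullback.fst (point K).hom (specMap K L) ≫ w.left := pullback.lift_fst _ _ _
  have h2 : (pointToBaseChange K L).left ≫ pullback.fst (point K).hom (specMap K L) =
      specMap K L := pullback.lift_fst _ _ _
  rw [baseChangePoint, Over.comp_left, Category.assoc, h1, ← Category.assoc, h2]

lemma baseChangePoint_left_snd (w : W.Points) :
    (baseChangePoint (L := L) w).left ≫ pullback.snd W.toOver.hom (specMap K L) = 𝟙 _ :=
  Over.w (baseChangePoint (L := L) w)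

variable (L) in
/-- The base change of a chart. -/
noncomputable def baseChangeChart (j : Spec (CommRingCat.of A) ⟶ W.toOver.left)
    (hj : j ≫ W.toOver.hom = Spec.map (CommRingCat.ofHom (algebraMap K A))) :
    Spec (CommRingCat.of (A ⊗[K] L)) ⟶ ((baseChange K L).obj W.toOver).left :=
  pullback.lift
    (Spec.map (CommRingCat.ofHom (Algebra.TensorProduct.includeLeftRingHom : A →+* A ⊗[K] L)) ≫ j)
    (Spec.map (CommRingCat.ofHom
      (Algebra.TensorProduct.includeRight : L →ₐ[K] A ⊗[K] L).toRingHom)) (by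
    rw [Category.assoc, hj, specMap, ← Spec.map_comp, ← Spec.map_comp, ← CommRingCat.ofHom_comp,
      ← CommRingCat.ofHom_comp]
    congr 2
    ext x
    exact ((Algebra.TensorProduct.includeLeft : A →ₐ[K] A ⊗[K] L).commutes x).trans
      ((Algebra.TensorProduct.includeRight : L →ₐ[K] A ⊗[K] L).commutes x).symm)

lemma baseChangePoint_chartPoint_left (j : Spec (CommRingCat.of A) ⟶ W.toOver.left)
    (hj : j ≫ W.toOver.hom = Spec.map (CommRingCat.ofHom (algebraMap K A))) (φ : A →ₐ[K] K) :
    (baseChangePoint (L := L) (chartPoint j hj φ)).left =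
      Spec.map (CommRingCat.ofHom (tensorPoint φ)) ≫ baseChangeChart L j hj := by
  refine pullback.hom_ext ?_ ?_
  · rw [Category.assoc, baseChangeChart, pullback.lift_fst, ← Category.assoc, ← Spec.map_comp,
      ← CommRingCat.ofHom_comp]
    have h1 : (tensorPoint (L := L) φ).comp Algebra.TensorProduct.includeLeftRingHom =
        (algebraMap K L).comp φ.toRingHom := by
      ext a
      exact (tensorPoint_tmul φ a 1).trans (mul_one _)
    rw [h1, CommRingCat.ofHom_comp, Spec.map_comp, Category.assoc]
    exact baseChangePoint_left_fst _
  · rw [Category.assoc, baseChangeChart, pullback.lift_snd, ← Spec.map_comp,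
      ← CommRingCat.ofHom_comp]
    have h1 : (tensorPoint (L := L) φ).comp
        (Algebra.TensorProduct.includeRight : L →ₐ[K] A ⊗[K] L).toRingHom = RingHom.id L := by
      ext l
      exact (tensorPoint_tmul φ 1 l).trans (by simp)
    rw [h1]
    exact (baseChangePoint_left_snd _).trans (Spec.map_id _).symm

/-- The Weil restriction of an étale algebra over `A ⊗ L`, on rational points. -/
lemma exists_etale_forall_tensorPoint [FiniteDimensional K L] (E : Type w) [CommRing E]
    [Algebra (A ⊗[K] L) E] [Algebra.Etale (A ⊗[K] L) E] :
    ∃ (B : Type w) (_ : CommRing B) (_ : Algebra A B), Algebra.Etale A B ∧ ∀ φ : A →ₐ[K] K,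
      (∃ ψ : B →+* K, ψ.comp (algebraMap A B) = φ) ↔
        ∃ θ : E →+* L, θ.comp (algebraMap (A ⊗[K] L) E) = tensorPoint φ := by
  let b := Module.Free.chooseBasis K L
  obtain ⟨B, _, _, hB, h⟩ := exists_etale_weilRestriction (E := E)
    (Algebra.TensorProduct.basis A b)
  refine ⟨B, inferInstance, inferInstance, hB, fun φ ↦ ?_⟩
  let := φ.toRingHom.toAlgebra
  let := (tensorPoint (L := L) φ).toAlgebra
  let : Algebra A L := ((algebraMap K L).comp φ.toRingHom).toAlgebra
  have : IsScalarTower A K L := .of_algebraMap_eq fun _ ↦ rfl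
  have : IsScalarTower A (A ⊗[K] L) L := .of_algebraMap_eq fun a ↦
    ((tensorPoint_tmul φ a 1).trans (mul_one _)).symm
  have hiff := h K L b fun i ↦ by
    rw [Algebra.TensorProduct.basis_apply]
    exact ((tensorPoint_tmul φ 1 (b i)).trans (by simp)).symm
  constructor
  · rintro ⟨ψ, hψ⟩
    obtain ⟨θ⟩ := hiff.mp ⟨{ ψ with commutes' := fun a ↦ congr($hψ a) }⟩
    exact ⟨θ.toRingHom, θ.comp_algebraMap⟩
  · rintro ⟨θ, hθ⟩
    obtain ⟨ψ⟩ := hiff.mpr ⟨{ θ with commutes' := fun a ↦ congr($hθ a) }⟩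
    exact ⟨ψ.toRingHom, ψ.comp_algebraMap⟩

/-- A morphism `W_L → V` induces a continuous map `W(K) → V(L)`. -/
theorem continuous_baseChangePoint_comp [FiniteDimensional K L] {V : Variety L}
    (g : (baseChange K L).obj W.toOver ⟶ V.toOver) :
    Continuous[etaleOpen K W, etaleOpen L V] fun w : W.Points ↦ baseChangePoint w ≫ g := by
  let := etaleOpen K W
  refine continuous_generateFrom_iff.mpr ?_
  rintro _ ⟨X, f, hf, rfl⟩
  refine isOpen_etaleOpen_of_chart fun A _ _ j _ hj φ ↦ ?_
  rintro ⟨x₀, hx₀⟩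
  let r : Spec (CommRingCat.of (A ⊗[K] L)) ⟶ V.toOver.left := baseChangeChart L j hj ≫ g.left
  have hr : ∀ φ : A →ₐ[K] K, (baseChangePoint (chartPoint j hj φ) ≫ g).left =
      Spec.map (CommRingCat.ofHom (tensorPoint φ)) ≫ r := fun φ ↦ by
    rw [Over.comp_left, baseChangePoint_chartPoint_left, Category.assoc]
  let P := pullback f.left r
  have hx₀' : x₀.left ≫ f.left = Spec.map (CommRingCat.ofHom (tensorPoint φ)) ≫ r := by
    rw [← hr]
    exact congr(($hx₀).left)
  obtain ⟨E, _, i, e, hi, he⟩ := exists_affine_chart P (pullback.lift x₀.left _ hx₀')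
  let : Algebra (A ⊗[K] L) E := (Spec.preimage (i ≫ pullback.snd f.left r)).hom.toAlgebra
  have hE : Spec.map (CommRingCat.ofHom (algebraMap (A ⊗[K] L) E)) = i ≫ pullback.snd f.left r :=
    Spec.map_preimage _
  have : Algebra.Etale (A ⊗[K] L) E := by
    rw [← RingHom.etale_algebraMap]
    refine (HasRingHomProperty.Spec_iff (P := @Etale)
      (φ := CommRingCat.ofHom (algebraMap (A ⊗[K] L) E))).mp ?_
    rw [hE]
    infer_instance
  obtain ⟨B, _, _, hB, h⟩ := exists_etale_forall_tensorPoint (K := K) (L := L) (A := A) E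
  refine ⟨B, inferInstance, inferInstance, hB, (h φ).mpr ⟨e, ?_⟩, fun φ' hφ' ↦ ?_⟩
  · have h1 := congr($he ≫ pullback.snd f.left r)
    rw [pullback.lift_snd, Category.assoc, ← hE, ← Spec.map_comp, ← CommRingCat.ofHom_comp] at h1
    exact congr($(Spec.map_injective h1).hom).symm
  · obtain ⟨θ, hθ⟩ := (h φ').mp hφ'
    have h1 : (Spec.map (CommRingCat.ofHom θ) ≫ i ≫ pullback.fst f.left r) ≫ f.left =
        (baseChangePoint (chartPoint j hj φ') ≫ g).left := by
      rw [hr, Category.assoc, Category.assoc, pullback.condition, ← Category.assoc i, ← hE,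
        ← Category.assoc, ← Spec.map_comp, ← CommRingCat.ofHom_comp, hθ]
    refine ⟨Over.homMk (Spec.map (CommRingCat.ofHom θ) ≫ i ≫ pullback.fst f.left r) ?_, ?_⟩
    · rw [← Over.w f, ← Category.assoc, h1]
      exact Over.w _
    · ext1
      exact h1

end BaseChange

end EtaleOpen

namespace EtaleOpen

open CategoryTheory CategoryTheory.Limits AlgebraicGeometry
open scoped Topology TensorProduct

section BoundedSet

open Polynomial

/-- The elements `z` for which `y ^ n = 1 + z ^ n` and `y ^ 2 + y = p * z ^ 2` have simple
solutions. -/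
def boundedSet {k : Type*} [Field k] (n : ℕ) (p : k) : Set k :=
  {z | (∃ y : k, y ^ n = 1 + z ^ n ∧ n * y ^ (n - 1) ≠ 0) ∧
    ∃ y : k, y ^ 2 + y = p * z ^ 2 ∧ 2 * y + 1 ≠ 0}

lemma zero_mem_boundedSet {k : Type*} [Field k] {n : ℕ} (hn0 : n ≠ 0) (hn : (n : k) ≠ 0) (p : k) :
    0 ∈ boundedSet n p :=
  ⟨⟨1, by simp [hn0], by simpa⟩, ⟨0, by simp, by simp⟩⟩

lemma exists_comp_algebraMap_eq_iff {A k : Type*} [CommRing A] [Field k] (P : StandardEtalePair A)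
    (φ : A →+* k) : (∃ ψ : P.Ring →+* k, ψ.comp (algebraMap A P.Ring) = φ) ↔
      ∃ y, P.f.eval₂ φ y = 0 ∧ P.g.eval₂ φ y ≠ 0 := by
  let := φ.toAlgebra
  constructor
  · rintro ⟨ψ, hψ⟩
    let ψ' : P.Ring →ₐ[A] k := { ψ with commutes' := fun a ↦ congr($hψ a) }
    have h := P.hasMap_X.map ψ'
    exact ⟨ψ' P.X, h.1, h.2.ne_zero⟩
  · rintro ⟨y, h1, h2⟩
    let ψ := P.lift y ⟨h1, isUnit_iff_ne_zero.mpr h2⟩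
    exact ⟨ψ.toRingHom, ψ.comp_algebraMap⟩

/-- Points at which finitely many functions take values in `boundedSet n p` are parametrized by an
étale algebra. -/
lemma exists_etale_forall_mem_boundedSet {k A ι : Type w} [Field k] [CommRing A] [Algebra k A]
    {n : ℕ} (hn : n ≠ 0) (p : k) (s : Finset ι) (a : ι → A) :
    ∃ (B : Type w) (_ : CommRing B) (_ : Algebra A B), Algebra.Etale A B ∧ ∀ φ : A →ₐ[k] k,
      (∃ ψ : B →+* k, ψ.comp (algebraMap A B) = φ) ↔ ∀ i ∈ s, φ (a i) ∈ boundedSet n p := by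
  classical
  induction s using Finset.induction_on with
  | empty =>
    exact ⟨A, inferInstance, inferInstance, inferInstance, fun φ ↦
      ⟨fun _ ↦ by simp, fun _ ↦ ⟨φ, rfl⟩⟩⟩
  | insert i s _ ih =>
    obtain ⟨B, _, _, hB, h⟩ := ih
    let P : StandardEtalePair A :=
      { f := X ^ n - C (1 + a i ^ n)
        monic_f := monic_X_pow_sub_C _ hn
        g := derivative (X ^ n - C (1 + a i ^ n))
        cond := ⟨1, 0, 1, by ring⟩ }
    let Q : StandardEtalePair A :=
      { f := X ^ 2 + (X - C (algebraMap k A p * a i ^ 2))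
        monic_f := monic_X_pow_add ((degree_X_sub_C_le _).trans_lt (by norm_num))
        g := derivative (X ^ 2 + (X - C (algebraMap k A p * a i ^ 2)))
        cond := ⟨1, 0, 1, by ring⟩ }
    have hPQ : Algebra.Etale A (P.Ring ⊗[A] Q.Ring) :=
      have : Algebra.Etale P.Ring (P.Ring ⊗[A] Q.Ring) := inferInstance
      Algebra.Etale.comp A P.Ring _
    have hB' : Algebra.Etale A (B ⊗[A] (P.Ring ⊗[A] Q.Ring)) :=
      have : Algebra.Etale B (B ⊗[A] (P.Ring ⊗[A] Q.Ring)) := inferInstance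
      Algebra.Etale.comp A B _
    refine ⟨B ⊗[A] (P.Ring ⊗[A] Q.Ring), inferInstance, inferInstance, hB', fun φ ↦ ?_⟩
    have hP : (∃ ψ : P.Ring →+* k, ψ.comp (algebraMap A P.Ring) = φ) ↔
        ∃ y : k, y ^ n = 1 + φ (a i) ^ n ∧ n * y ^ (n - 1) ≠ 0 := by
      rw [exists_comp_algebraMap_eq_iff]
      refine exists_congr fun y ↦ ?_
      simp only [P, derivative_sub, derivative_C, derivative_X_pow, eval₂_sub, eval₂_X_pow, eval₂_C,
        sub_zero, eval₂_mul, eval₂_natCast, map_natCast, sub_eq_zero]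
      simp only [RingHom.coe_coe, map_add, map_one, map_pow]
    have hQ : (∃ ψ : Q.Ring →+* k, ψ.comp (algebraMap A Q.Ring) = φ) ↔
        ∃ y : k, y ^ 2 + y = p * φ (a i) ^ 2 ∧ 2 * y + 1 ≠ 0 := by
      rw [exists_comp_algebraMap_eq_iff]
      refine exists_congr fun y ↦ and_congr ?_ ?_
      · simp only [Q, eval₂_add, eval₂_sub, eval₂_X_pow, eval₂_X, eval₂_C, ← add_sub_assoc,
          sub_eq_zero]
        simp
      · simp [Q, eval₂_add, -map_mul, -map_pow, derivative_C]
        rw [one_add_one_eq_two]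
    rw [Finset.forall_mem_insert, ← h φ, boundedSet, Set.mem_ofPred_eq, ← hP, ← hQ]
    let := φ.toRingHom.toAlgebra
    constructor
    · rintro ⟨ψ, hψ⟩
      let ψ' : B ⊗[A] (P.Ring ⊗[A] Q.Ring) →ₐ[A] k := { ψ with commutes' := fun a ↦ congr($hψ a) }
      let l := ψ'.comp (Algebra.TensorProduct.includeLeft : B →ₐ[A] _)
      let r := ψ'.comp (Algebra.TensorProduct.includeRight : (P.Ring ⊗[A] Q.Ring) →ₐ[A] _)
      let u := r.comp (Algebra.TensorProduct.includeLeft : P.Ring →ₐ[A] _)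
      let v := r.comp (Algebra.TensorProduct.includeRight : Q.Ring →ₐ[A] _)
      exact ⟨⟨⟨u, u.comp_algebraMap⟩, ⟨v, v.comp_algebraMap⟩⟩, ⟨l, l.comp_algebraMap⟩⟩
    · rintro ⟨⟨⟨u, hu⟩, ⟨v, hv⟩⟩, ⟨l, hl⟩⟩
      let u' : P.Ring →ₐ[A] k := { u with commutes' := fun a ↦ congr($hu a) }
      let v' : Q.Ring →ₐ[A] k := { v with commutes' := fun a ↦ congr($hv a) }
      let l' : B →ₐ[A] k := { l with commutes' := fun a ↦ congr($hl a) }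
      let m := Algebra.TensorProduct.lift l'
        (Algebra.TensorProduct.lift u' v' fun _ _ ↦ .all _ _) fun _ _ ↦ .all _ _
      exact ⟨m, m.comp_algebraMap⟩

end BoundedSet

section AffineLine

open Polynomial

/-- The coordinate of a rational point of the affine line. -/
noncomputable def lineCoord {k : Type w} [Field k] (p : (affineLine k).Points) : k :=
  (Spec.preimage p.left).hom X

/-- The rational point of the affine line with given coordinate. -/
noncomputable def linePoint {k : Type w} [Field k] (l : k) : (affineLine k).Points :=
  Over.homMk (Spec.map (CommRingCat.ofHom (evalRingHom l))) (by
    change Spec.map _ ≫ Spec.map _ = _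
    rw [← Spec.map_comp, ← CommRingCat.ofHom_comp]
    have : (evalRingHom l).comp (algebraMap k k[X]) = RingHom.id k := by
      ext
      simp
    rw [this]
    exact Spec.map_id _)

lemma lineCoord_eq {k : Type w} [Field k] {p : (affineLine k).Points} {f : k[X] →+* k}
    (h : p.left = Spec.map (CommRingCat.ofHom f)) : lineCoord p = f X := by
  rw [lineCoord, h]
  exact congr(($(Spec.preimage_map (CommRingCat.ofHom f))).hom X)

@[simp]
lemma lineCoord_linePoint {k : Type w} [Field k] (l : k) : lineCoord (linePoint l) = l :=
  (lineCoord_eq (f := evalRingHom l) rfl).trans (by simp)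

variable {K L : Type w} [Field K] [Field L] [Algebra K L]

lemma toPoint_eq {V : Variety L} {W : Variety K} (h : WeilRestriction V W) (w : W.Points) :
    h.toPoint w = baseChangePoint w ≫ h.homEquiv (𝟙 _) := by
  rw [WeilRestriction.toPoint, h.homEquiv_eq, baseChangePoint, Category.assoc]
  rfl

/-- The points of the affine line over `L` whose coordinate has coordinates over `K` in
`boundedSet n p`. -/
def boundedPoints {ι : Type w} (b : Module.Basis ι K L) (n : ℕ) (p : K) :
    Set (affineLine L).Points :=
  {x | ∀ i, b.repr (lineCoord x) i ∈ boundedSet n p}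

lemma isOpen_preimage_boundedPoints {ι : Type w} [Fintype ι] (b : Module.Basis ι K L) {n : ℕ}
    (hn : n ≠ 0) (p : K) {W : Variety K}
    (g : (baseChange K L).obj W.toOver ⟶ (affineLine L).toOver) :
    IsOpen[etaleOpen K W] {w : W.Points | baseChangePoint w ≫ g ∈ boundedPoints b n p} := by
  refine isOpen_etaleOpen_of_chart fun A _ _ j _ hj φ hφ ↦ ?_
  let r : Spec (CommRingCat.of (A ⊗[K] L)) ⟶ Spec (CommRingCat.of L[X]) :=
    baseChangeChart L j hj ≫ g.left
  let c : L[X] →+* A ⊗[K] L := (Spec.preimage r).hom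
  have hc : r = Spec.map (CommRingCat.ofHom c) := (Spec.map_preimage _).symm
  have hcoord : ∀ φ : A →ₐ[K] K, lineCoord (baseChangePoint (chartPoint j hj φ) ≫ g) =
      tensorPoint φ (c X) := fun φ ↦ by
    refine lineCoord_eq (f := (tensorPoint φ).comp c) ?_
    rw [Over.comp_left, baseChangePoint_chartPoint_left, CommRingCat.ofHom_comp, Spec.map_comp,
      ← hc, Category.assoc]
    rfl
  let a : ι → A := fun i ↦ (Algebra.TensorProduct.basis A b).repr (c X) i
  have ha : ∀ φ : A →ₐ[K] K, ∀ i, b.repr (tensorPoint φ (c X)) i = φ (a i) := fun φ i ↦ by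
    rw [← (Algebra.TensorProduct.basis A b).sum_repr (c X), map_sum]
    have h1 : ∀ i, tensorPoint (L := L) φ ((Algebra.TensorProduct.basis A b).repr (c X) i •
        Algebra.TensorProduct.basis A b i) = φ (a i) • b i := fun i ↦ by
      rw [Algebra.TensorProduct.basis_repr_symm_apply', tensorPoint_tmul, Algebra.smul_def]
    simp_rw [h1]
    rw [b.repr_sum_self]
  have hmem : ∀ φ : A →ₐ[K] K, baseChangePoint (chartPoint j hj φ) ≫ g ∈ boundedPoints b n p ↔
      ∀ i ∈ (Finset.univ : Finset ι), φ (a i) ∈ boundedSet n p := fun φ ↦ by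
    simp only [boundedPoints, Set.mem_ofPred_eq, hcoord, ha, Finset.mem_univ, true_imp_iff]
  obtain ⟨B, _, _, hB, h⟩ := exists_etale_forall_mem_boundedSet hn p Finset.univ a
  exact ⟨B, inferInstance, inferInstance, hB, (h φ).mpr ((hmem φ).mp hφ),
    fun φ' hφ' ↦ (hmem φ').mpr ((h φ').mp hφ')⟩

variable (K L) in
/-- The extension of the étale open topology refines the étale open topology. -/
theorem ext_etaleOpen_le [FiniteDimensional K L] (V : Variety L) :
    ext K L (etaleOpen K) V ≤ etaleOpen L V := by
  refine iSup_le fun V' ↦ iSup_le fun j ↦ iSup_le fun _ ↦ iSup_le fun W ↦ iSup_le fun h ↦ ?_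
  rw [← continuous_iff_coinduced_le]
  simp_rw [toPoint_eq, Category.assoc]
  exact continuous_baseChangePoint_comp _

lemma isOpen_ext_boundedPoints {ι : Type w} [Fintype ι] (b : Module.Basis ι K L) {n : ℕ}
    (hn : n ≠ 0) (p : K) :
    IsOpen[ext K L (etaleOpen K) (affineLine L)] (boundedPoints b n p) := by
  rw [ext]
  simp only [isOpen_iSup_iff, isOpen_coinduced]
  intro V' j _ W h
  simp_rw [toPoint_eq, Category.assoc]
  exact isOpen_preimage_boundedPoints b hn p _

end AffineLine

end EtaleOpen

namespace EtaleOpen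

open CategoryTheory CategoryTheory.Limits AlgebraicGeometry
open Polynomial IsLocalRing
open scoped Topology

section FractionField

variable {R : Type*} {L : Type w} [CommRing R] [Field L] [Algebra R L]

/-- A neighbourhood of the origin in the étale open topology contains a nonzero multiple of the
integral closure of a henselian local ring. -/
lemma exists_forall_linePoint_mem [HenselianLocalRing R] [FaithfulSMul R L] (hR : ¬ IsField R)
    (hL : ∀ x : L, ∃ d : R, d ≠ 0 ∧ IsIntegral R (algebraMap R L d * x))
    {O : Set (affineLine L).Points} (hO : IsOpen[etaleOpen L (affineLine L)] O)
    (h0 : linePoint 0 ∈ O) :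
    ∃ a : R, a ≠ 0 ∧ ∀ s : integralClosure R L, linePoint (algebraMap R L a * s) ∈ O := by
  have : IsDomain R := (FaithfulSMul.algebraMap_injective R L).isDomain
  induction hO with
  | univ => exact ⟨1, one_ne_zero, fun _ ↦ trivial⟩
  | inter U V _ _ hU hV =>
    obtain ⟨a, ha, hUa⟩ := hU h0.1
    obtain ⟨b, hb, hVb⟩ := hV h0.2
    refine ⟨a * b, mul_ne_zero ha hb, fun s ↦ ⟨?_, ?_⟩⟩
    · convert hUa (b • s) using 2
      rw [map_mul, mul_assoc, Subalgebra.coe_smul, Algebra.smul_def]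
    · convert hVb (a • s) using 2
      rw [map_mul, mul_comm (algebraMap R L a), mul_assoc, Subalgebra.coe_smul, Algebra.smul_def]
  | sUnion S _ h =>
    obtain ⟨U, hU, h0U⟩ := h0
    obtain ⟨a, ha, hUa⟩ := h U hU h0U
    exact ⟨a, ha, fun s ↦ ⟨U, hU, hUa s⟩⟩
  | basic U hU =>
    obtain ⟨X, f, hf, rfl⟩ := hU
    obtain ⟨x₀, hx₀⟩ := h0
    obtain ⟨E, _, i, e, hi, he⟩ := exists_affine_chart X.toOver.left x₀.left
    let fl : X.toOver.left ⟶ Spec (CommRingCat.of L[X]) := f.left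
    let : Algebra L[X] E := (Spec.preimage (i ≫ fl)).hom.toAlgebra
    have hE : Spec.map (CommRingCat.ofHom (algebraMap L[X] E)) = i ≫ fl :=
      Spec.map_preimage _
    have : Algebra.Etale L[X] E := by
      rw [← RingHom.etale_algebraMap]
      refine (HasRingHomProperty.Spec_iff (P := @Etale)
        (φ := CommRingCat.ofHom (algebraMap L[X] E))).mp ?_
      rw [hE]
      have : Etale fl := hf
      infer_instance
    have hpt : ∀ t (θ : E →+* L), θ.comp (algebraMap L[X] E) = evalRingHom t ↔
        (Spec.map (CommRingCat.ofHom θ) ≫ i) ≫ fl = (linePoint t).left := fun t θ ↦ by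
      rw [Category.assoc, ← hE, ← Spec.map_comp, ← CommRingCat.ofHom_comp]
      change _ ↔ _ = Spec.map (CommRingCat.ofHom (evalRingHom t))
      exact ⟨fun h ↦ by rw [h], fun h ↦ congr($(Spec.map_injective h).hom)⟩
    have he0 : e.comp (algebraMap L[X] E) = evalRingHom 0 := by
      rw [hpt, ← he]
      exact congr(($hx₀).left)
    let := (evalRingHom (0 : L)).toAlgebra
    obtain ⟨P, j, x, hx⟩ := exists_standardEtalePair_hasMap (R := L[X]) (B := E) (k := L)
      { e with commutes' := fun a ↦ congr($he0 a) }
    have hx1 : P.f.evalEval 0 x = 0 := by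
      rw [← eval₂_evalRingHom]
      exact hx.1
    have hx2 : (derivative P.f).evalEval 0 x ≠ 0 := by
      rw [← eval₂_evalRingHom]
      exact hx.isUnit_derivative_f.ne_zero
    have hx3 : P.g.evalEval 0 x ≠ 0 := by
      rw [← eval₂_evalRingHom]
      exact hx.2.ne_zero
    obtain ⟨a, ha, h⟩ := exists_evalEval_eq_zero hR hL hx1 hx2 hx3
    refine ⟨a, ha, fun s ↦ ?_⟩
    obtain ⟨y, hy⟩ := h s
    rw [← eval₂_evalRingHom] at hy
    obtain ⟨ψ, hψ⟩ := (exists_comp_algebraMap_eq_iff P _).mpr ⟨y, hy⟩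
    have hθ : (ψ.comp j.toRingHom).comp (algebraMap L[X] E) =
        evalRingHom (algebraMap R L a * s) := by
      rw [← hψ, RingHom.comp_assoc]
      congr 1
      exact j.comp_algebraMap
    rw [hpt] at hθ
    refine ⟨Over.homMk (Spec.map (CommRingCat.ofHom (ψ.comp j.toRingHom)) ≫ i) ?_, ?_⟩
    · rw [← Over.w f, ← Category.assoc]
      refine (congr($hθ ≫ (affineLine L).toOver.hom)).trans ?_
      exact Over.w (linePoint (algebraMap R L a * s))
    · ext1
      exact hθ

variable {K : Type w} [IsDomain R] [Field K] [Algebra R K] [IsFractionRing R K] [Algebra K L]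
  [IsScalarTower R K L]

/-- If a nonzero multiple of the integral closure has bounded coordinates, then the integral
closure is finite. -/
lemma finite_integralClosure_of_forall_repr [IsNoetherianRing R] {ι : Type*} [Finite ι]
    (b : Module.Basis ι K L) {a : R} (ha : a ≠ 0)
    (h : ∀ s : integralClosure R L, ∀ i, ∃ r, algebraMap R K r = b.repr (algebraMap R L a * s) i) :
    Module.Finite R (integralClosure R L) := by
  let N := LinearMap.range ((Algebra.linearMap R K).compLeft ι)
  let F : integralClosure R L →ₗ[R] ι → K :=
    (b.equivFun.toLinearMap.restrictScalars R) ∘ₗ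
      LinearMap.mulLeft R (algebraMap R L a) ∘ₗ (integralClosure R L).val.toLinearMap
  have hF : ∀ s, F s ∈ N := fun s ↦ by
    choose r hr using h s
    exact ⟨r, funext fun i ↦ hr i⟩
  have haL : algebraMap R L a ≠ 0 := by
    rw [IsScalarTower.algebraMap_apply R K L]
    simpa using ha
  refine Module.Finite.of_injective (F.codRestrict N hF) fun s t hst ↦ ?_
  have h1 : F s = F t := congr(($hst).1)
  exact Subtype.ext (mul_left_cancel₀ haL (b.equivFun.injective h1))

lemma not_isField_of_not_finite_integralClosure {R : Type*} {L : Type w} (K : Type w) [CommRing R]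
    [IsDomain R] [Field K] [Algebra R K] [IsFractionRing R K] [Field L] [Algebra K L]
    [FiniteDimensional K L] [Algebra R L] [IsScalarTower R K L]
    (hS : ¬ Module.Finite R (integralClosure R L)) : ¬ IsField R := fun hR ↦ hS <| by
  have : IsNoetherianRing R := by
    let := hR.toField
    infer_instance
  have hs : Function.Surjective (algebraMap R K) :=
    IsFractionRing.surjective_iff_isField.mpr hR
  exact finite_integralClosure_of_forall_repr (Module.Free.chooseBasis K L) (one_ne_zero (α := R))
    fun _ _ ↦ hs _

theorem not_isOpen_boundedPoints [FiniteDimensional K L] [HenselianLocalRing R]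
    [IsRegularLocalRing R] (hS : ¬ Module.Finite R (integralClosure R L)) {ι : Type w} [Finite ι]
    (b : Module.Basis ι K L) {n : ℕ} (hn : 3 ≤ n) (hnR : IsUnit (n : R)) {π : R}
    (hπ : π ∈ maximalIdeal R) (hπ' : π ∉ maximalIdeal R ^ 2) :
    ¬ IsOpen[etaleOpen L (affineLine L)] (boundedPoints b n (algebraMap R K π)) := fun hO ↦ by
  have : FaithfulSMul R L := by
    rw [faithfulSMul_iff_algebraMap_injective, IsScalarTower.algebraMap_eq R K L]
    exact (algebraMap K L).injective.comp (IsFractionRing.injective R K)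
  have hL : ∀ x : L, ∃ d : R, d ≠ 0 ∧ IsIntegral R (algebraMap R L d * x) := fun x ↦ by
    have := (IsFractionRing.isAlgebraic_iff R K L (x := x)).mpr (Algebra.IsAlgebraic.isAlgebraic x)
    obtain ⟨d, hd, h⟩ := this.exists_integral_multiple
    exact ⟨d, hd, by rwa [← Algebra.smul_def]⟩
  have hnK : (n : K) ≠ 0 := by
    simpa using (hnR.map (algebraMap R K)).ne_zero
  obtain ⟨a, ha, h⟩ := exists_forall_linePoint_mem
    (not_isField_of_not_finite_integralClosure K hS) hL hO fun i ↦ by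
      rw [lineCoord_linePoint, map_zero]
      exact zero_mem_boundedSet (by lia) hnK _
  refine hS (finite_integralClosure_of_forall_repr b ha fun s i ↦ ?_)
  have hi := h s i
  rw [lineCoord_linePoint] at hi
  obtain ⟨⟨y, hy, -⟩, ⟨y', hy', -⟩⟩ := hi
  exact exists_algebraMap_eq_of_equations hn hnR hπ hπ' hy hy'

end FractionField

end EtaleOpen

theorem theorem5p1 (R : Type v) (K L : Type u)
    [CommRing R] [IsDomain R] [HenselianLocalRing R] [IsRegularLocalRing R]
    [Field K] [Algebra R K] [IsFractionRing R K]
    [Field L] [Algebra K L] [FiniteDimensional K L]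
    [Algebra R L] [IsScalarTower R K L]
    (hS : ¬ Module.Finite R (integralClosure R L)) :
    EtaleOpen.StrictlyRefines
        (EtaleOpen.ext K L (EtaleOpen.etaleOpen K)) (EtaleOpen.etaleOpen L) ∧
      EtaleOpen.ext K L (EtaleOpen.etaleOpen K) (EtaleOpen.affineLine L) <
        EtaleOpen.etaleOpen L (EtaleOpen.affineLine L) := by
  obtain ⟨n, hn, hnR⟩ := EtaleOpen.exists_isUnit_natCast R
  obtain ⟨π, hπ, hπ'⟩ := EtaleOpen.exists_mem_maximalIdeal_notMem_sq
    (EtaleOpen.not_isField_of_not_finite_integralClosure K hS)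
  let b := Module.Free.chooseBasis K L
  have h : ¬ EtaleOpen.etaleOpen L (EtaleOpen.affineLine L) ≤
      EtaleOpen.ext K L (EtaleOpen.etaleOpen K) (EtaleOpen.affineLine L) := fun h ↦
    EtaleOpen.not_isOpen_boundedPoints hS b hn hnR hπ hπ'
      (h _ (EtaleOpen.isOpen_ext_boundedPoints b (Nat.ne_of_gt (by lia)) _))
  exact ⟨⟨EtaleOpen.ext_etaleOpen_le K L, fun h' ↦ h (h' _)⟩,
    lt_of_le_not_ge (EtaleOpen.ext_etaleOpen_le K L _) h⟩
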